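/- **Filling extremality of Banach spaces.** Let $n\ge 1$, let $A=(A,\|\cdot\|_A)$ be an $n$-dimensional real Banach space and let $U\subset A$ be a bounded open connected (non-empty) subset whose exterior $A\setminus\overline U$ is connected. Let $X$ be a compact metric space, $Y\subset X$ a closed subset, $F:Y\to\partial U$ a $1$-Lipschitz map (for the metric of $A$), and let $\mathbb F$ be an abelian group. Suppose that, in Čech cohomology, the restriction homomorphism $H^{n-1}(X;\mathbb F)\to H^{n-1}(Y;\mathbb F)$ vanishes, while $F^*:H^{n-1}(\partial U;\mathbb F)\to H^{n-1}(Y;\mathbb F)$ does not vanish. Then John's form $h_\diamond$ of $A$ exists and is unique, and $$\mathrm{Hil.vol}^{[n]}_{\mathbb F}(X)\ \ge\ \mathrm{Hil.vol}^{[n]}_{\mathbb F}(U)=\mathrm{vol}_{h_\diamond}(U),$$ where $U$ carries the metric of $A$ and $\mathrm{vol}_{h_\diamond}$ is Lebesgue measure normalized by the Euclidean structure $h_\diamond$. Definitions used. *Dilations.* An axial projector of $\mathbb R^n$ (Euclidean) is a pair $(v,l)$ of a unit vector $v$ and a linear form $l$ of norm $1$ with $l(v)=1$; $\mathcal P$ is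 the space of all of them. An axial partition of unity is a Borel measure $\mu$ on $\mathcal P$ with $\int_{\mathcal P} l(y)\,v\,d\mu=y$ for all $y$. For a map $f:X\to\mathbb R^n$ from a metric space put $$\mathrm{Hilb}(f)=n^{-1/2}\inf_\mu\Big(\int_{\mathcal P}\mathrm{Lip}^2(l\circ f)\,d\mu\Big)^{1/2},\qquad \widetilde{\mathrm{Hilb}}(f)=n^{-1/2}\inf_\mu\inf_{(g_p)}\Big(\int_{\mathcal P}\mathrm{Lip}^2(g_p)\,d\mu\Big)^{1/2},$$ with $\mu$ running over the axial partitions of unity and $(g_p)_{p\in\mathcal P}$ over the families of Lipschitz functions $g_p:X\to\mathbb R$ such that for each $x$ the function $p\mapsto g_p(x)$ is in $L_2(\mu)$ and $\int_{\mathcal P} g_p(x)\,v\,d\mu=f(x)$. *John's form* $h_\diamond$ is the positive definite quadratic form on $A$ such that $\|\cdot\|_{h_\diamond}\ge\|\cdot\|_A$ and $\mathrm{Hilb}(\mathrm{id}:(A,\|\cdot\|_A)\to(A,\|\cdot\|_{h_\diamond}))\le1$. *Hilbert Jacobian.* For $f:X\to\mathbb R^n$ and $x\in X$, $\widetilde{\mathrm{Hil}}\mathrm{Jac}^{[n]}f(x)=\inf\widetilde{\mathrm{Hilb}}{}^n(\varphi\circ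 f|_W)$ over all neighbourhoods $W$ of $x$ and all $C^1$ diffeomorphisms $\varphi$ of $\mathbb R^n$ onto open subsets of $\mathbb R^n$ with $|\det D\varphi|\ge1$ everywhere. *Stable points.* For a continuous $f:X\to\mathbb R^n$, a point $y\in\mathbb R^n$ is stable if for all sufficiently small closed neighbourhoods $V$ of $y$ the homomorphism $f^*:H^n(V,\partial V;\mathbb F)\to H^n(f^{-1}(V),f^{-1}(\partial V);\mathbb F)$ is non-zero. *Volume.* $\mathrm{glb.vol}_{\mathbb F}(X)$ is the supremum, over all Lipschitz maps $f:X\to\mathbb R^n$ with $\widetilde{\mathrm{Hil}}\mathrm{Jac}^{[n]}f(x)\le1$ for all $x\in X$, of the Lebesgue measure of the set of stable points of $f$. Finally $$\mathrm{Hil.vol}^{[n]}_{\mathbb F}(X)=\sup_{\mathcal U}\ \mathrm{mult}(\mathcal U)^{-1}\sum_i \mathrm{glb.vol}_{\mathbb F}(U_i),$$ over countable systems $\mathcal U=(U_i)$ of open subsets of $X$ whose intersection multiplicity $\mathrm{mult}(\mathcal U)$ (the maximal number of $U_i$ containing a common point) is finite. -/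

import Mathlib

open MeasureTheory Topology Set
open scoped NNReal ENNReal

noncomputable section

/-! ### Čech cohomology of pairs with coefficients in an abelian group

Open covers are indexed by the points of the space: a cover is a family `(U x)` of open sets with
`x ∈ U x`.  Such covers are cofinal among all open covers, they are directed under pointwise
inclusion, and refinement is then the identity on indices.  A simplex of the nerve is a tuple of
points `(x 0, …, x p)` with `⋂ i, U (x i) ≠ ∅`.  In the direct limit over all covers a cochain is a
function on tuples of points, modulo the functions vanishing on the nerve of some cover. -/

namespace Cech

variable {X Z : Type*} [TopologicalSpace X] [TopologicalSpace Z] {G : Type*} [AddCommGroup G]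

/-- Functions on `(p+1)`-tuples of points. -/
abbrev Cochain (X : Type*) (G : Type*) (p : ℕ) : Type _ := (Fin (p + 1) → X) → G

/-- The functions which vanish on the nerve of some open cover of the subspace `B`. -/
def null (G : Type*) [AddCommGroup G] (B : Set X) (p : ℕ) : AddSubgroup (Cochain X G p) where
  carrier := {φ | ∃ U : X → Set X, (∀ x, IsOpen (U x) ∧ x ∈ U x) ∧
    ∀ x : Fin (p + 1) → X, (∀ i, x i ∈ B) → (B ∩ ⋂ i, U (x i)).Nonempty → φ x = 0}
  zero_mem' := ⟨fun _ => univ, fun _ => ⟨isOpen_univ, mem_univ _⟩, fun _ _ _ => rfl⟩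
  add_mem' := by
    rintro φ ψ ⟨U, hU, hφ⟩ ⟨V, hV, hψ⟩
    refine ⟨fun x => U x ∩ V x,
      fun x => ⟨(hU x).1.inter (hV x).1, (hU x).2, (hV x).2⟩, fun x hx hne => ?_⟩
    obtain ⟨z, hzB, hz⟩ := hne
    rw [mem_iInter] at hz
    have h1 := hφ x hx ⟨z, hzB, mem_iInter.2 fun i => (hz i).1⟩
    have h2 := hψ x hx ⟨z, hzB, mem_iInter.2 fun i => (hz i).2⟩
    simp [h1, h2]
  neg_mem' := by
    rintro φ ⟨U, hU, hφ⟩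
    exact ⟨U, hU, fun x hx hne => by simp [hφ x hx hne]⟩

/-- The simplicial coboundary. -/
def d (X : Type*) (G : Type*) [AddCommGroup G] (p : ℕ) : Cochain X G p →+ Cochain X G (p + 1) where
  toFun φ := fun x => ∑ i : Fin (p + 2), (-1 : ℤ) ^ (i : ℕ) • φ (x ∘ i.succAbove)
  map_zero' := by ext x; simp
  map_add' φ ψ := by ext x; simp [smul_add, Finset.sum_add_distrib]

/-- Cocycles of the pair `(X, B)`: they vanish (in the limit) on `B` and have (in the limit)
zero coboundary on `X`. -/
def cocycles (G : Type*) [AddCommGroup G] (B : Set X) (p : ℕ) : AddSubgroup (Cochain X G p) :=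
  null G B p ⊓ (null G (univ : Set X) (p + 1)).comap (d X G p)

/-- Coboundaries of the pair `(X, B)`, including the cochains which are zero in the limit. -/
def coboundaries (G : Type*) [AddCommGroup G] (B : Set X) :
    (p : ℕ) → AddSubgroup (Cochain X G p)
  | 0 => null G (univ : Set X) 0
  | p + 1 => null G (univ : Set X) (p + 1) ⊔ (null G B p).map (d X G p)

/-- The Čech cohomology group `Hᵖ(X, B; G)`. The absolute group `Hᵖ(X; G)` is the case `B = ∅`. -/
abbrev H (p : ℕ) (B : Set X) (G : Type*) [AddCommGroup G] : Type _ :=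
  cocycles G B p ⧸ (coboundaries G B p).addSubgroupOf (cocycles G B p)

/-- Pull-back of cochains. -/
def pullback (f : X → Z) (G : Type*) [AddCommGroup G] (p : ℕ) :
    Cochain Z G p →+ Cochain X G p where
  toFun φ := fun x => φ (f ∘ x)
  map_zero' := rfl
  map_add' _ _ := rfl

theorem pullback_null (f : C(X, Z)) {B : Set X} {B' : Set Z} (hf : MapsTo f B B') {p : ℕ}
    {φ : Cochain Z G p} (hφ : φ ∈ null G B' p) : pullback f G p φ ∈ null G B p := by
  obtain ⟨U, hU, h⟩ := hφ
  refine ⟨fun x => f ⁻¹' U (f x), fun x => ⟨(hU _).1.preimage f.continuous, (hU _).2⟩, ?_⟩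
  rintro x hx ⟨z, hzB, hz⟩
  rw [mem_iInter] at hz
  exact h (f ∘ x) (fun i => hf (hx i)) ⟨f z, hf hzB, mem_iInter.2 hz⟩

theorem d_pullback (f : X → Z) (p : ℕ) (φ : Cochain Z G p) :
    d X G p (pullback f G p φ) = pullback f G (p + 1) (d Z G p φ) := rfl

theorem pullback_cocycles (f : C(X, Z)) {B : Set X} {B' : Set Z} (hf : MapsTo f B B') {p : ℕ}
    {φ : Cochain Z G p} (hφ : φ ∈ cocycles G B' p) : pullback f G p φ ∈ cocycles G B p := by
  refine ⟨pullback_null f hf hφ.1, ?_⟩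
  exact pullback_null (p := p + 1) f (mapsTo_univ _ _) hφ.2

theorem pullback_coboundaries (f : C(X, Z)) {B : Set X} {B' : Set Z} (hf : MapsTo f B B') {p : ℕ}
    {φ : Cochain Z G p} (hφ : φ ∈ coboundaries G B' p) :
    pullback f G p φ ∈ coboundaries G B p := by
  cases p with
  | zero => exact pullback_null f (mapsTo_univ _ _) hφ
  | succ p =>
    obtain ⟨φ₁, h₁, φ₂, ⟨ψ, hψ, rfl⟩, rfl⟩ := AddSubgroup.mem_sup.1 hφ
    refine AddSubgroup.mem_sup.2 ⟨_, pullback_null f (mapsTo_univ _ _) h₁, _,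
      ⟨pullback f G p ψ, pullback_null f hf hψ, rfl⟩, ?_⟩
    rw [d_pullback, map_add]

/-- Pull-back of cocycles. -/
def cocyclesMap (p : ℕ) (G : Type*) [AddCommGroup G] (f : C(X, Z)) {B : Set X} {B' : Set Z}
    (hf : MapsTo f B B') : cocycles G B' p →+ cocycles G B p :=
  ((pullback f G p).comp (cocycles G B' p).subtype).codRestrict _
    fun φ => pullback_cocycles f hf φ.2

/-- The homomorphism `f^* : Hᵖ(Z, B'; G) → Hᵖ(X, B; G)` induced by a continuous map of pairs
`f : (X, B) → (Z, B')`. -/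
def map (p : ℕ) (G : Type*) [AddCommGroup G] (f : C(X, Z)) {B : Set X} {B' : Set Z}
    (hf : MapsTo f B B') : H p B' G →+ H p B G :=
  QuotientAddGroup.map _ _ (cocyclesMap p G f hf) fun _ hφ =>
    AddSubgroup.mem_addSubgroupOf.2
      (pullback_coboundaries f hf (AddSubgroup.mem_addSubgroupOf.1 hφ))

/-- The homomorphism `f^* : Hᵖ(Z; G) → Hᵖ(X; G)` induced by a continuous map. -/
def mapAbs (p : ℕ) (G : Type*) [AddCommGroup G] (f : C(X, Z)) :
    H p (∅ : Set Z) G →+ H p (∅ : Set X) G :=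
  map p G f (mapsTo_empty _ _)

end Cech

namespace HilbertVolume

/-! ### Axial projectors, dilations -/

section Dilation

variable {X : Type*} [PseudoEMetricSpace X]
  {Y : Type*} [NormedAddCommGroup Y] [NormedSpace ℝ Y]

/-- Axial projectors `(a, p)` of a normed space: `a t = t • v` for a unit vector `v`, and
`p y = l y • v` for a linear form `l` of norm `1` with `l v = 1`. -/
def AxialProjector (Y : Type*) [NormedAddCommGroup Y] [NormedSpace ℝ Y] : Type _ :=
  {q : Y × StrongDual ℝ Y // ‖q.1‖ = 1 ∧ ‖q.2‖ = 1 ∧ q.2 q.1 = 1}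

instance : TopologicalSpace (AxialProjector Y) :=
  inferInstanceAs (TopologicalSpace
    {q : Y × StrongDual ℝ Y // ‖q.1‖ = 1 ∧ ‖q.2‖ = 1 ∧ q.2 q.1 = 1})

instance : MeasurableSpace (AxialProjector Y) := borel _

instance : BorelSpace (AxialProjector Y) := ⟨rfl⟩

/-- The unit vector spanning the axis. -/
def AxialProjector.axis (q : AxialProjector Y) : Y := q.1.1

/-- The projector, as a real-valued coordinate along the axis. -/
def AxialProjector.coord (q : AxialProjector Y) : StrongDual ℝ Y := q.1.2

/-- Axial partitions of unity: Borel measures on the space of axial projectors with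
`∫ p dμ = id`. -/
structure IsPartitionOfUnity (μ : Measure (AxialProjector Y)) : Prop where
  integrable : ∀ y : Y, Integrable (fun p : AxialProjector Y => p.coord y • p.axis) μ
  integral_eq : ∀ y : Y, ∫ p : AxialProjector Y, p.coord y • p.axis ∂μ = y

/-- The best Lipschitz constant of a real function. -/
def lip (f : X → ℝ) : ℝ≥0∞ := ⨅ (K : ℝ≥0) (_ : LipschitzWith K f), (K : ℝ≥0∞)

/-- The `L₂`-dilation `(∫ Lip²(p ∘ f) dμ)^{1/2}`. -/
def dil (μ : Measure (AxialProjector Y)) (f : X → Y) : ℝ≥0∞ :=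
  (∫⁻ p : AxialProjector Y, lip (fun x => p.coord (f x)) ^ 2 ∂μ) ^ (1 / 2 : ℝ)

/-- The minimal `L₂`-dilation, over all axial partitions of unity. -/
def minDil (f : X → Y) : ℝ≥0∞ :=
  ⨅ (μ : Measure (AxialProjector Y)) (_ : IsPartitionOfUnity μ), dil μ f

/-- The `L̃₂`-dilation: the infimum of `(∫ Lip²(g_p) dμ)^{1/2}` over all families of real functions
`g_p`, with `p ↦ g_p x` in `L₂(μ)` for every `x`, such that `f x = ∫ a_p (g_p x) dμ`.
The integral of `Lip²(g_p)` is taken through measurable bounds `Lip(g_p) ≤ L p`. -/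
def dilTilde (μ : Measure (AxialProjector Y)) (f : X → Y) : ℝ≥0∞ :=
  ⨅ (g : AxialProjector Y → X → ℝ) (L : AxialProjector Y → ℝ≥0) (_ : Measurable L)
    (_ : ∀ p, LipschitzWith (L p) (g p)) (_ : ∀ x, MemLp (fun p => g p x) 2 μ)
    (_ : ∀ x, ∫ p : AxialProjector Y, g p x • p.axis ∂μ = f x),
    (∫⁻ p : AxialProjector Y, (L p : ℝ≥0∞) ^ 2 ∂μ) ^ (1 / 2 : ℝ)

/-- The minimal `L̃₂`-dilation, over all axial partitions of unity. -/
def minDilTilde (f : X → Y) : ℝ≥0∞ :=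
  ⨅ (μ : Measure (AxialProjector Y)) (_ : IsPartitionOfUnity μ), dilTilde μ f

end Dilation

/-! ### Hilbert constants, Hilbert Jacobian, Hilbertian volume -/

section Volume

variable {X : Type*} [PseudoEMetricSpace X] {n : ℕ}

/-- The Hilbert constant `n^{-1/2} ‖min.dil^* f‖_{L₂}` of a map into Euclidean `n`-space. -/
def hilb (f : X → EuclideanSpace ℝ (Fin n)) : ℝ≥0∞ :=
  minDil f / (n : ℝ≥0∞) ^ (1 / 2 : ℝ)

/-- The Hilbert constant `n^{-1/2} ‖min.dil~^* f‖_{L₂}` of a map into Euclidean `n`-space. -/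
def hilbTilde (f : X → EuclideanSpace ℝ (Fin n)) : ℝ≥0∞ :=
  minDilTilde f / (n : ℝ≥0∞) ^ (1 / 2 : ℝ)

/-- Diffeomorphisms of Euclidean space onto an open subset of it, with Jacobian at least `1`. -/
structure IsExpandingDiffeo (φ : EuclideanSpace ℝ (Fin n) → EuclideanSpace ℝ (Fin n)) : Prop where
  contDiff : ContDiff ℝ 1 φ
  injective : Function.Injective φ
  one_le_jac : ∀ v, 1 ≤ |(fderiv ℝ φ v).det|

/-- The Hilbert Jacobian at `x` of a map into Euclidean `n`-space: the infimum of
`Hilb~ⁿ (φ ∘ f|_W)` over all neighbourhoods `W` of `x` and all diffeomorphisms `φ` with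
Jacobian at least `1`. -/
def hilJac (f : X → EuclideanSpace ℝ (Fin n)) (x : X) : ℝ≥0∞ :=
  ⨅ (W : Set X) (_ : W ∈ 𝓝 x) (φ : EuclideanSpace ℝ (Fin n) → EuclideanSpace ℝ (Fin n))
    (_ : IsExpandingDiffeo φ), hilbTilde (fun w : W => φ (f w)) ^ n

/-- The cohomologically stable points of a continuous map `f : X → ℝⁿ`: the points `y` such that for
all sufficiently small closed neighbourhoods `V` of `y` the homomorphism
`Hⁿ(V, ∂V; G) → Hⁿ(f⁻¹(V), f⁻¹(∂V); G)` does not vanish. -/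
def stableImage (G : Type*) [AddCommGroup G] (f : C(X, EuclideanSpace ℝ (Fin n))) :
    Set (EuclideanSpace ℝ (Fin n)) :=
  {y | ∃ W ∈ 𝓝 y, ∀ V ∈ 𝓝 y, IsClosed V → V ⊆ W →
    Cech.map n G (f.restrictPreimage V)
      (B := {x | f x.1 ∈ frontier V}) (B' := {v | v.1 ∈ frontier V}) (fun _ hx => hx) ≠ 0}

/-- The hyper-Hilbertian global `n`-volume of `X` over `ℝⁿ`. -/
def glbVol (G : Type*) [AddCommGroup G] (n : ℕ) (X : Type*) [PseudoEMetricSpace X] : ℝ≥0∞ :=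
  ⨆ (f : C(X, EuclideanSpace ℝ (Fin n))) (_ : ∃ K : ℝ≥0, LipschitzWith K f)
    (_ : ∀ x, hilJac f x ≤ 1), volume (stableImage G f)

/-- The intersection multiplicity of a countable system of open subsets. -/
def multiplicity (U : ℕ → TopologicalSpace.Opens X) : ℕ∞ :=
  ⨆ x : X, {i | x ∈ U i}.encard

/-- The Hilbertian volume `Hil.vol^{[n]}` with coefficients `G`: the supremum of
`mult(U)⁻¹ ∑ᵢ glbVol(Uᵢ)` over countable systems of open subsets of finite multiplicity. -/
def hilVol (G : Type*) [AddCommGroup G] (n : ℕ) (X : Type*) [PseudoEMetricSpace X] : ℝ≥0∞ :=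
  ⨆ (U : ℕ → TopologicalSpace.Opens X) (_ : multiplicity U ≠ ⊤),
    (∑' i, glbVol G n (U i)) / (multiplicity U : ℝ≥0∞)

end Volume

/-! ### John's form -/

section John

variable {A : Type*} [NormedAddCommGroup A] [NormedSpace ℝ A]

/-- `T` identifies `A`, with the quadratic form `h`, isometrically with Euclidean `n`-space. -/
def IsFrame {n : ℕ} (h : QuadraticForm ℝ A) (T : A ≃L[ℝ] EuclideanSpace ℝ (Fin n)) : Prop :=
  ∀ x, h x = ‖T x‖ ^ 2

/-- John's form of an `n`-dimensional Banach space: a Hilbert (positive definite) quadratic form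
`h` with `‖x‖_h ≥ ‖x‖` such that the identity map `(A, ‖·‖) → (A, ‖·‖_h)` has
`Hilb = n^{-1/2} ‖min.dil^* id‖_{L₂} ≤ 1`. -/
def IsJohnForm (n : ℕ) (h : QuadraticForm ℝ A) : Prop :=
  ∃ T : A ≃L[ℝ] EuclideanSpace ℝ (Fin n), IsFrame h T ∧ (∀ x, ‖x‖ ≤ ‖T x‖) ∧ hilb T ≤ 1

/-- The Euclidean volume of `s` for the positive definite form `h`. All isometric identifications
`T` of `(A, h)` with Euclidean space give the same value. -/
def formVol (n : ℕ) (h : QuadraticForm ℝ A) (s : Set A) : ℝ≥0∞ :=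
  ⨆ (T : A ≃L[ℝ] EuclideanSpace ℝ (Fin n)) (_ : IsFrame h T), volume (T '' s)

end John

end HilbertVolume

end

/-! John's theorem gives coordinates `T : A ≃ ℝⁿ` with `‖x‖ ≤ ‖T x‖` and a decomposition `y = ∑ c i
⟪v i, y⟫ v i` into unit vectors such that every `⟪v i, T ·⟫` has norm at most one on `A`. Everything
reduces to comparing both Hilbertian volumes with `volume (T '' U)`.

Upper bound for `U` (`hilVol_le_volume_image`). The inverse of `T` is 1-Lipschitz from the Euclidean
metric, so an admissible map becomes a Lipschitz map of a Euclidean domain. At a point of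
differentiability its determinant is at most its Hilbert Jacobian (`abs_det_le_hilJac`). The reason
is that averaging over a small ball bounds the sum of the singular values by `∫ Lip(g_p) dμ`, after
which AM-GM, Cauchy–Schwarz and the fact that `μ` has mass `n` finish the estimate. Since stable
points lie in the image, Rademacher's theorem and the area inequality bound their volume.

Lower bound for `X` (`exists_image_subset_stableImage`). The functions `⟪v i, T ∘ F⟫` on `Y` are
1-Lipschitz and extend to `X`. Recombining the extensions gives `f` with Hilbert constant at most
one and `f = T ∘ F` on `Y`. All points of `T '' U` are stable for `f`: suppose `f^*` vanished on
`Hⁿ(V, ∂V)` for a closed neighbourhood `V` inside `T '' U`. Any class of degree `n - 1` on the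
boundary extends to a large ball minus the interior of `V`, because the inside and the exterior of
the boundary are connected and neither is contained in that set (`extends_of_isCompact`). The
coboundary of the extension is a relative class of `(V, ∂V)`. As its pull-back vanishes, the
pulled-back class extends to all of `X` (`exists_extension_of_map_eq_zero`), hence dies on `Y`, so
`F^*` would be zero.

For `U` itself the map `T` is admissible, and its points are stable because `T` has a section and
the local cohomology of `ℝⁿ` is already known to be non-zero from the stability for `f`.

Čech cohomology is handled on compact metric spaces through functions on small tuples of points,
where discontinuous maps moving points little still induce chain homotopies. -/

open MeasureTheory Topology Set
open scoped NNReal ENNReal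

noncomputable section

/-! ### Coboundary and prism operators on functions of tuples -/

namespace Cech

variable {M N G : Type*} [AddCommGroup G]

/-- The simplicial coboundary, on functions of `p`-tuples of points, for all `p ≥ 0`. -/
def cobd {p : ℕ} : ((Fin p → M) → G) →+ ((Fin (p + 1) → M) → G) where
  toFun φ := fun x => ∑ i : Fin (p + 1), (-1 : ℤ) ^ (i : ℕ) • φ (x ∘ i.succAbove)
  map_zero' := by ext x; simp
  map_add' φ ψ := by ext x; simp [smul_add, Finset.sum_add_distrib]

theorem cobd_apply {p : ℕ} (φ : (Fin p → M) → G) (x : Fin (p + 1) → M) :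
    cobd φ x = ∑ i : Fin (p + 1), (-1 : ℤ) ^ (i : ℕ) • φ (x ∘ i.succAbove) := rfl

theorem d_eq_cobd {p : ℕ} (φ : Cochain M G p) : d M G p φ = cobd φ := rfl

/-- The face omitting `a` has sign `+1`; every other face keeps `a` and loses one sign. This cone
formula drives all inductions on the number of points. -/
theorem cobd_cons {p : ℕ} (φ : (Fin (p + 1) → M) → G) (a : M) (t : Fin (p + 1) → M) :
    cobd φ (Fin.cons a t : Fin (p + 2) → M) =
      φ t - cobd (fun s : Fin p → M => φ (Fin.cons a s : Fin (p + 1) → M)) t := by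
  rw [cobd_apply, Fin.sum_univ_succ, cobd_apply, sub_eq_add_neg, ← Finset.sum_neg_distrib]
  congr 1
  · simp only [Fin.val_zero, pow_zero, one_smul]
    congr 1
  · refine Finset.sum_congr rfl fun i _ => ?_
    have : (Fin.cons a t : Fin (p + 2) → M) ∘ i.succ.succAbove =
        (Fin.cons a (t ∘ i.succAbove) : Fin (p + 1) → M) := by
      ext j
      refine Fin.cases ?_ (fun j => ?_) j <;> simp
    rw [this, Fin.val_succ, pow_succ]
    simp

theorem cobd_comp {p : ℕ} (f : N → M) (φ : (Fin p → M) → G) :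
    cobd (fun x : Fin p → N => φ (f ∘ x)) = fun x => cobd φ (f ∘ x) := rfl

theorem cobd_cobd {p : ℕ} (φ : (Fin p → M) → G) : cobd (cobd φ) = 0 := by
  induction p with
  | zero =>
    ext x
    have : ∀ y z : Fin 0 → M, φ y = φ z := fun y z => congrArg φ (Subsingleton.elim _ _)
    simp only [cobd_apply, Fin.sum_univ_succ]
    simp [this _ default]
  | succ p ih =>
    ext x
    obtain ⟨a, t, rfl⟩ : ∃ a t, x = (Fin.cons a t : Fin (p + 3) → M) :=
      ⟨x 0, Fin.tail x, (Fin.cons_self_tail x).symm⟩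
    have h : (fun s : Fin (p + 1) → M => cobd φ (Fin.cons a s : Fin (p + 2) → M)) =
        φ - cobd (fun s : Fin p → M => φ (Fin.cons a s : Fin (p + 1) → M)) := by
      ext s; exact cobd_cons φ a s
    rw [cobd_cons, h, map_sub, ih]
    simp

/-- The prism operator of a map `σ : M → M`, a chain homotopy between the identity and `σ`. -/
def prism (σ : M → M) : (p : ℕ) → ((Fin (p + 1) → M) → G) → (Fin p → M) → G
  | 0, _ => 0
  | p + 1, φ => fun x => φ (Fin.cons (x 0) (σ ∘ x)) -
      prism σ p (fun s => φ (Fin.cons (x 0) s)) (Fin.tail x)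

theorem prism_sub (σ : M → M) {p : ℕ} (φ ψ : (Fin (p + 1) → M) → G) :
    prism σ p (φ - ψ) = prism σ p φ - prism σ p ψ := by
  induction p with
  | zero => simp [prism]
  | succ p ih =>
    ext x
    have := congrFun (ih (fun s => φ (Fin.cons (x 0) s)) (fun s => ψ (Fin.cons (x 0) s)))
      (Fin.tail x)
    simp only [prism, Pi.sub_apply] at this ⊢
    rw [show (fun s : Fin (p + 1) → M => φ (Fin.cons (x 0) s) - ψ (Fin.cons (x 0) s)) =
      (fun s => φ (Fin.cons (x 0) s)) - (fun s => ψ (Fin.cons (x 0) s)) from rfl, this]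
    abel

theorem prism_cons (σ : M → M) {p : ℕ} (φ : (Fin (p + 2) → M) → G) (a : M) (t : Fin p → M) :
    prism σ (p + 1) φ (Fin.cons a t) = φ (Fin.cons a (Fin.cons (σ a) (σ ∘ t))) -
      prism σ p (fun s => φ (Fin.cons a s)) t := by
  have : σ ∘ (Fin.cons a t : Fin (p + 1) → M) = Fin.cons (σ a) (σ ∘ t) := by
    ext j
    refine Fin.cases ?_ (fun j => ?_) j <;> simp
  simp [prism, this]

/-- Split off the first point `a` and apply the induction hypothesis to the slice `φ (a, ·)`; the
terms containing both `a` and `σ a` cancel. -/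
theorem cobd_prism (σ : M → M) {p : ℕ} (φ : (Fin (p + 1) → M) → G) (x : Fin (p + 1) → M) :
    cobd (prism σ p φ) x + prism σ (p + 1) (cobd φ) x = φ (σ ∘ x) - φ x := by
  induction p with
  | zero =>
    obtain ⟨a, t, rfl⟩ : ∃ a t, x = (Fin.cons a t : Fin 1 → M) :=
      ⟨x 0, Fin.tail x, (Fin.cons_self_tail x).symm⟩
    have h1 : σ ∘ (Fin.cons a t : Fin 1 → M) = Fin.cons (σ a) (σ ∘ t) := by
      ext j
      refine Fin.cases ?_ (fun j => ?_) j <;> simp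
    rw [prism_cons, cobd_cons, h1]
    have h2 : prism σ 0 φ = 0 := rfl
    have h3 : ∀ χ : (Fin 1 → M) → G, prism σ 0 χ t = 0 := fun _ => rfl
    rw [h2, h3, map_zero, cobd_apply, Fin.sum_univ_one]
    simp [Subsingleton.elim (σ ∘ t) t]
  | succ p ih =>
    obtain ⟨a, t, rfl⟩ : ∃ a t, x = (Fin.cons a t : Fin (p + 2) → M) :=
      ⟨x 0, Fin.tail x, (Fin.cons_self_tail x).symm⟩
    have h1 : σ ∘ (Fin.cons a t : Fin (p + 2) → M) = Fin.cons (σ a) (σ ∘ t) := by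
      ext j
      refine Fin.cases ?_ (fun j => ?_) j <;> simp
    set φa : (Fin (p + 1) → M) → G := fun s => φ (Fin.cons a s) with hφa
    have h2 : (fun s : Fin (p + 2) → M => cobd φ (Fin.cons a s)) = φ - cobd φa := by
      ext s; exact cobd_cons φ a s
    have h3 : (fun s : Fin p → M => prism σ (p + 1) φ (Fin.cons a s)) =
        (fun s => φa (Fin.cons (σ a) (σ ∘ s))) - prism σ p φa := by
      ext s; exact prism_cons σ φ a s
    rw [prism_cons, cobd_cons, cobd_cons, h1, h2, h3, prism_sub, map_sub, cobd_cons]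
    have h4 := ih φa t
    have h5 : cobd (fun s : Fin p → M => φa (Fin.cons (σ a) (σ ∘ s))) t =
      cobd (fun s : Fin p → M => φ (Fin.cons a (Fin.cons (σ a) s))) (σ ∘ t) := rfl
    simp only [Pi.sub_apply]
    rw [h5]
    have h7 : φa (σ ∘ t) = φ (Fin.cons a (σ ∘ t)) := rfl
    rw [← h7]
    have h6 : φa t = φ (Fin.cons a t) := rfl
    rw [← h6]
    rw [eq_comm, sub_eq_iff_eq_add] at h4
    rw [h4]
    abel

/-- The prism evaluates `φ` only on tuples whose entries are among the `x j` and `σ (x j)`.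
Smallness and support conditions on `φ` therefore pass to its prism. -/
theorem prism_eq_zero (σ : M → M) {p : ℕ} (φ : (Fin (p + 1) → M) → G) (x : Fin p → M)
    (h : ∀ w : Fin (p + 1) → M, (∀ i, ∃ j, w i = x j ∨ w i = σ (x j)) → φ w = 0) :
    prism σ p φ x = 0 := by
  induction p with
  | zero => rfl
  | succ p ih =>
    simp only [prism]
    rw [h, ih, sub_zero]
    · intro w hw
      refine h _ fun i => ?_
      refine Fin.cases ⟨0, by simp⟩ (fun i => ?_) i
      obtain ⟨j, hj⟩ := hw i
      exact ⟨j.succ, by simpa [Fin.tail] using hj⟩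
    · intro i
      refine Fin.cases ⟨0, by simp⟩ (fun i => ⟨i, by simp⟩) i

end Cech

/-! ### Cochains on small tuples of a metric space: homotopy, gluing and vanishing -/

namespace Cech

section Small

variable {M N G : Type*} [MetricSpace M] [MetricSpace N] [AddCommGroup G]

/-- `φ` vanishes on all sufficiently small tuples of points of `C`. -/
def IsNull (C : Set M) {p : ℕ} (φ : (Fin p → M) → G) : Prop :=
  ∃ δ > 0, ∀ x : Fin p → M, (∀ i, x i ∈ C) → (∀ i j, dist (x i) (x j) < δ) → φ x = 0

/-- On `C`, the cochain `φ` is a coboundary up to cochains vanishing on small tuples. -/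
def IsBdry (C : Set M) {p : ℕ} (φ : (Fin (p + 1) → M) → G) : Prop :=
  ∃ ψ : (Fin p → M) → G, IsNull C (φ - cobd ψ)

variable {C C₁ C₂ D : Set M} {p : ℕ}

theorem IsNull.mono {φ : (Fin p → M) → G} (h : IsNull D φ) (hCD : C ⊆ D) : IsNull C φ := by
  obtain ⟨δ, hδ, h⟩ := h
  exact ⟨δ, hδ, fun x hx => h x fun i => hCD (hx i)⟩

theorem isNull_of_eq_zero {φ : (Fin p → M) → G}
    (h : ∀ x : Fin p → M, (∀ i, x i ∈ C) → φ x = 0) : IsNull C φ :=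
  ⟨1, one_pos, fun x hx _ => h x hx⟩

theorem IsNull.add {φ ψ : (Fin p → M) → G} (hφ : IsNull C φ) (hψ : IsNull C ψ) :
    IsNull C (φ + ψ) := by
  obtain ⟨δ, hδ, hφ⟩ := hφ
  obtain ⟨ε, hε, hψ⟩ := hψ
  refine ⟨min δ ε, lt_min hδ hε, fun x hx h => ?_⟩
  rw [Pi.add_apply, hφ x hx fun i j => (h i j).trans_le (min_le_left _ _),
    hψ x hx fun i j => (h i j).trans_le (min_le_right _ _), add_zero]

theorem IsNull.neg {φ : (Fin p → M) → G} (hφ : IsNull C φ) : IsNull C (-φ) := by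
  obtain ⟨δ, hδ, hφ⟩ := hφ
  exact ⟨δ, hδ, fun x hx h => by rw [Pi.neg_apply, hφ x hx h, neg_zero]⟩

theorem IsNull.sub {φ ψ : (Fin p → M) → G} (hφ : IsNull C φ) (hψ : IsNull C ψ) :
    IsNull C (φ - ψ) := by
  rw [sub_eq_add_neg]; exact hφ.add hψ.neg

theorem IsNull.cobd {φ : (Fin p → M) → G} (hφ : IsNull C φ) : IsNull C (cobd φ) := by
  obtain ⟨δ, hδ, hφ⟩ := hφ
  refine ⟨δ, hδ, fun x hx h => ?_⟩
  rw [cobd_apply]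
  refine Finset.sum_eq_zero fun i _ => ?_
  rw [hφ (x ∘ i.succAbove) (fun j => hx _) (fun j k => h _ _), smul_zero]

theorem IsNull.comp {φ : (Fin p → M) → G} (hφ : IsNull C φ) {f : N → M} {C' : Set N} {K : ℝ≥0}
    (hf : LipschitzOnWith K f C') (hm : MapsTo f C' C) :
    IsNull C' (fun x : Fin p → N => φ (f ∘ x)) := by
  obtain ⟨δ, hδ, hφ⟩ := hφ
  have hK : (0 : ℝ) < K + 1 := by positivity
  refine ⟨δ / (K + 1), by positivity, fun x hx h => hφ _ (fun i => hm (hx i)) fun i j => ?_⟩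
  have h1 := hf.dist_le_mul _ (hx i) _ (hx j)
  have h2 := h i j
  rw [lt_div_iff₀ hK] at h2
  have h3 : (0:ℝ) ≤ dist (x i) (x j) := dist_nonneg
  simp only [Function.comp_apply]
  nlinarith

/-- No continuity of `σ` is needed: a displacement below `δ / 4` takes tuples of mesh below `δ / 4`
to tuples of mesh below `δ`. The bound `ε` is found before `σ`. -/
theorem IsNull.pull {φ : (Fin p → M) → G} (hφ : IsNull D φ) :
    ∃ ε > 0, ∀ (σ : M → M) (C : Set M), (∀ x ∈ C, σ x ∈ D ∧ dist x (σ x) < ε) →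
      IsNull C (fun x : Fin p → M => φ (σ ∘ x)) := by
  obtain ⟨δ, hδ, hφ⟩ := hφ
  refine ⟨δ / 4, by positivity, fun σ C hσ => ⟨δ / 4, by positivity, fun x hx h => ?_⟩⟩
  refine hφ _ (fun i => (hσ _ (hx i)).1) fun i j => ?_
  have h1 := (hσ _ (hx i)).2
  have h2 := (hσ _ (hx j)).2
  have h3 := dist_triangle4 (σ (x i)) (x i) (x j) (σ (x j))
  rw [dist_comm (σ (x i)) (x i)] at h3
  have := h i j
  simp only [Function.comp_apply]
  linarith

theorem IsNull.prism {φ : (Fin (p + 1) → M) → G} (hφ : IsNull C φ) :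
    ∃ ε > 0, ∀ (σ : M → M) (D : Set M), D ⊆ C → (∀ x ∈ D, σ x ∈ C ∧ dist x (σ x) < ε) →
      IsNull D (prism σ p φ) := by
  obtain ⟨δ, hδ, hφ⟩ := hφ
  refine ⟨δ / 4, by positivity, fun σ D hD hσ => ⟨δ / 4, by positivity, fun x hx h => ?_⟩⟩
  refine prism_eq_zero σ φ x fun w hw => ?_
  have key : ∀ i, ∃ j, w i ∈ C ∧ dist (w i) (x j) < δ / 4 := by
    intro i
    obtain ⟨j, hj | hj⟩ := hw i
    · exact ⟨j, hj ▸ hD (hx j), by rw [hj, dist_self]; positivity⟩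
    · refine ⟨j, hj ▸ (hσ _ (hx j)).1, ?_⟩
      rw [hj, dist_comm]; exact (hσ _ (hx j)).2
  refine hφ w (fun i => (key i).choose_spec.1) fun i i' => ?_
  obtain ⟨j, -, hj⟩ := key i
  obtain ⟨j', -, hj'⟩ := key i'
  have h3 := dist_triangle4 (w i) (x j) (x j') (w i')
  rw [dist_comm (x j') (w i')] at h3
  have := h j j'
  linarith

/-- A cocycle changes by a coboundary under pull-back by a map which moves points little. -/
theorem IsNull.homotopy {φ : (Fin (p + 1) → M) → G} (hφ : IsNull C (Cech.cobd φ)) :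
    ∃ ε > 0, ∀ (σ : M → M) (D : Set M), D ⊆ C → (∀ x ∈ D, σ x ∈ C ∧ dist x (σ x) < ε) →
      IsNull D ((fun x => φ (σ ∘ x)) - φ - Cech.cobd (Cech.prism σ p φ)) := by
  obtain ⟨ε, hε, h⟩ := hφ.prism
  refine ⟨ε, hε, fun σ D hD hσ => ?_⟩
  convert h σ D hD hσ using 1
  ext x
  simp only [Pi.sub_apply, ← cobd_prism]
  abel

theorem IsBdry.mono {φ : (Fin (p + 1) → M) → G} (h : IsBdry D φ) (hCD : C ⊆ D) : IsBdry C φ := by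
  obtain ⟨ψ, h⟩ := h
  exact ⟨ψ, h.mono hCD⟩

-- Cochains are arbitrary functions, so an arbitrary choice of a nearby point of `C` can play the
-- role of a neighbourhood retraction.
open scoped Classical in
theorem exists_near_retraction (C : Set M) {δ : ℝ} (hδ : 0 < δ) :
    ∃ σ : M → M, (∀ x ∈ C, σ x = x) ∧
      ∀ x ∈ Metric.thickening δ C, σ x ∈ C ∧ dist x (σ x) < δ := by
  refine ⟨fun x => if x ∈ C then x else
    if h : ∃ y ∈ C, dist x y < δ then h.choose else x, fun x hx => if_pos hx, fun x hx => ?_⟩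
  by_cases hxC : x ∈ C
  · simp [hxC, hδ]
  · have h := Metric.mem_thickening_iff.1 hx
    simp only [hxC, if_false, h, dif_pos]
    exact h.choose_spec

/-- Being a coboundary extends to a neighbourhood. -/
theorem IsBdry.exists_thickening {φ : (Fin (p + 1) → M) → G} (hφ : IsNull C (cobd φ))
    (hDC : D ⊆ C) (h : IsBdry D φ) : ∃ δ > 0, IsBdry (C ∩ Metric.thickening δ D) φ := by
  obtain ⟨ψ, hψ⟩ := h
  obtain ⟨ε₁, hε₁, h₁⟩ := hφ.homotopy
  obtain ⟨ε₂, hε₂, h₂⟩ := hψ.pull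
  obtain ⟨σ, -, hσ⟩ := exists_near_retraction D (lt_min hε₁ hε₂)
  -- Near `D` the cocycle `φ` differs from its pull-back by the coboundary of the prism, and the
  -- pull-back has primitive `ψ ∘ σ`.
  refine ⟨min ε₁ ε₂, lt_min hε₁ hε₂, (fun x => ψ (σ ∘ x)) - prism σ p φ, ?_⟩
  set C' := C ∩ Metric.thickening (min ε₁ ε₂) D
  have h₃ := h₂ σ C' fun x hx =>
    ⟨(hσ x hx.2).1, (hσ x hx.2).2.trans_le (min_le_right _ _)⟩
  have h₄ := h₁ σ C' inter_subset_left fun x hx =>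
    ⟨hDC (hσ x hx.2).1, (hσ x hx.2).2.trans_le (min_le_left _ _)⟩
  convert h₃.sub h₄ using 1
  rw [map_sub, cobd_comp]
  ext x
  simp only [Pi.sub_apply]
  abel

open scoped Classical in
/-- Two compact sets: points can be moved by little so that small tuples of points of the union
are moved into one of the two sets. -/
theorem exists_separating_map (h₁ : IsCompact C₁) (h₂ : IsCompact C₂) {η : ℝ} (hη : 0 < η) :
    ∃ σ : M → M, (∀ x ∈ C₁, σ x ∈ C₁) ∧ (∀ x ∈ C₂, σ x ∈ C₂) ∧ (∀ x, dist x (σ x) < η) ∧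
      ∃ δ > 0, ∀ (q : ℕ) (x : Fin q → M), (∀ i, x i ∈ C₁ ∪ C₂) → (∀ i j, dist (x i) (x j) < δ) →
        (∀ i, σ (x i) ∈ C₁) ∨ (∀ i, σ (x i) ∈ C₂) := by
  -- Removing a neighbourhood of `A ∩ B` from `A` leaves a compact set disjoint from `B`, hence at
  -- positive distance from it.
  have key : ∀ {A B : Set M}, IsCompact A → IsCompact B → ∃ δ > 0, ∀ x ∈ A, ∀ y ∈ B,
      dist x y < δ → ∃ z ∈ A ∩ B, dist x z < η := by
    intro A B hA hB
    have hd : Disjoint (A \ Metric.thickening η (A ∩ B)) B := by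
      rw [Set.disjoint_left]
      rintro x ⟨hxA, hx⟩ hxB
      exact hx (Metric.self_subset_thickening hη _ ⟨hxA, hxB⟩)
    obtain ⟨δ, hδ, h⟩ := hd.exists_thickenings (hA.diff Metric.isOpen_thickening) hB.isClosed
    refine ⟨δ, hδ, fun x hx y hy hxy => ?_⟩
    by_contra hcon
    have hx' : x ∈ A \ Metric.thickening η (A ∩ B) :=
      ⟨hx, fun hmem => hcon (Metric.mem_thickening_iff.1 hmem)⟩
    exact Set.disjoint_left.1 h (Metric.self_subset_thickening hδ _ hx')
      (Metric.mem_thickening_iff.2 ⟨y, hy, hxy⟩)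
  obtain ⟨δ₁, hδ₁, k₁⟩ := key h₁ h₂
  obtain ⟨δ₂, hδ₂, k₂⟩ := key h₂ h₁
  set σ : M → M := fun x => if h : ∃ z ∈ C₁ ∩ C₂, dist x z < η then h.choose else x with hσdef
  have hσ : ∀ x, (∃ z ∈ C₁ ∩ C₂, dist x z < η) → σ x ∈ C₁ ∩ C₂ ∧ dist x (σ x) < η := by
    intro x h
    simp only [hσdef, h, dif_pos]
    exact h.choose_spec
  have hσ' : ∀ x, (¬ ∃ z ∈ C₁ ∩ C₂, dist x z < η) → σ x = x := by
    intro x h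
    simp only [hσdef, h, dif_neg, not_false_eq_true]
  refine ⟨σ, fun x hx => ?_, fun x hx => ?_, fun x => ?_, min δ₁ δ₂, lt_min hδ₁ hδ₂,
    fun q x hx hxd => ?_⟩
  · by_cases h : ∃ z ∈ C₁ ∩ C₂, dist x z < η
    · exact (hσ x h).1.1
    · rwa [hσ' x h]
  · by_cases h : ∃ z ∈ C₁ ∩ C₂, dist x z < η
    · exact (hσ x h).1.2
    · rwa [hσ' x h]
  · by_cases h : ∃ z ∈ C₁ ∩ C₂, dist x z < η
    · exact (hσ x h).2
    · rwa [hσ' x h, dist_self]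
  · by_cases H₁ : ∀ i, x i ∈ C₁
    · left; intro i
      by_cases h : ∃ z ∈ C₁ ∩ C₂, dist (x i) z < η
      · exact (hσ _ h).1.1
      · rw [hσ' _ h]; exact H₁ i
    by_cases H₂ : ∀ i, x i ∈ C₂
    · right; intro i
      by_cases h : ∃ z ∈ C₁ ∩ C₂, dist (x i) z < η
      · exact (hσ _ h).1.2
      · rw [hσ' _ h]; exact H₂ i
    push Not at H₁ H₂
    obtain ⟨i, hi⟩ := H₁
    obtain ⟨j, hj⟩ := H₂
    have hi' := (hx i).resolve_left hi
    have hj' := (hx j).resolve_right hj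
    left; intro k
    -- A small tuple contained in neither set has a point in each, so all its points are near the
    -- intersection and `σ` sends them there.
    have : ∃ z ∈ C₁ ∩ C₂, dist (x k) z < η := by
      rcases hx k with hk | hk
      · exact k₁ _ hk _ hi' ((hxd _ _).trans_le (min_le_left _ _))
      · rw [inter_comm]
        exact k₂ _ hk _ hj' ((hxd _ _).trans_le (min_le_right _ _))
    exact (hσ _ this).1.1

/-- A cochain vanishing on small tuples of two compact sets vanishes on small tuples of the union
after moving points by little. -/
theorem IsNull.union (h₁ : IsCompact C₁) (h₂ : IsCompact C₂) {φ : (Fin p → M) → G}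
    (hφ₁ : IsNull C₁ φ) (hφ₂ : IsNull C₂ φ) {η : ℝ} (hη : 0 < η) :
    ∃ σ : M → M, (∀ x ∈ C₁, σ x ∈ C₁) ∧ (∀ x ∈ C₂, σ x ∈ C₂) ∧
      (∀ x, dist x (σ x) < η) ∧ IsNull (C₁ ∪ C₂) (fun x : Fin p → M => φ (σ ∘ x)) := by
  obtain ⟨δ₁, hδ₁, hφ₁⟩ := hφ₁
  obtain ⟨δ₂, hδ₂, hφ₂⟩ := hφ₂
  set δ := min δ₁ δ₂ with hδdef
  have hδ : 0 < δ := lt_min hδ₁ hδ₂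
  obtain ⟨σ, s₁, s₂, s₃, ε, hε, hs⟩ := exists_separating_map h₁ h₂
    (lt_min hη (show 0 < δ / 4 by positivity))
  refine ⟨σ, s₁, s₂, fun x => (s₃ x).trans_le (min_le_left _ _), min ε (δ / 4),
    lt_min hε (by positivity), fun x hx hxd => ?_⟩
  have hd : ∀ i j, dist ((σ ∘ x) i) ((σ ∘ x) j) < δ := by
    intro i j
    have a₁ := (s₃ (x i)).trans_le (min_le_right _ _)
    have a₂ := (s₃ (x j)).trans_le (min_le_right _ _)
    have a₃ := (hxd i j).trans_le (min_le_right _ _)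
    have a₄ := dist_triangle4 (σ (x i)) (x i) (x j) (σ (x j))
    rw [dist_comm (σ (x i)) (x i)] at a₄
    simp only [Function.comp_apply]
    linarith
  rcases hs _ x hx fun i j => (hxd i j).trans_le (min_le_left _ _) with h | h
  · exact hφ₁ _ h fun i j => (hd i j).trans_le (min_le_left _ _)
  · exact hφ₂ _ h fun i j => (hd i j).trans_le (min_le_right _ _)

/-- Small tuples of the union need not lie in one piece; a small separating displacement puts them
there, and the prism pays for the displacement. -/
theorem isBdry_union (h₁ : IsCompact C₁) (h₂ : IsCompact C₂) {φ : (Fin (p + 1) → M) → G}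
    (hφ : IsNull (C₁ ∪ C₂) (cobd φ)) {ψ : (Fin p → M) → G} (hψ₁ : IsNull C₁ (φ - cobd ψ))
    (hψ₂ : IsNull C₂ (φ - cobd ψ)) : IsBdry (C₁ ∪ C₂) φ := by
  obtain ⟨ε, hε, h⟩ := hφ.homotopy
  obtain ⟨σ, s₁, s₂, s₃, hσ⟩ := hψ₁.union h₁ h₂ hψ₂ hε
  refine ⟨(fun x => ψ (σ ∘ x)) - prism σ p φ, ?_⟩
  have := h σ _ subset_rfl fun x hx => ⟨hx.imp (s₁ x) (s₂ x), s₃ x⟩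
  convert hσ.sub this using 1
  rw [map_sub, cobd_comp]
  ext x
  simp only [Pi.sub_apply]
  abel

open scoped Classical in
/-- Gluing of two primitives of a cocycle which differ by a global cocycle on the intersection. -/
theorem isBdry_union_of_sub (h₁ : IsCompact C₁) (h₂ : IsCompact C₂) {φ : (Fin (p + 1) → M) → G}
    (hφ : IsNull (C₁ ∪ C₂) (cobd φ)) {ψ₁ ψ₂ χ : (Fin p → M) → G} (hψ₁ : IsNull C₁ (φ - cobd ψ₁))
    (hψ₂ : IsNull C₂ (φ - cobd ψ₂)) (hχ : cobd χ = 0) (h : IsNull (C₁ ∩ C₂) (ψ₁ - ψ₂ - χ)) :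
    IsBdry (C₁ ∪ C₂) φ := by
  -- On small tuples of the intersection both branches agree, so `ψ` is equivalent to `ψ₂` on all of
  -- `C₂`; subtracting `χ` does not change the coboundary on `C₁`.
  set ψ : (Fin p → M) → G := fun x => if ∀ i, x i ∈ C₁ then ψ₁ x - χ x else ψ₂ x with hψ
  refine isBdry_union h₁ h₂ hφ (ψ := ψ) ?_ ?_
  · have : IsNull C₁ (ψ - (ψ₁ - χ)) := isNull_of_eq_zero fun x hx => by simp [hψ, hx]
    convert hψ₁.sub this.cobd using 1
    rw [map_sub, map_sub, hχ]
    abel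
  · have : IsNull C₂ (ψ - ψ₂) := by
      obtain ⟨δ, hδ, h⟩ := h
      refine ⟨δ, hδ, fun x hx hxd => ?_⟩
      by_cases hx₁ : ∀ i, x i ∈ C₁
      · have := h x (fun i => ⟨hx₁ i, hx i⟩) hxd
        simp only [Pi.sub_apply] at this
        simp only [hψ, hx₁, implies_true, if_true, Pi.sub_apply, ← this]
        abel
      · simp [hψ, hx₁]
    convert hψ₂.sub this.cobd using 1
    rw [map_sub]
    abel

/-- A cocycle which is a coboundary on each slice of a real function is a coboundary, if all
cocycles of one degree less of the slices are restrictions of global ones. -/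
theorem isBdry_of_slices (hC : IsCompact C) {g : M → ℝ} (hg : ContinuousOn g C)
    {φ : (Fin (p + 1) → M) → G} (hφ : IsNull C (cobd φ))
    (ha : ∀ t, IsBdry (C ∩ g ⁻¹' {t}) φ)
    (hb : ∀ (t : ℝ) (χ : (Fin p → M) → G), IsNull (C ∩ g ⁻¹' {t}) (cobd χ) →
      ∃ χ' : (Fin p → M) → G, cobd χ' = 0 ∧ IsNull (C ∩ g ⁻¹' {t}) (χ - χ')) : IsBdry C φ := by
  have hcomp : ∀ {S : Set ℝ}, IsClosed S → IsCompact (C ∩ g ⁻¹' S) := fun hS =>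
    hC.of_isClosed_subset (hg.preimage_isClosed_of_isClosed hC.isClosed hS) inter_subset_left
  choose δ hδ hδ' using fun t => (ha t).exists_thickening hφ inter_subset_left
  -- The levels whose whole slice lies in the neighbourhood of the slice at `t` where `φ` bounds.
  -- Compactness makes this set open, so finitely many intervals of such levels cover the range of
  -- `g`.
  set c : ℝ → Set ℝ := fun t => (g '' (C \ Metric.thickening (δ t) (C ∩ g ⁻¹' {t})))ᶜ with hc
  have hco : ∀ t, IsOpen (c t) := fun t =>
    ((hC.diff Metric.isOpen_thickening).image_of_continuousOn
      (hg.mono sdiff_subset)).isClosed.isOpen_compl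
  have hct : ∀ t, t ∈ c t := by
    rintro t ⟨x, ⟨hx, hx'⟩, hxt⟩
    exact hx' (Metric.self_subset_thickening (hδ t) _ ⟨hx, hxt⟩)
  have hcb : ∀ t S, S ⊆ c t → IsBdry (C ∩ g ⁻¹' S) φ := by
    intro t S hS
    refine (hδ' t).mono fun x hx => ⟨hx.1, ?_⟩
    by_contra hcon
    exact hS hx.2 ⟨x, ⟨hx.1, hcon⟩, rfl⟩
  obtain ⟨R, hR⟩ := (hC.image_of_continuousOn hg).isBounded.subset_closedBall 0
  set b : ℝ := max R 0 with hbdef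
  have hgb : ∀ x ∈ C, g x ∈ Icc (-b) b := by
    intro x hx
    have := hR ⟨x, hx, rfl⟩
    rw [mem_closedBall_zero_iff, Real.norm_eq_abs] at this
    exact abs_le.1 (this.trans (le_max_left _ _))
  have hb0 : -b ≤ b := by have : 0 ≤ b := le_max_right _ _; linarith
  obtain ⟨t, ht0, htm, ⟨m, hm⟩, ht⟩ := exists_monotone_Icc_subset_open_cover_Icc hb0
    (c := fun t => (Subtype.val ⁻¹' c t : Set (Icc (-b) b)))
    (fun t => (hco t).preimage continuous_subtype_val)
    (fun t _ => mem_iUnion.2 ⟨t, hct t⟩)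
  have hstep : ∀ k, IsBdry (C ∩ g ⁻¹' Icc (t k : ℝ) (t (k + 1))) φ := by
    intro k
    obtain ⟨i, hi⟩ := ht k
    refine hcb i _ fun s hs => ?_
    exact hi (a := ⟨s, (t k).2.1.trans hs.1, hs.2.trans (t (k + 1)).2.2⟩) ⟨hs.1, hs.2⟩
  have hall : ∀ k, IsBdry (C ∩ g ⁻¹' Icc (-b) (t k)) φ := by
    intro k
    induction k with
    | zero =>
      rw [ht0]
      exact (ha (-b)).mono (by simp)
    | succ k ih =>
      have htk : (t k : ℝ) ≤ t (k + 1) := htm (Nat.le_succ k)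
      have hun : C ∩ g ⁻¹' Icc (-b) (t (k + 1)) =
          (C ∩ g ⁻¹' Icc (-b) (t k)) ∪ (C ∩ g ⁻¹' Icc (t k : ℝ) (t (k + 1))) := by
        rw [← inter_union_distrib_left, ← preimage_union, Icc_union_Icc_eq_Icc (t k).2.1 htk]
      have hin : (C ∩ g ⁻¹' Icc (-b) (t k)) ∩ (C ∩ g ⁻¹' Icc (t k : ℝ) (t (k + 1))) ⊆
          C ∩ g ⁻¹' {(t k : ℝ)} := by
        rintro x ⟨⟨hx, h1⟩, -, h2⟩
        exact ⟨hx, le_antisymm h1.2 h2.1⟩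
      have hin' : C ∩ g ⁻¹' {(t k : ℝ)} ⊆
          (C ∩ g ⁻¹' Icc (-b) (t k)) ∩ (C ∩ g ⁻¹' Icc (t k : ℝ) (t (k + 1))) := by
        rintro x ⟨hx, h1 : g x = t k⟩
        refine ⟨⟨hx, ?_⟩, hx, ?_⟩
        · simp only [mem_preimage, h1]; exact ⟨(t k).2.1, le_rfl⟩
        · simp only [mem_preimage, h1]; exact ⟨le_rfl, htk⟩
      obtain ⟨ψ₁, h₁⟩ := ih
      obtain ⟨ψ₂, h₂⟩ := hstep k
      -- Consecutive slabs meet in a single slice, where the two primitives differ by a cocycle. Its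
      -- global extension allows the gluing.
      obtain ⟨χ, hχ, hχ'⟩ := hb (t k) (ψ₁ - ψ₂) (by
        convert (h₂.mono (hin'.trans inter_subset_right)).sub
          (h₁.mono (hin'.trans inter_subset_left)) using 1
        rw [map_sub]; abel)
      rw [hun]
      refine isBdry_union_of_sub (hcomp isClosed_Icc) (hcomp isClosed_Icc)
        (hφ.mono (union_subset inter_subset_left inter_subset_left)) h₁ h₂ hχ (hχ'.mono hin)
  refine (hall m).mono fun x hx => ⟨hx, ?_⟩
  rw [hm m le_rfl]
  exact hgb x hx

/-- The cone over the single point is a contracting homotopy. -/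
theorem isBdry_of_subsingleton (hC : C.Subsingleton) {φ : (Fin (p + 2) → M) → G}
    (hφ : IsNull C (cobd φ)) : IsBdry C φ := by
  rcases hC.eq_empty_or_singleton with rfl | ⟨a, rfl⟩
  · exact ⟨0, isNull_of_eq_zero fun x hx => (hx 0).elim⟩
  obtain ⟨δ, hδ, hφ⟩ := hφ
  refine ⟨fun s => φ (Fin.cons a s), isNull_of_eq_zero fun x hx => ?_⟩
  have hc : ∀ i, (Fin.cons a x : Fin (p + 3) → M) i = a := fun i =>
    Fin.cases rfl (fun i => hx i) i
  have := hφ (Fin.cons a x) hc fun i j => by rw [hc, hc, dist_self]; exact hδ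
  rwa [cobd_cons] at this

/-- Compact sets with `k` continuous functions separating points have no cohomology in the positive
degrees `≥ k`. -/
theorem isBdry_of_injOn {k : ℕ} (hC : IsCompact C) {g : M → Fin k → ℝ} (hg : ContinuousOn g C)
    (hgi : InjOn g C) {p : ℕ} (hp : k ≤ p + 1) {φ : (Fin (p + 2) → M) → G}
    (hφ : IsNull C (cobd φ)) : IsBdry C φ := by
  induction k generalizing C p with
  | zero =>
    exact isBdry_of_subsingleton (fun x hx y hy => hgi hx hy (Subsingleton.elim _ _)) hφ
  | succ k ih =>
    have hg0 : ContinuousOn (fun x => g x 0) C := (continuous_apply 0).comp_continuousOn hg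
    have hgt : ContinuousOn (fun x => Fin.tail (g x)) C :=
      (continuous_pi fun i => continuous_apply _).comp_continuousOn hg
    have hsl : ∀ t, IsCompact (C ∩ (fun x => g x 0) ⁻¹' {t}) := fun t =>
      hC.of_isClosed_subset (hg0.preimage_isClosed_of_isClosed hC.isClosed isClosed_singleton)
        inter_subset_left
    have hinj : ∀ t, InjOn (fun x => Fin.tail (g x)) (C ∩ (fun x => g x 0) ⁻¹' {t}) := by
      rintro t x ⟨hx, hxt : g x 0 = t⟩ y ⟨hy, hyt : g y 0 = t⟩ hxy
      refine hgi hx hy ?_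
      rw [← Fin.cons_self_tail (g x), ← Fin.cons_self_tail (g y), hxt, hyt]
      exact congrArg _ hxy
    refine isBdry_of_slices hC hg0 hφ (fun t => ?_) fun t χ hχ => ?_
    · exact ih (hsl t) (hgt.mono inter_subset_left) (hinj t) (by omega)
        (hφ.mono inter_subset_left)
    -- Cocycles of the slices must extend globally. In degree zero the slice has at most one point
    -- and a constant extends the cochain. In higher degree the induction hypothesis writes it as
    -- `cobd ω`, which is a cocycle everywhere.
    · rcases p with _ | p
      · have hk : k = 0 := by omega
        subst hk
        have hsub : (C ∩ (fun x => g x 0) ⁻¹' {t}).Subsingleton := fun x hx y hy =>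
          hinj t hx hy (Subsingleton.elim _ _)
        rcases hsub.eq_empty_or_singleton with he | ⟨a, ha⟩
        · exact ⟨0, map_zero _, isNull_of_eq_zero fun x hx => by
            rw [he] at hx; exact (hx 0).elim⟩
        · refine ⟨fun _ => χ fun _ => a, ?_, isNull_of_eq_zero fun x hx => ?_⟩
          · ext x
            simp [cobd_apply, Fin.sum_univ_succ]
          · rw [ha] at hx
            have : x = fun _ => a := funext hx
            simp [this]
      · obtain ⟨ω, hω⟩ := ih (hsl t) (hgt.mono inter_subset_left) (hinj t) (by omega) hχ
        exact ⟨cobd ω, cobd_cobd ω, hω⟩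

end Small
end Cech

/-! ### Extension of codimension-one classes in Euclidean space -/

namespace Cech

section Extension

variable {M G : Type*} [MetricSpace M] [AddCommGroup G] {p : ℕ}

/-- The class of `φ` on `K` extends to `C`. -/
def Extends (φ : (Fin p → M) → G) (K C : Set M) : Prop :=
  ∃ b : (Fin p → M) → G, IsNull C (cobd b) ∧ IsNull K (b - φ)

/-- Pull back along a near retraction that fixes `C`. This continuity property supplies the chain
condition in Zorn's lemma. -/
theorem Extends.exists_thickening {φ : (Fin p → M) → G} {K C : Set M} (hKC : K ⊆ C)
    (h : Extends φ K C) : ∃ δ > 0, Extends φ K (Metric.thickening δ C) := by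
  obtain ⟨b, hb, hbφ⟩ := h
  obtain ⟨ε, hε, h⟩ := hb.pull
  obtain ⟨σ, hσ, hσ'⟩ := exists_near_retraction C hε
  refine ⟨ε, hε, fun x => b (σ ∘ x), h σ _ hσ', ?_⟩
  have : IsNull K ((fun x : Fin p → M => b (σ ∘ x)) - b) := isNull_of_eq_zero fun x hx => by
    have : σ ∘ x = x := funext fun i => hσ _ (hKC (hx i))
    simp [this]
  convert this.add hbφ using 1
  abel

-- On the intersection the extended class is some `cobd ω`, which makes sense on all of `C₂`. The
-- patched cochain is a cocycle on each piece, and the prism correction makes it one on the union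
-- without changing its values on small tuples of `K`.
open scoped Classical in
theorem Extends.union {φ : (Fin (p + 1) → M) → G} {K C₁ C₂ : Set M} (h₁ : IsCompact C₁)
    (h₂ : IsCompact C₂) (hK : K ⊆ C₁) (h : Extends φ K C₁)
    (hz : ∀ b : (Fin (p + 1) → M) → G, IsNull (C₁ ∩ C₂) (cobd b) → IsBdry (C₁ ∩ C₂) b) :
    Extends φ K (C₁ ∪ C₂) := by
  obtain ⟨b₁, hb₁, hbφ⟩ := h
  obtain ⟨ω, hω⟩ := hz b₁ (hb₁.mono inter_subset_left)
  set b : (Fin (p + 1) → M) → G := fun x => if ∀ i, x i ∈ C₁ then b₁ x else cobd ω x with hb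
  have e₁ : IsNull C₁ (b - b₁) := isNull_of_eq_zero fun x hx => by simp [hb, hx]
  have e₂ : IsNull C₂ (b - cobd ω) := by
    obtain ⟨δ, hδ, h⟩ := hω
    refine ⟨δ, hδ, fun x hx hxd => ?_⟩
    by_cases hx₁ : ∀ i, x i ∈ C₁
    · simpa [hb, hx₁] using h x (fun i => ⟨hx₁ i, hx i⟩) hxd
    · simp [hb, hx₁]
  have n₁ : IsNull C₁ (cobd b) := by
    convert e₁.cobd.add hb₁ using 1
    rw [map_sub]; abel
  have n₂ : IsNull C₂ (cobd b) := by
    convert e₂.cobd using 1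
    rw [map_sub, cobd_cobd, sub_zero]
  obtain ⟨ε, hε, h⟩ := n₁.homotopy
  obtain ⟨σ, s₁, -, s₃, hσ⟩ := n₁.union h₁ h₂ n₂ hε
  refine ⟨(fun x => b (σ ∘ x)) - cobd (prism σ p b), ?_, ?_⟩
  · rw [map_sub, cobd_cobd, sub_zero, cobd_comp]
    exact hσ
  · have := h σ _ subset_rfl fun x hx => ⟨s₁ x hx, s₃ x⟩
    convert ((this.add e₁).mono hK).add hbφ using 1
    abel

end Extension

section Euclidean

variable {G : Type*} [AddCommGroup G] {k : ℕ}

/-- Stereographic projection from the missing point `y` supplies `k + 1` continuous coordinates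
separating the points of `C`, and the degree is `k + 1`. -/
theorem isBdry_of_subset_sphere {C : Set (EuclideanSpace ℝ (Fin (k + 2)))} (hC : IsCompact C)
    {x y : EuclideanSpace ℝ (Fin (k + 2))} (hxy : x ≠ y) (hCs : C ⊆ Metric.sphere x (dist y x))
    (hy : y ∉ C) {φ : (Fin (k + 2) → EuclideanSpace ℝ (Fin (k + 2))) → G}
    (hφ : IsNull C (cobd φ)) : IsBdry C φ := by
  set r := dist y x with hr
  have hr0 : 0 < r := dist_pos.2 hxy.symm
  set v : EuclideanSpace ℝ (Fin (k + 2)) := r⁻¹ • (y - x) with hv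
  have hv1 : ‖v‖ = 1 := by
    rw [hv, norm_smul, ← dist_eq_norm, ← hr, norm_inv, Real.norm_of_nonneg hr0.le,
      inv_mul_cancel₀ hr0.ne']
  have hv0 : v ≠ 0 := by rintro h; simp [h] at hv1
  have : Fact (Module.finrank ℝ (EuclideanSpace ℝ (Fin (k + 2))) = (k + 1) + 1) := ⟨by simp⟩
  set B := OrthonormalBasis.fromOrthogonalSpanSingleton (𝕜 := ℝ) (k + 1) hv0
  set τ : EuclideanSpace ℝ (Fin (k + 2)) → EuclideanSpace ℝ (Fin (k + 2)) :=
    fun z => r⁻¹ • (z - x) with hτ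
  have hτinj : Function.Injective τ := fun z w h => by
    have := smul_right_injective _ (inv_ne_zero hr0.ne') h
    simpa using this
  have hτ1 : ∀ z ∈ C, ‖τ z‖ = 1 := by
    intro z hz
    have : dist z x = r := hCs hz
    rw [hτ, norm_smul, ← dist_eq_norm, this, norm_inv, Real.norm_of_nonneg hr0.le,
      inv_mul_cancel₀ hr0.ne']
  have hτv : ∀ z ∈ C, τ z ≠ v := by
    intro z hz h
    have : z = y := hτinj h
    exact hy (this ▸ hz)
  refine isBdry_of_injOn (k := k + 1) hC
    (g := fun z i => B.repr (stereoToFun v (τ z)) i) ?_ ?_ le_rfl hφ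
  · have h1 : ContinuousOn (fun z => stereoToFun v (τ z)) C := by
      refine (continuousOn_stereoToFun (v := v)).comp (by fun_prop) fun z hz => ?_
      simp only [mem_ofPred_eq, innerSL_apply_apply]
      intro h
      exact hτv z hz ((inner_eq_one_iff_of_norm_eq_one hv1 (hτ1 z hz)).1 h).symm
    have h2 := B.repr.continuous.comp_continuousOn h1
    exact continuousOn_pi.2 fun i => by
      exact (EuclideanSpace.proj (𝕜 := ℝ) i).continuous.comp_continuousOn h2
  · intro z hz w hw h
    have h1 : stereoToFun v (τ z) = stereoToFun v (τ w) := by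
      apply B.repr.injective
      ext i
      exact congrFun h i
    have hz' := stereo_left_inv hv1 (x := ⟨τ z, by simpa using hτ1 z hz⟩)
      fun h => hτv z hz h
    have hw' := stereo_left_inv hv1 (x := ⟨τ w, by simpa using hτ1 w hw⟩)
      fun h => hτv w hw h
    simp only at hz' hw'
    rw [h1, hw'] at hz'
    exact hτinj (Subtype.ext_iff.1 hz').symm

theorem isBdry_of_isCompact {C : Set (EuclideanSpace ℝ (Fin (k + 2)))} (hC : IsCompact C)
    {φ : (Fin (k + 3) → EuclideanSpace ℝ (Fin (k + 2))) → G}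
    (hφ : IsNull C (cobd φ)) : IsBdry C φ :=
  isBdry_of_injOn (k := k + 2) hC (g := fun z i => z i)
    (by fun_prop) (fun z _ w _ h => by ext i; exact congrFun h i) le_rfl hφ

/-- If no non-empty union of components of the complement of `K` is contained in the compact set
`D`, then all classes of codimension one of `K` extend to `D`. -/
theorem extends_of_isCompact {K D : Set (EuclideanSpace ℝ (Fin (k + 2)))} (hK : IsCompact K)
    (hD : IsCompact D) (hKD : K ⊆ D)
    (hcomp : ∀ S : Set (EuclideanSpace ℝ (Fin (k + 2))), S ⊆ D \ K → IsOpen S →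
      IsClosed (S ∪ K) → S = ∅)
    {φ : (Fin (k + 2) → EuclideanSpace ℝ (Fin (k + 2))) → G} (hφ : IsNull K (cobd φ)) :
    Extends φ K D := by
  by_contra hcon
  -- A minimal closed set to which the class does not extend. If the class extended to the
  -- intersection of a chain, it would extend to a neighbourhood and hence, by compactness, to a
  -- member of the chain.
  obtain ⟨C, hCmin⟩ := zorn_superset {C | IsClosed C ∧ K ⊆ C ∧ C ⊆ D ∧ ¬ Extends φ K C} (by
    intro c hcS hc
    rcases c.eq_empty_or_nonempty with rfl | hne
    · exact ⟨D, ⟨hD.isClosed, hKD, subset_rfl, hcon⟩, by simp⟩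
    refine ⟨⋂₀ c, ⟨isClosed_sInter fun s hs => (hcS hs).1, subset_sInter fun s hs => (hcS hs).2.1,
      ?_, fun hext => ?_⟩, fun s hs => sInter_subset_of_mem hs⟩
    · obtain ⟨s, hs⟩ := hne
      exact (sInter_subset_of_mem hs).trans (hcS hs).2.2.1
    · obtain ⟨δ, hδ, b, hb, hbφ⟩ :=
        hext.exists_thickening (subset_sInter fun s hs => (hcS hs).2.1)
      have : Nonempty c := hne.to_subtype
      obtain ⟨⟨s, hs⟩, hsub⟩ := exists_subset_nhds_of_isCompact' (V := fun s : c => (s : Set _))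
        (U := Metric.thickening δ (⋂₀ c))
        (by
          rintro ⟨s, hs⟩ ⟨t, ht⟩
          rcases hc.total hs ht with h | h
          · exact ⟨⟨s, hs⟩, subset_rfl, h⟩
          · exact ⟨⟨t, ht⟩, h, subset_rfl⟩)
        (fun s => hD.of_isClosed_subset (hcS s.2).1 (hcS s.2).2.2.1)
        (fun s => (hcS s.2).1)
        (fun x hx => Metric.isOpen_thickening.mem_nhds (Metric.self_subset_thickening hδ _
          (by rwa [sInter_eq_iInter])))
      exact (hcS hs).2.2.2 ⟨b, hb.mono hsub, hbφ⟩)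
  obtain ⟨hCc, hKC, hCD, hCext⟩ := hCmin.prop
  have hCcomp : IsCompact C := hD.of_isClosed_subset hCc hCD
  -- Minimality forces `C \ K` to be open. Otherwise a ball about some `x ∈ C \ K`, avoiding `K`,
  -- has a point `y ∉ C`. The class extends to `C` minus the open ball of radius `dist y x`, and
  -- then across the removed piece, because the overlap lies in a sphere punctured at `y`.
  have hempty : C \ K = ∅ := by
    refine hcomp _ (sdiff_subset_sdiff_left hCD) ?_ (by rwa [sdiff_union_of_subset hKC])
    rw [Metric.isOpen_iff]
    rintro x ⟨hxC, hxK⟩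
    obtain ⟨ε, hε, hεK⟩ := Metric.isOpen_iff.1 hK.isClosed.isOpen_compl x hxK
    refine ⟨ε, hε, fun y hy => ⟨?_, fun h => hεK hy h⟩⟩
    by_contra hyC
    have hxy : x ≠ y := fun h => hyC (h ▸ hxC)
    have hr0 : 0 < dist y x := dist_pos.2 hxy.symm
    apply hCext
    have hQK : Disjoint K (Metric.closedBall x (dist y x)) := by
      rw [Set.disjoint_left]
      intro z hzK hz
      exact hεK (Metric.closedBall_subset_ball hy hz) hzK
    have hC₁ : IsClosed (C \ Metric.ball x (dist y x)) := hCc.sdiff Metric.isOpen_ball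
    have hK₁ : K ⊆ C \ Metric.ball x (dist y x) := fun z hz =>
      ⟨hKC hz, fun h => Set.disjoint_left.1 hQK hz (Metric.ball_subset_closedBall h)⟩
    have hun : C = (C \ Metric.ball x (dist y x)) ∪ (C ∩ Metric.closedBall x (dist y x)) := by
      ext z
      constructor
      · intro hz
        by_cases h : z ∈ Metric.ball x (dist y x)
        · exact Or.inr ⟨hz, Metric.ball_subset_closedBall h⟩
        · exact Or.inl ⟨hz, h⟩
      · rintro (h | h)
        · exact h.1
        · exact h.1
    rw [hun]
    refine Extends.union (hCcomp.of_isClosed_subset hC₁ sdiff_subset)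
      (hCcomp.inter_right Metric.isClosed_closedBall) hK₁ ?_ fun b hb => ?_
    · by_contra hne
      have := hCmin.le_of_le ⟨hC₁, hK₁, sdiff_subset.trans hCD, hne⟩ sdiff_subset
      exact (this hxC).2 (Metric.mem_ball_self hr0)
    · refine isBdry_of_subset_sphere ((hCcomp.of_isClosed_subset hC₁ sdiff_subset).inter
        (hCcomp.inter_right Metric.isClosed_closedBall)) hxy ?_ (fun h => hyC h.1.1) hb
      rintro z ⟨⟨-, hz⟩, -, hz'⟩
      exact le_antisymm hz' (not_lt.1 hz)
  refine hCext ⟨φ, ?_, isNull_of_eq_zero fun x _ => by simp⟩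
  have : C ⊆ K := sdiff_eq_empty.1 hempty
  exact hφ.mono this

end Euclidean

end Cech

/-! ### Čech classes and small tuples on compact metric spaces -/

namespace Cech

section Compare

variable {M N G : Type*} [MetricSpace M] [MetricSpace N] [AddCommGroup G] {p : ℕ}

theorem IsNull.mem_null {B : Set M} {φ : Cochain M G p} (h : IsNull B φ) : φ ∈ null G B p := by
  obtain ⟨δ, hδ, h⟩ := h
  refine ⟨fun x => Metric.ball x (δ / 2),
    fun x => ⟨Metric.isOpen_ball, Metric.mem_ball_self (by positivity)⟩, ?_⟩
  rintro x hx ⟨z, -, hz⟩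
  rw [mem_iInter] at hz
  refine h x hx fun i j => ?_
  have h1 : dist z (x i) < δ / 2 := hz i
  have h2 : dist z (x j) < δ / 2 := hz j
  have := dist_triangle_left (x i) (x j) z
  linarith

theorem isNull_iff_subtype {C : Set M} {φ : (Fin p → M) → G} :
    IsNull C φ ↔ IsNull (univ : Set C) (fun x => φ (Subtype.val ∘ x)) := by
  refine exists_congr fun δ => and_congr_right fun _ => ⟨fun h x _ hd => h _ (fun i => (x i).2) hd,
    fun h x hx hd => h (fun i => ⟨x i, hx i⟩) (fun i => mem_univ _) hd⟩

/-- This is the Lebesgue number of the cover of `B` by the sets `U s`, cut down to `ε`-balls so that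
the chosen index stays close to the point. -/
theorem exists_refinement_aux {B : Set M} (hB : IsCompact B) {U : M → Set M}
    (hU : ∀ x, IsOpen (U x) ∧ x ∈ U x) {ε : ℝ} (hε : 0 < ε) :
    ∃ δ > 0, ∀ x ∈ B, ∃ s ∈ B, dist x s < ε ∧ Metric.ball x δ ⊆ U s := by
  obtain ⟨δ, hδ, h⟩ := lebesgue_number_lemma_of_metric hB
    (c := fun s : B => U s ∩ Metric.ball (s : M) ε)
    (fun s => (hU s).1.inter Metric.isOpen_ball)
    (fun x hx => mem_iUnion.2 ⟨⟨x, hx⟩, (hU x).2, Metric.mem_ball_self hε⟩)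
  refine ⟨δ, hδ, fun x hx => ?_⟩
  obtain ⟨s, hs⟩ := h x hx
  exact ⟨s, s.2, (hs (Metric.mem_ball_self hδ)).2, fun z hz => (hs hz).1⟩

/-- A refinement map from the covers by small balls to a given cover. -/
theorem exists_refinement [CompactSpace M] {B : Set M} (hB : IsClosed B) {U : M → Set M}
    (hU : ∀ x, IsOpen (U x) ∧ x ∈ U x) {ε : ℝ} (hε : 0 < ε) :
    ∃ σ : M → M, (∀ x ∈ B, σ x ∈ B) ∧ (∀ x, dist x (σ x) < ε) ∧
      ∃ δ > 0, ∀ x y, dist x y < δ → x ∈ U (σ y) := by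
  obtain ⟨δ₁, hδ₁, h₁⟩ := exists_refinement_aux hB.isCompact hU hε
  obtain ⟨δ₂, hδ₂, h₂⟩ := exists_refinement_aux isCompact_univ hU hε
  have : ∀ x, ∃ s, (x ∈ B → s ∈ B) ∧ dist x s < ε ∧ Metric.ball x (min δ₁ δ₂) ⊆ U s := by
    intro x
    by_cases hx : x ∈ B
    · obtain ⟨s, hs, hd, h⟩ := h₁ x hx
      exact ⟨s, fun _ => hs, hd, (Metric.ball_subset_ball (min_le_left _ _)).trans h⟩
    · obtain ⟨s, -, hd, h⟩ := h₂ x (mem_univ x)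
      exact ⟨s, fun h => (hx h).elim, hd, (Metric.ball_subset_ball (min_le_right _ _)).trans h⟩
  choose σ hσ₁ hσ₂ hσ₃ using this
  exact ⟨σ, hσ₁, hσ₂, min δ₁ δ₂, lt_min hδ₁ hδ₂, fun x y h => hσ₃ y h⟩

theorem isNull_refinement {B : Set M} {U : M → Set M} {σ : M → M} (hσ : ∀ x ∈ B, σ x ∈ B)
    {δ : ℝ} (hδ : 0 < δ) (hσU : ∀ x y, dist x y < δ → x ∈ U (σ y)) {φ : Cochain M G p}
    (hφ : ∀ x : Fin (p + 1) → M, (∀ i, x i ∈ B) → (B ∩ ⋂ i, U (x i)).Nonempty → φ x = 0) :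
    IsNull B (fun x : Fin (p + 1) → M => φ (σ ∘ x)) :=
  ⟨δ, hδ, fun x hx hd => hφ _ (fun i => hσ _ (hx i))
    ⟨x 0, hx 0, mem_iInter.2 fun i => hσU _ _ (hd 0 i)⟩⟩

/-- The cover `x ↦ U x ∩ U (σ x)` controls all tuples mixing points and their images, which are the
only ones seen by the prism. -/
theorem prism_mem_null {B : Set M} {U : M → Set M} (hU : ∀ x, IsOpen (U x) ∧ x ∈ U x)
    {σ : M → M} (hσ : ∀ x ∈ B, σ x ∈ B) (hσU : ∀ x, x ∈ U (σ x)) {φ : Cochain M G (p + 1)}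
    (hφ : ∀ x : Fin (p + 2) → M, (∀ i, x i ∈ B) → (B ∩ ⋂ i, U (x i)).Nonempty → φ x = 0) :
    prism σ (p + 1) φ ∈ null G B p := by
  refine ⟨fun x => U x ∩ U (σ x),
    fun x => ⟨(hU x).1.inter (hU _).1, (hU x).2, hσU x⟩, ?_⟩
  rintro x hx ⟨z, hzB, hz⟩
  rw [mem_iInter] at hz
  refine prism_eq_zero σ φ x fun w hw => hφ w (fun i => ?_) ⟨z, hzB, mem_iInter.2 fun i => ?_⟩
  · obtain ⟨j, hj | hj⟩ := hw i
    · exact hj ▸ hx j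
    · exact hj ▸ hσ _ (hx j)
  · obtain ⟨j, hj | hj⟩ := hw i
    · exact hj ▸ (hz j).1
    · exact hj ▸ (hz j).2

end Compare

section Pairs

variable {X Z G : Type*} [TopologicalSpace X] [TopologicalSpace Z] [AddCommGroup G] {p : ℕ}

theorem null_mono {B B' : Set X} (h : B ⊆ B') : null G B' p ≤ null G B p := by
  rintro φ ⟨U, hU, hφ⟩
  exact ⟨U, hU, fun x hx hne => hφ x (fun i => h (hx i)) (hne.mono (inter_subset_inter_left _ h))⟩

theorem mem_null_empty (φ : Cochain X G p) : φ ∈ null G (∅ : Set X) p :=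
  ⟨fun _ => univ, fun _ => ⟨isOpen_univ, mem_univ _⟩, fun _ hx _ => (hx 0).elim⟩

theorem mem_coboundaries_succ {B : Set X} {φ : Cochain X G (p + 1)} :
    φ ∈ coboundaries G B (p + 1) ↔
      ∃ ψ ∈ null G B p, φ - d X G p ψ ∈ null G (univ : Set X) (p + 1) := by
  constructor
  · intro h
    obtain ⟨φ₁, h₁, _, ⟨ψ, hψ, rfl⟩, rfl⟩ := AddSubgroup.mem_sup.1 h
    exact ⟨ψ, hψ, by simpa using h₁⟩
  · rintro ⟨ψ, hψ, h⟩
    exact AddSubgroup.mem_sup.2 ⟨_, h, _, ⟨ψ, hψ, rfl⟩, by simp⟩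

theorem map_eq_zero_iff_forall (f : C(X, Z)) {B : Set X} {B' : Set Z} (hf : MapsTo f B B') :
    map p G f hf = 0 ↔ ∀ φ ∈ cocycles G B' p, pullback f G p φ ∈ coboundaries G B p := by
  have key : ∀ φ : cocycles G B' p, map p G f hf (QuotientAddGroup.mk φ) = 0 ↔
      pullback f G p φ ∈ coboundaries G B p := by
    intro φ
    change (QuotientAddGroup.mk (cocyclesMap p G f hf φ) : H p B G) = 0 ↔ _
    rw [QuotientAddGroup.eq_zero_iff, AddSubgroup.mem_addSubgroupOf]
    rfl
  constructor
  · intro h φ hφ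
    rw [← key ⟨φ, hφ⟩, h]; rfl
  · intro h
    ext φ
    exact (key φ).2 (h φ φ.2)

end Pairs

section Compact

variable {M G : Type*} [MetricSpace M] [CompactSpace M] [AddCommGroup G] {p : ℕ}

/-- On a compact metric space every Čech class is represented by a cochain whose coboundary
vanishes on small simplices. -/
theorem exists_small_representative {φ : Cochain M G (p + 1)}
    (hφ : d M G (p + 1) φ ∈ null G (univ : Set M) (p + 2)) :
    ∃ (φ' : Cochain M G (p + 1)) (ω : Cochain M G p), IsNull (univ : Set M) (cobd φ') ∧
      φ' - φ - d M G p ω ∈ null G (univ : Set M) (p + 1) := by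
  obtain ⟨U, hU, h⟩ := hφ
  obtain ⟨σ, -, -, δ, hδ, hσ⟩ := exists_refinement isClosed_univ hU one_pos
  refine ⟨fun x => φ (σ ∘ x), prism σ (p + 1) φ, ?_, ?_⟩
  · exact isNull_refinement (fun _ _ => mem_univ _) hδ hσ h
  · have := prism_mem_null hU (fun _ _ => mem_univ _)
      (fun x => hσ x x (by rwa [dist_self])) h
    convert this using 1
    ext x
    have := cobd_prism σ φ x
    simp only [Pi.sub_apply, d_eq_cobd, ← this]
    abel

/-- Pull the Čech primitive back along a refinement map and correct by the prism. The refinement map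
preserves `B`, which keeps the new primitive zero on small tuples of `B`. -/
theorem exists_small_primitive {B : Set M} (hB : IsClosed B) {β : Cochain M G (p + 1)}
    (hβ : IsNull (univ : Set M) (cobd β)) (hβB : IsNull B β) (h : β ∈ coboundaries G B (p + 1)) :
    ∃ c : Cochain M G p, IsNull B c ∧ IsNull (univ : Set M) (β - cobd c) := by
  obtain ⟨c, ⟨U₁, hU₁, hc⟩, ⟨U₂, hU₂, hβc⟩⟩ := mem_coboundaries_succ.1 h
  obtain ⟨ε₁, hε₁, h₁⟩ := hβ.homotopy
  obtain ⟨ε₂, hε₂, h₂⟩ := hβB.prism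
  obtain ⟨σ, hσB, hσ, δ, hδ, hσU⟩ := exists_refinement hB (U := fun x => U₁ x ∩ U₂ x)
    (fun x => ⟨(hU₁ x).1.inter (hU₂ x).1, (hU₁ x).2, (hU₂ x).2⟩) (lt_min hε₁ hε₂)
  refine ⟨(fun x => c (σ ∘ x)) - prism σ (p + 1) β, ?_, ?_⟩
  · exact (isNull_refinement hσB hδ (fun x y h => (hσU x y h).1) hc).sub
      (h₂ σ B subset_rfl fun x hx => ⟨hσB x hx, (hσ x).trans_le (min_le_right _ _)⟩)
  · have h₃ := isNull_refinement (B := univ) (fun _ _ => mem_univ _) hδ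
      (fun x y h => (hσU x y h).2) hβc
    have h₄ := h₁ σ univ subset_rfl fun x _ => ⟨mem_univ _, (hσ x).trans_le (min_le_left _ _)⟩
    convert h₃.sub h₄ using 1
    rw [map_sub, cobd_comp]
    ext x
    simp only [Pi.sub_apply, d_eq_cobd]
    abel

end Compact

end Cech

/-! ### Cohomologically stable points -/

namespace HilbertVolume

open Cech

variable {G : Type*} [AddCommGroup G] {k : ℕ}

/-- Stable points belong to the image. -/
theorem stableImage_subset_range {X : Type*} [PseudoEMetricSpace X]
    (f : C(X, EuclideanSpace ℝ (Fin (k + 2)))) : stableImage G f ⊆ range f := by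
  rintro y ⟨W, hW, h⟩
  by_contra hy
  obtain ⟨r, hr, hrW⟩ := Metric.nhds_basis_closedBall.mem_iff.1 hW
  set V := Metric.closedBall y r with hV
  refine h V (Metric.closedBall_mem_nhds y hr) Metric.isClosed_closedBall hrW ?_
  refine (map_eq_zero_iff_forall _ _).2 ?_
  rintro φ ⟨hφB, hφ⟩
  have hVc : CompactSpace V := isCompact_iff_compactSpace.1 (isCompact_closedBall y r)
  obtain ⟨φ', ω, hφ', hω⟩ := exists_small_representative hφ
  have hyV : y ∈ V := Metric.mem_closedBall_self hr.le
  classical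
  set ρ : EuclideanSpace ℝ (Fin (k + 2)) → V := fun z => if h : z ∈ V then ⟨z, h⟩ else ⟨y, hyV⟩
  have hρ : ∀ z : V, ρ z = z := fun z => by simp [ρ]
  have hρL : LipschitzOnWith 1 ρ V := by
    intro z hz w hw
    simp [ρ, hz, hw, Subtype.edist_eq]
  -- The absolute cohomology of the ball vanishes in degree `k + 2`, so only the relative condition
  -- on the sphere is left to treat.
  obtain ⟨ψ, hψ⟩ := isBdry_of_isCompact (isCompact_closedBall y r)
    (φ := fun x => φ' (ρ ∘ x)) (hφ'.comp hρL (mapsTo_univ _ _))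
  rw [isNull_iff_subtype] at hψ
  have hψ' : IsNull (univ : Set V)
      (φ' - cobd fun x : Fin (k + 2) → V => ψ (Subtype.val ∘ x)) := by
    convert hψ using 1
    ext x
    exact congrArg (fun z => φ' z - cobd ψ (Subtype.val ∘ x)) (funext fun i => (hρ (x i)).symm)
  obtain ⟨b, hφb⟩ : ∃ b : Cochain V G (k + 1),
      φ - d V G (k + 1) b ∈ null G (univ : Set V) (k + 2) := by
    refine ⟨(fun x => ψ (Subtype.val ∘ x)) - ω, ?_⟩
    convert (null G (univ : Set V) (k + 2)).sub_mem hψ'.mem_null hω using 1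
    rw [map_sub, d_eq_cobd, d_eq_cobd]
    abel
  have hB : d V G (k + 1) b ∈ null G {v : V | v.1 ∈ frontier V} (k + 2) := by
    convert (null G {v : V | v.1 ∈ frontier V} (k + 2)).sub_mem hφB
      (null_mono (subset_univ _) hφb) using 1
    abel
  have hfr : frontier V = Metric.sphere y r := frontier_closedBall y hr.ne'
  have hfy : ∀ x : f ⁻¹' V, ‖f x.1 - y‖ ≠ 0 := fun x => by
    rw [norm_ne_zero_iff, sub_ne_zero]
    exact fun h => hy ⟨_, h⟩
  have hmem : ∀ x : f ⁻¹' V, dist (y + (r / ‖f x.1 - y‖) • (f x.1 - y)) y = r := fun x => by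
    rw [dist_eq_norm, add_sub_cancel_left, norm_smul, norm_div, norm_norm,
      Real.norm_of_nonneg hr.le, div_mul_cancel₀ _ (hfy x)]
  -- Radial projection of `f` to the sphere, available because `f` misses `y`.
  let q : C(f ⁻¹' V, V) := ⟨fun x => ⟨y + (r / ‖f x.1 - y‖) • (f x.1 - y), (hmem x).le⟩, by
    refine Continuous.subtype_mk ?_ _
    have : Continuous fun x : f ⁻¹' V => f x.1 := f.continuous.comp continuous_subtype_val
    exact continuous_const.add ((continuous_const.div (this.sub continuous_const).norm hfy).smul
      (this.sub continuous_const))⟩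
  have hq : MapsTo q univ {v : V | v.1 ∈ frontier V} := fun x _ => by
    change _ ∈ frontier V
    rw [hfr]; exact hmem x
  -- The difference `f^* b - q^* b` vanishes over the sphere, where `f = q`. Its coboundary is still
  -- `f^* φ` in the limit, since `d b` is null on the sphere, the target of `q`.
  refine mem_coboundaries_succ.2 ⟨pullback (f.restrictPreimage V) G (k + 1) b -
    pullback q G (k + 1) b, ?_, ?_⟩
  · refine ⟨fun _ => univ, fun _ => ⟨isOpen_univ, mem_univ _⟩, fun x hx _ => ?_⟩
    have : f.restrictPreimage V ∘ x = q ∘ x := by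
      ext1 i
      have hi : f (x i).1 ∈ frontier V := hx i
      rw [hfr] at hi
      have hi' : ‖f (x i).1 - y‖ = r := by rw [← dist_eq_norm]; exact hi
      apply Subtype.ext
      change f (x i).1 = y + (r / ‖f (x i).1 - y‖) • (f (x i).1 - y)
      rw [hi', div_self hr.ne', one_smul, add_sub_cancel]
    change b (f.restrictPreimage V ∘ x) - b (q ∘ x) = 0
    rw [this, sub_self]
  · have e₁ := pullback_null (f.restrictPreimage V) (mapsTo_univ _ univ) hφb
    have e₂ := pullback_null q hq hB
    convert AddSubgroup.add_mem _ e₁ e₂ using 1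
    rw [map_sub, d_pullback, d_pullback, map_sub]
    abel

/-- The main gluing step: if the relative class of a cocycle `b` on the complement of `V` has
vanishing pull-back, then the pull-back of `b` extends to the whole space. -/
theorem exists_extension_of_map_eq_zero {X : Type*} [MetricSpace X] [CompactSpace X]
    {f : C(X, EuclideanSpace ℝ (Fin (k + 2)))} {L : ℝ≥0} (hf : LipschitzWith L f)
    {V D : Set (EuclideanSpace ℝ (Fin (k + 2)))} (hV : IsClosed V) (hVD : V ⊆ D)
    (hfD : range f ⊆ D) {b : (Fin (k + 2) → EuclideanSpace ℝ (Fin (k + 2))) → G}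
    (hb : IsNull (D \ interior V) (cobd b))
    (h : Cech.map (k + 2) G (f.restrictPreimage V)
      (B := {x | f x.1 ∈ frontier V}) (B' := {v | v.1 ∈ frontier V}) (fun _ hx => hx) = 0) :
    ∃ (θ : (Fin (k + 2) → X) → G) (ω : (Fin (k + 1) → X) → G), IsNull (univ : Set X) (cobd θ) ∧
      IsNull (f ⁻¹' (interior V)ᶜ) (θ - (fun x => b (f ∘ x)) - cobd ω) := by
  have hfr : frontier V = V \ interior V := hV.frontier_eq
  set β₀ : Cochain V G (k + 2) := fun x => cobd b (Subtype.val ∘ x) with hβ₀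
  have h₀ : IsNull {v : V | v.1 ∈ frontier V} β₀ :=
    hb.comp (LipschitzWith.subtype_val V).lipschitzOnWith fun v hv => by
      have hv' : v.1 ∈ frontier V := hv
      rw [hfr] at hv'
      exact ⟨hVD hv'.1, hv'.2⟩
  have hβ₀c : β₀ ∈ cocycles G {v : V | v.1 ∈ frontier V} (k + 2) := by
    refine ⟨h₀.mem_null, ?_⟩
    change d V G (k + 2) β₀ ∈ null G (univ : Set V) (k + 3)
    have : d V G (k + 2) β₀ = 0 := by
      rw [d_eq_cobd, hβ₀, cobd_comp, cobd_cobd]; rfl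
    rw [this]; exact zero_mem _
  have hco := (map_eq_zero_iff_forall _ _).1 h β₀ hβ₀c
  have hfV : IsClosed (f ⁻¹' V) := hV.preimage f.continuous
  have hc : CompactSpace (f ⁻¹' V) := isCompact_iff_compactSpace.1 hfV.isCompact
  set β : Cochain (f ⁻¹' V) G (k + 2) := fun x => cobd b (fun i => f (x i).1) with hβ
  have hB : IsClosed {x : f ⁻¹' V | f x.1 ∈ frontier V} :=
    isClosed_frontier.preimage (f.continuous.comp continuous_subtype_val)
  have hfL : LipschitzWith L (fun x : f ⁻¹' V => f x.1) := fun x y => hf x.1 y.1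
  obtain ⟨c, hcB, hβc⟩ := exists_small_primitive hB (β := β)
    (by
      have : cobd β = fun x => cobd (cobd b) (fun i => f (x i).1) := rfl
      rw [this, cobd_cobd]
      exact isNull_of_eq_zero fun _ _ => rfl)
    (hb.comp hfL.lipschitzOnWith fun v hv => by
      have hv' : f v.1 ∈ frontier V := hv
      rw [hfr] at hv'
      exact ⟨hVD hv'.1, hv'.2⟩) hco
  classical
  -- Extension by zero of the relative primitive of `f^* (cobd b)`. It stays null over the
  -- complement of `interior V` because `c` is null over the frontier. Hence `f^* b - c'` is a
  -- cocycle over `V` and over that complement.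
  set c' : (Fin (k + 2) → X) → G := fun x =>
    if h : ∀ i, x i ∈ f ⁻¹' V then c fun i => ⟨x i, h i⟩ else 0 with hc'
  have hc'v : ∀ x : Fin (k + 2) → f ⁻¹' V, c' (Subtype.val ∘ x) = c x := fun x => by
    exact dif_pos fun i => (x i).2
  set bf : (Fin (k + 2) → X) → G := fun x => b (f ∘ x) with hbf
  set θ₀ := bf - c' with hθ₀
  have n₁ : IsNull (f ⁻¹' V) (cobd θ₀) := by
    rw [isNull_iff_subtype]
    convert hβc using 1
    rw [← cobd_comp]
    have : (fun x : Fin (k + 2) → f ⁻¹' V => θ₀ (Subtype.val ∘ x)) =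
        (fun x => b (fun i => f (x i).1)) - c := by
      ext x
      simp only [hθ₀, Pi.sub_apply, hc'v]
      rfl
    rw [this, map_sub]
    rfl
  have hc'₂ : IsNull (f ⁻¹' (interior V)ᶜ) c' := by
    obtain ⟨δ, hδ, hcB⟩ := hcB
    refine ⟨δ, hδ, fun x hx hd => ?_⟩
    by_cases h : ∀ i, x i ∈ f ⁻¹' V
    · simp only [hc']
      rw [dif_pos h]
      refine hcB _ (fun i => ?_) hd
      change f (x i) ∈ frontier V
      rw [hfr]
      exact ⟨h i, hx i⟩
    · simp only [hc']
      rw [dif_neg h]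
  have n₂ : IsNull (f ⁻¹' (interior V)ᶜ) (cobd θ₀) := by
    rw [hθ₀, map_sub]
    refine IsNull.sub ?_ hc'₂.cobd
    exact hb.comp hf.lipschitzOnWith fun x hx => ⟨hfD ⟨x, rfl⟩, hx⟩
  obtain ⟨ε, hε, hh⟩ := n₂.homotopy
  have hfVc : IsClosed (f ⁻¹' (interior V)ᶜ) :=
    isOpen_interior.isClosed_compl.preimage f.continuous
  obtain ⟨σ, -, s₂, s₃, hσ⟩ := n₁.union hfV.isCompact hfVc.isCompact n₂ hε
  have hun : f ⁻¹' V ∪ f ⁻¹' (interior V)ᶜ = univ := by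
    rw [← preimage_union, eq_univ_iff_forall]
    intro x
    by_cases hx : f x ∈ interior V
    · exact Or.inl (interior_subset hx)
    · exact Or.inr hx
  rw [hun] at hσ
  refine ⟨fun x => θ₀ (σ ∘ x), prism σ (k + 1) θ₀, hσ, ?_⟩
  have := hh σ _ subset_rfl fun x hx => ⟨s₂ x hx, s₃ x⟩
  convert this.sub hc'₂ using 1
  rw [hθ₀]
  abel

/-- Stability of the points of a bounded domain `S` under a map of a space `X` which fills a
boundary carrying a non-trivial class. -/
theorem subset_stableImage {X Q : Type*} [MetricSpace X] [CompactSpace X] [MetricSpace Q]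
    [CompactSpace Q] {Y : Set X} {S : Set (EuclideanSpace ℝ (Fin (k + 2)))} (hSo : IsOpen S)
    (hSb : Bornology.IsBounded S) (hSc : IsPreconnected S) (hSe : IsPreconnected (closure S)ᶜ)
    {τ : Q → EuclideanSpace ℝ (Fin (k + 2))} (hτ : range τ = frontier S)
    {ρ : EuclideanSpace ℝ (Fin (k + 2)) → Q} {L L' : ℝ≥0} (hρ : LipschitzOnWith L' ρ (frontier S))
    (hρτ : ∀ q, ρ (τ q) = q) (F : C(Y, Q)) {f : C(X, EuclideanSpace ℝ (Fin (k + 2)))}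
    (hf : LipschitzWith L f) (hfF : ∀ y : Y, f y = τ (F y))
    (hX : Cech.mapAbs (k + 1) G (⟨Subtype.val, continuous_subtype_val⟩ : C(Y, X)) = 0)
    (hF : Cech.mapAbs (k + 1) G F ≠ 0) : S ⊆ stableImage G f := by
  intro y hy
  obtain ⟨W, hWy, hWS⟩ : ∃ W ∈ 𝓝 y, W ⊆ S := ⟨S, hSo.mem_nhds hy, subset_rfl⟩
  refine ⟨W, hWy, fun V hVy hVc hVW hmap => hF ?_⟩
  refine (map_eq_zero_iff_forall _ _).2 fun φ hφ => ?_
  obtain ⟨φ', ω, hφ', hω⟩ := exists_small_representative hφ.2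
  have hyV : y ∈ interior V := mem_interior_iff_mem_nhds.2 hVy
  have hVS : V ⊆ S := hVW.trans hWS
  have hSK : Disjoint S (frontier S) := by
    rw [hSo.frontier_eq]; exact disjoint_sdiff_right
  set b₀ : (Fin (k + 2) → EuclideanSpace ℝ (Fin (k + 2))) → G := fun x => φ' (ρ ∘ x) with hb₀
  have hb₀n : IsNull (frontier S) (cobd b₀) := hφ'.comp hρ (mapsTo_univ _ _)
  obtain ⟨R, hR⟩ := (hSb.closure.union
    (isCompact_range f.continuous).isBounded).subset_closedBall 0
  set D := Metric.closedBall (0 : EuclideanSpace ℝ (Fin (k + 2))) R with hD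
  have hclD : closure S ⊆ D := subset_union_left.trans hR
  have hKD : frontier S ⊆ D \ interior V := fun z hz =>
    ⟨hclD (frontier_subset_closure hz), fun h =>
      Set.disjoint_left.1 hSK (hVS (interior_subset h)) hz⟩
  have hDc : IsCompact D := isCompact_closedBall 0 R
  -- The domain contains `y`, a point of the removed `interior V`, and the exterior contains points
  -- outside `D`. By connectedness neither can meet an admissible `S'`.
  obtain ⟨b, hb, hbb₀⟩ := extends_of_isCompact (G := G)
    (hDc.of_isClosed_subset isClosed_frontier (hKD.trans sdiff_subset))
    (hDc.diff isOpen_interior) hKD (fun S' hS' hS'o hS'c => by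
      have key : ∀ {P : Set (EuclideanSpace ℝ (Fin (k + 2)))}, IsPreconnected P →
          Disjoint P (frontier S) → (∃ z ∈ P, z ∉ S') → Disjoint P S' := by
        rintro P hP hPK ⟨z, hzP, hzS'⟩
        rcases hP.subset_or_subset hS'o hS'c.isOpen_compl
          (Set.disjoint_left.2 fun x hx hx' => hx' (Or.inl hx))
          (fun x hx => by
            by_cases hxS : x ∈ S'
            · exact Or.inl hxS
            · refine Or.inr fun h => ?_
              rcases h with h | h
              · exact hxS h
              · exact Set.disjoint_left.1 hPK hx h) with h | h
        · exact (hzS' (h hzP)).elim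
        · exact Set.disjoint_left.2 fun x hx hx' => h hx (Or.inl hx')
      have d₁ : Disjoint S S' := key hSc hSK ⟨y, hy, fun h => (hS' h).1.2 hyV⟩
      have d₂ : Disjoint (closure S)ᶜ S' := by
        refine key hSe (Set.disjoint_left.2 fun x hx hx' => hx (frontier_subset_closure hx')) ?_
        obtain ⟨z, hz⟩ := NormedSpace.exists_lt_norm ℝ (EuclideanSpace ℝ (Fin (k + 2))) R
        have hzD : z ∉ D := by
          rw [hD, mem_closedBall_zero_iff]; exact not_le.2 hz
        exact ⟨z, fun h => hzD (hclD h), fun h => hzD (hS' h).1.1⟩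
      refine eq_empty_of_forall_notMem fun x hx => ?_
      by_cases hxc : x ∈ closure S
      · by_cases hxS : x ∈ S
        · exact Set.disjoint_left.1 d₁ hxS hx
        · refine (hS' hx).2 ?_
          rw [hSo.frontier_eq]
          exact ⟨hxc, hxS⟩
      · exact Set.disjoint_left.1 d₂ hxc hx) hb₀n
  obtain ⟨θ, ω', hθ, hθω⟩ := exists_extension_of_map_eq_zero hf hVc
    ((hVS.trans subset_closure).trans hclD) (subset_union_right.trans hR) hb hmap
  have hθY := (map_eq_zero_iff_forall _ _).1 hX θ ⟨mem_null_empty _, hθ.mem_null⟩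
  have hfY : ∀ y : Y, f y ∈ frontier S := fun y => by
    rw [hfF, ← hτ]; exact mem_range_self _
  obtain ⟨ψ, -, hψ⟩ := mem_coboundaries_succ.1 hθY
  have e₁ : IsNull (univ : Set Y) (fun x => (θ - (fun x => b (f ∘ x)) - cobd ω')
      (Subtype.val ∘ x)) :=
    hθω.comp (LipschitzWith.subtype_val Y).lipschitzOnWith fun z _ h =>
      (hKD (hfY z)).2 h
  have e₂ : IsNull (univ : Set Y) (fun x => (b - b₀) (fun i => f (x i))) :=
    hbb₀.comp (f := fun z : Y => f z) (K := L) (fun x _ y _ => hf x y) fun z _ => hfY z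
  have e₃ := pullback_null F (mapsTo_univ _ univ) hω
  -- On `Y` the extension `θ` is `d ψ`. It also equals `F^* φ + d (F^* ω) + d ω'` in the limit,
  -- which dictates this primitive of `F^* φ`.
  refine mem_coboundaries_succ.2 ⟨ψ - (fun x => ω' (Subtype.val ∘ x)) - pullback F G k ω,
    mem_null_empty _, ?_⟩
  convert AddSubgroup.sub_mem _ (AddSubgroup.sub_mem _ hψ
    (AddSubgroup.add_mem _ e₁.mem_null e₂.mem_null)) e₃ using 1
  rw [map_sub, map_sub]
  have hb₀F : ∀ x : Fin (k + 2) → Y, b₀ (fun i => f (x i)) = φ' (F ∘ x) := fun x => by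
    simp only [hb₀]
    congr 1
    ext1 i
    simp [hfF, hρτ]
  ext x
  have h₁ : d Y G k (fun x => ω' (Subtype.val ∘ x)) x = cobd ω' (Subtype.val ∘ x) := rfl
  have h₂ : d Y G k (pullback F G k ω) x = d Q G k ω (F ∘ x) := rfl
  have h₃ : ∀ χ : Cochain Q G (k + 1), pullback F G (k + 1) χ x = χ (F ∘ x) := fun _ => rfl
  have h₄ : pullback (⟨Subtype.val, continuous_subtype_val⟩ : C(Y, X)) G (k + 1) θ x =
    θ (Subtype.val ∘ x) := rfl
  have h₅ : b (f ∘ Subtype.val ∘ x) = b (fun i => f (x i)) := rfl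
  simp only [Pi.sub_apply, Pi.add_apply, h₁, h₂, h₃, h₄, h₅, hb₀F]
  abel

/-- Stable points of a composition with a map on the right are stable. -/
theorem stableImage_comp_subset {n : ℕ} {X X' : Type*} [PseudoEMetricSpace X]
    [PseudoEMetricSpace X'] (f : C(X', EuclideanSpace ℝ (Fin n))) (s : C(X, X')) :
    stableImage G (f.comp s) ⊆ stableImage G f := by
  rintro y ⟨W, hW, h⟩
  refine ⟨W, hW, fun V hVy hVc hVW h0 => h V hVy hVc hVW ?_⟩
  refine (map_eq_zero_iff_forall _ _).2 fun φ hφ => ?_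
  replace h0 := (map_eq_zero_iff_forall _ _).1 h0
  let s' : C((f.comp s) ⁻¹' V, f ⁻¹' V) := ⟨fun x => ⟨s x.1, x.2⟩, by fun_prop⟩
  have := pullback_coboundaries s' (B := {x | f.comp s x.1 ∈ frontier V})
    (B' := {x | f x.1 ∈ frontier V}) (fun _ hx => hx) (h0 φ hφ)
  exact this

/-- Points with a local section are stable once the local homology of Euclidean space at the
point does not vanish, which is the case if the point is stable for some map. -/
theorem mem_stableImage_of_section {n : ℕ} {X X' : Type*} [PseudoEMetricSpace X]
    [PseudoEMetricSpace X'] (f : C(X, EuclideanSpace ℝ (Fin n)))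
    (f' : C(X', EuclideanSpace ℝ (Fin n))) {y : EuclideanSpace ℝ (Fin n)}
    (hy : y ∈ stableImage G f') {S : Set (EuclideanSpace ℝ (Fin n))} (hS : S ∈ 𝓝 y)
    (s : C(S, X)) (hs : ∀ z : S, f (s z) = z) : y ∈ stableImage G f := by
  obtain ⟨W, hW, h⟩ := hy
  refine ⟨W ∩ S, Filter.inter_mem hW hS, fun V hVy hVc hVW h0 =>
    h V hVy hVc (hVW.trans inter_subset_left) ?_⟩
  refine (map_eq_zero_iff_forall _ _).2 fun φ hφ => ?_
  replace h0 := (map_eq_zero_iff_forall _ _).1 h0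
  have hVS : V ⊆ S := hVW.trans inter_subset_right
  let s' : C(V, f ⁻¹' V) := ⟨fun v => ⟨s ⟨v, hVS v.2⟩, by
    change f _ ∈ V; rw [hs]; exact v.2⟩, by fun_prop⟩
  have hs' : ∀ v : V, f (s' v).1 = v := fun v => hs ⟨v, hVS v.2⟩
  have h1 := pullback_coboundaries s' (B := {v | v.1 ∈ frontier V})
    (B' := {x | f x.1 ∈ frontier V})
    (fun v hv => by change f (s' v).1 ∈ frontier V; rw [hs']; exact hv) (h0 φ hφ)
  -- The section makes `f^*` split injective, so its vanishing would kill the relative cohomology of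
  -- `V`, against the stability of `y` for `f'`.
  have h2 : pullback s' G n (pullback (f.restrictPreimage V) G n φ) = φ := by
    ext x
    change φ _ = φ x
    congr 1
    ext1 i
    exact Subtype.ext (hs' (x i))
  rw [h2] at h1
  exact pullback_coboundaries (f'.restrictPreimage V) (B := {x | f' x.1 ∈ frontier V})
    (B' := {v | v.1 ∈ frontier V}) (fun _ hx => hx) h1

end HilbertVolume

/-! ### Existence of John's form -/

namespace HilbertVolume

section JohnExistence

/-- In finite dimension the convex hull of a compact set is compact. -/
theorem isCompact_convexHull_of_finiteDimensional {V : Type*} [NormedAddCommGroup V]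
    [NormedSpace ℝ V] [FiniteDimensional ℝ V] {s : Set V} (hs : IsCompact s) :
    IsCompact (convexHull ℝ s) := by
  rcases s.eq_empty_or_nonempty with rfl | ⟨s₀, hs₀⟩
  · simp
  set N := Module.finrank ℝ V + 1 with hN
  have hcomp : IsCompact (stdSimplex ℝ (Fin N) ×ˢ (univ.pi fun _ : Fin N => s)) :=
    (isCompact_stdSimplex ℝ (Fin N)).prod (isCompact_univ_pi fun _ => hs)
  have hcont : Continuous fun q : (Fin N → ℝ) × (Fin N → V) => ∑ i, q.1 i • q.2 i := by fun_prop
  convert hcomp.image hcont using 1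
  ext x
  constructor
  · intro hx
    -- Carathéodory's theorem bounds the number of points by `N`. Shorter combinations are padded
    -- with weight zero at `s₀`.
    obtain ⟨ι, _, z, w, hz, hind, hw, hw1, hx⟩ := eq_pos_convex_span_of_mem_convexHull hx
    have hcard : Fintype.card ι ≤ Fintype.card (Fin N) := by
      rw [Fintype.card_fin]
      exact hind.card_le_finrank_succ.trans (Nat.succ_le_succ (Submodule.finrank_le _))
    obtain ⟨e⟩ := Function.Embedding.nonempty_of_card_le hcard
    have hz' : ∀ j, Function.extend e z (fun _ => s₀) j ∈ s := by
      intro j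
      by_cases hj : ∃ i, e i = j
      · obtain ⟨i, rfl⟩ := hj
        rw [e.injective.extend_apply]
        exact hz ⟨i, rfl⟩
      · rw [Function.extend_apply' _ _ _ hj]; exact hs₀
    refine ⟨⟨Function.extend e w 0, Function.extend e z fun _ => s₀⟩, ⟨⟨fun j => ?_, ?_⟩,
      fun j _ => hz' j⟩, ?_⟩
    · by_cases hj : ∃ i, e i = j
      · obtain ⟨i, rfl⟩ := hj
        simp only [e.injective.extend_apply]
        exact (hw i).le
      · simp only [Function.extend_apply' _ _ _ hj]; exact le_rfl
    · rw [← hw1]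
      refine (Fintype.sum_of_injective e e.injective _ _ (fun j hj => ?_) fun i => ?_).symm
      · simp only [Function.extend_apply' _ _ _ hj, Pi.zero_apply]
      · simp only [e.injective.extend_apply]
    · rw [← hx]
      refine (Fintype.sum_of_injective e e.injective _ _ (fun j hj => ?_) fun i => ?_).symm
      · simp only [Function.extend_apply' _ _ _ hj, Pi.zero_apply, zero_smul]
      · simp only [e.injective.extend_apply]
  · rintro ⟨q, ⟨hq1, hq2⟩, rfl⟩
    exact (convex_convexHull ℝ s).sum_mem (fun i _ => hq1.1 i) hq1.2
      fun i _ => subset_convexHull ℝ s (hq2 i (mem_univ i))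

/-- Points inside the open unit ball have room to move; at points of norm one the derivative of the
squared norm is negative. Compactness makes the time uniform. -/
theorem eventually_norm_add_smul_le_one {E : Type*} [NormedAddCommGroup E]
    [InnerProductSpace ℝ E] {B : Set E} (hB : IsCompact B) (hB1 : ∀ w ∈ B, ‖w‖ ≤ 1)
    (K : E →L[ℝ] E) (hK : ∀ w ∈ B, ‖w‖ = 1 → inner ℝ w (K w) < 0) :
    ∀ᶠ t : ℝ in 𝓝[>] 0, ∀ w ∈ B, ‖w + t • K w‖ ≤ 1 := by
  have h : ∀ᶠ t : ℝ in 𝓝 0, ∀ w ∈ B, 0 < t → w ∈ B → ‖w + t • K w‖ ≤ 1 := by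
    refine hB.eventually_forall_of_forall_eventually fun w hw => ?_
    rcases (hB1 w hw).lt_or_eq with h1 | h1
    · have hc : Continuous fun z : ℝ × E => ‖z.2 + z.1 • K z.2‖ := by fun_prop
      have : ∀ᶠ z : ℝ × E in 𝓝 (0, w), ‖z.2 + z.1 • K z.2‖ < 1 :=
        hc.continuousAt.eventually_lt continuousAt_const (by simpa using h1)
      filter_upwards [this] with z hz _ _ using hz.le
    · have hc : Continuous fun z : ℝ × E => 2 * inner ℝ z.2 (K z.2) + z.1 * ‖K z.2‖ ^ 2 := by
        fun_prop
      have : ∀ᶠ z : ℝ × E in 𝓝 (0, w), 2 * inner ℝ z.2 (K z.2) + z.1 * ‖K z.2‖ ^ 2 < 0 :=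
        hc.continuousAt.eventually_lt continuousAt_const (by
          have := hK w hw h1
          simp only [zero_mul, add_zero]; linarith)
      filter_upwards [this] with z hz hz0 hzB
      rw [← sq_le_one_iff₀ (norm_nonneg _), norm_add_sq_real, inner_smul_right, norm_smul,
        mul_pow, Real.norm_eq_abs, sq_abs]
      have h2 := hB1 _ hzB
      have h3 : ‖z.2‖ ^ 2 ≤ 1 := by
        rw [sq_le_one_iff₀ (norm_nonneg _)]; exact h2
      nlinarith
  filter_upwards [nhdsWithin_le_nhds h, self_mem_nhdsWithin] with t ht ht0 w hw using
    ht w hw ht0 hw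

variable {n : ℕ}

theorem det_toEuclideanCLM (H : Matrix (Fin n) (Fin n) ℝ) :
    (Matrix.toEuclideanCLM (𝕜 := ℝ) H).det = H.det := by
  rw [ContinuousLinearMap.det, Matrix.coe_toEuclideanCLM_eq_toEuclideanLin,
    Matrix.toEuclideanLin_eq_toLin_orthonormal, LinearMap.det_toLin]

/-- The trace is the derivative of the determinant at the identity. -/
theorem eventually_one_lt_det (H : Matrix (Fin n) (Fin n) ℝ) (hH : 0 < H.trace) :
    ∀ᶠ t : ℝ in 𝓝[>] 0, 1 < (1 + t • H).det := by
  set P := (1 + (Polynomial.X : Polynomial ℝ) • H.map Polynomial.C).det.divX.divX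
  have hc : Continuous fun t : ℝ => H.trace + Polynomial.eval t P * t := by fun_prop
  have : ∀ᶠ t : ℝ in 𝓝 0, 0 < H.trace + Polynomial.eval t P * t :=
    continuousAt_const.eventually_lt hc.continuousAt (by simpa using hH)
  filter_upwards [nhdsWithin_le_nhds this, self_mem_nhdsWithin] with t ht ht0
  rw [Matrix.det_one_add_smul]
  have : (0 : ℝ) < t := ht0
  nlinarith

/-- A compact subset `B` of the unit ball such that no map `H` of determinant greater than one
maps `B` into the unit ball admits a John decomposition of the identity. -/
theorem exists_john_decomposition (hn : n ≠ 0) {B : Set (EuclideanSpace ℝ (Fin n))}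
    (hB : IsCompact B) (hB1 : ∀ w ∈ B, ‖w‖ ≤ 1)
    (hmax : ∀ H : EuclideanSpace ℝ (Fin n) →L[ℝ] EuclideanSpace ℝ (Fin n),
      (∀ w ∈ B, ‖H w‖ ≤ 1) → H.det ≤ 1) :
    ∃ (ι : Type) (_ : Fintype ι) (c : ι → ℝ) (v : ι → EuclideanSpace ℝ (Fin n)),
      (∀ i, 0 ≤ c i) ∧ (∀ i, v i ∈ B) ∧ (∀ i, ‖v i‖ = 1) ∧
      ∀ y, ∑ i, (c i * inner ℝ (v i) y) • v i = y := by
  have hn0 : (0 : ℝ) < n := by exact_mod_cast Nat.pos_of_ne_zero hn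
  set S := B ∩ Metric.sphere 0 1 with hS
  have hSc : IsCompact S := hB.inter_right Metric.isClosed_sphere
  set P : EuclideanSpace ℝ (Fin n) → Fin n → Fin n → ℝ := fun v i j => v i * v j with hP
  have hPc : Continuous P := by
    refine continuous_pi fun i => continuous_pi fun j => ?_
    fun_prop
  set I : Fin n → Fin n → ℝ := fun i j => if i = j then (n : ℝ)⁻¹ else 0 with hI
  -- A functional separating `I / n` from the matrices `v vᵀ` of contact points, shifted by `u • 1`,
  -- has positive trace and a quadratic form negative on the contact points. Moving in that
  -- direction raises the determinant while keeping `B` in the ball.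
  have hmem : I ∈ convexHull ℝ (P '' S) := by
    by_contra hcon
    obtain ⟨f, u, hfu, huf⟩ := geometric_hahn_banach_closed_point (convex_convexHull ℝ (P '' S))
      (isCompact_convexHull_of_finiteDimensional (hSc.image hPc)).isClosed hcon
    set h : Matrix (Fin n) (Fin n) ℝ := fun i j => f (Pi.single i (Pi.single j 1)) with hh
    have hf : ∀ a : Fin n → Fin n → ℝ, f a = ∑ i, ∑ j, a i j * h i j := by
      intro a
      have : a = ∑ i, ∑ j, a i j • (Pi.single i (Pi.single j (1 : ℝ)) : Fin n → Fin n → ℝ) := by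
        ext i j
        simp [Finset.sum_apply, Pi.single_apply, ite_apply]
      conv_lhs => rw [this]
      simp [map_sum, hh]
    set H : Matrix (Fin n) (Fin n) ℝ := h - u • 1 with hH
    have htr : 0 < H.trace := by
      have : f I = (n : ℝ)⁻¹ * h.trace := by
        rw [hf, Matrix.trace, Finset.mul_sum]
        simp [hI]
      rw [this, lt_inv_mul_iff₀ hn0] at huf
      rw [hH, Matrix.trace_sub, Matrix.trace_smul, Matrix.trace_one, Fintype.card_fin, smul_eq_mul]
      linarith
    set K := Matrix.toEuclideanCLM (𝕜 := ℝ) H with hK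
    have hKS : ∀ w ∈ B, ‖w‖ = 1 → inner ℝ w (K w) < 0 := by
      intro w hw hw1
      have h1 := hfu _ (subset_convexHull ℝ _ ⟨w, ⟨hw, by simpa using hw1⟩, rfl⟩)
      rw [hf] at h1
      have h2 : inner ℝ w (K w) = (∑ i, ∑ j, P w i j * h i j) - u * ‖w‖ ^ 2 := by
        rw [← real_inner_self_eq_norm_sq, PiLp.inner_apply, PiLp.inner_apply, Finset.mul_sum,
          ← Finset.sum_sub_distrib]
        refine Finset.sum_congr rfl fun i _ => ?_
        have : (K w) i = ∑ j, H i j * w j := by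
          rw [hK]
          rfl
        simp only [this, hH, hP, Matrix.sub_apply, Matrix.smul_apply, Matrix.one_apply,
          sub_mul, Finset.sum_sub_distrib, RCLike.inner_apply, conj_trivial]
        simp only [smul_eq_mul, mul_ite, mul_one, mul_zero, ite_mul, zero_mul, Finset.sum_ite_eq,
          Finset.mem_univ, if_true]
        rw [Finset.sum_mul]
        congr 1
        · exact Finset.sum_congr rfl fun j _ => by ring
        · ring
      rw [h2, hw1]
      linarith
    obtain ⟨t, ht1, ht2⟩ := ((eventually_norm_add_smul_le_one hB hB1 K hKS).and
      (eventually_one_lt_det H htr)).exists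
    have := hmax (Matrix.toEuclideanCLM (𝕜 := ℝ) (1 + t • H)) (fun w hw => by
      have : Matrix.toEuclideanCLM (𝕜 := ℝ) (1 + t • H) w = w + t • K w := by
        rw [map_add, map_smul, map_one]; rfl
      rw [this]; exact ht1 w hw)
    rw [det_toEuclideanCLM] at this
    exact absurd ht2 (not_lt.2 this)
  rw [mem_convexHull_iff_exists_fintype] at hmem
  obtain ⟨ι, _, w, z, hw0, hw1, hz, hsum⟩ := hmem
  choose v hvS hv using hz
  refine ⟨Fin (Fintype.card ι), inferInstance, fun i => n * w ((Fintype.equivFin ι).symm i),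
    fun i => v ((Fintype.equivFin ι).symm i), fun i => mul_nonneg hn0.le (hw0 _),
    fun i => (hvS _).1, fun i => by simpa using (hvS _).2, fun y => ?_⟩
  rw [Equiv.sum_comp (Fintype.equivFin ι).symm
    (fun i => ((n * w i) * inner ℝ (v i) y) • v i)]
  ext k
  have key : ∀ j, ∑ i, w i * (v i j * v i k) = if j = k then (n : ℝ)⁻¹ else 0 := by
    intro j
    have := congrFun (congrFun hsum j) k
    rw [Finset.sum_apply, Finset.sum_apply] at this
    refine Eq.trans ?_ this
    refine Finset.sum_congr rfl fun i _ => ?_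
    rw [← hv i]; rfl
  calc (∑ i, ((n * w i) * inner ℝ (v i) y) • v i) k
      = ∑ i, ∑ j, n * y j * (w i * (v i j * v i k)) := by
        rw [WithLp.ofLp_sum, Finset.sum_apply]
        refine Finset.sum_congr rfl fun i _ => ?_
        simp only [PiLp.smul_apply, smul_eq_mul, PiLp.inner_apply, RCLike.inner_apply,
          conj_trivial, Finset.mul_sum, Finset.sum_mul]
        exact Finset.sum_congr rfl fun j _ => by ring
    _ = ∑ j, n * y j * ∑ i, w i * (v i j * v i k) := by
        rw [Finset.sum_comm]
        simp_rw [Finset.mul_sum]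
    _ = y k := by
        simp_rw [key]
        simp only [mul_ite, mul_zero, Finset.sum_ite_eq', Finset.mem_univ, if_true]
        field_simp

theorem det_adjoint_eq {E : Type*} [NormedAddCommGroup E] [InnerProductSpace ℝ E]
    [FiniteDimensional ℝ E] (f : E →ₗ[ℝ] E) : LinearMap.det (LinearMap.adjoint f) =
    LinearMap.det f := by
  set b := stdOrthonormalBasis ℝ E
  rw [← LinearMap.det_toMatrix b.toBasis, ← LinearMap.det_toMatrix b.toBasis f,
    LinearMap.toMatrix_adjoint, Matrix.det_conjTranspose, star_trivial]

/-- John's theorem. -/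
theorem exists_john {A : Type*} [NormedAddCommGroup A] [NormedSpace ℝ A] (hn : n ≠ 0)
    (hA : Module.finrank ℝ A = n) :
    ∃ (T : A ≃L[ℝ] EuclideanSpace ℝ (Fin n)) (ι : Type) (_ : Fintype ι) (c : ι → ℝ)
      (v : ι → EuclideanSpace ℝ (Fin n)), (∀ x, ‖x‖ ≤ ‖T x‖) ∧ (∀ i, 0 ≤ c i) ∧
      (∀ i, ‖v i‖ = 1) ∧ (∀ i x, inner ℝ (v i) (T x) ≤ ‖x‖) ∧
      ∀ y, ∑ i, (c i * inner ℝ (v i) y) • v i = y := by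
  have hfd : FiniteDimensional ℝ A := Module.finite_of_finrank_pos (by omega)
  set E := EuclideanSpace ℝ (Fin n) with hE
  let T₁ : A ≃L[ℝ] E := ContinuousLinearEquiv.ofFinrankEq (by rw [hA]; exact finrank_euclideanSpace_fin.symm)
  -- Maximizing `D` selects an ellipsoid of largest volume in the unit ball of `A`; `T₁` only serves
  -- to define the determinant.
  let D : (E →L[ℝ] A) → ℝ := fun S => |((T₁ : A →L[ℝ] E).comp S).det|
  have hDc : Continuous D := by
    refine continuous_abs.comp (ContinuousLinearMap.continuous_det.comp ?_)
    fun_prop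
  obtain ⟨S₀, hS₀, hmax⟩ := (isCompact_closedBall (0 : E →L[ℝ] A) 1).exists_isMaxOn
    ⟨0, by simp⟩ hDc.continuousOn
  have hS₀1 : ‖S₀‖ ≤ 1 := by simpa using hS₀
  have hD0 : D S₀ ≠ 0 := by
    set r : ℝ := (‖(T₁.symm : E →L[ℝ] A)‖ + 1)⁻¹ with hr
    have hr0 : 0 < r := by positivity
    have h1 : r • (T₁.symm : E →L[ℝ] A) ∈ Metric.closedBall (0 : E →L[ℝ] A) 1 := by
      rw [mem_closedBall_zero_iff, norm_smul, Real.norm_of_nonneg hr0.le, hr,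
        inv_mul_le_one₀ (by positivity)]
      linarith
    have h2 := hmax h1
    have h3 : (T₁ : A →L[ℝ] E).comp (r • (T₁.symm : E →L[ℝ] A)) =
        r • ContinuousLinearMap.id ℝ E := by
      ext1 x; simp
    have h4 : D (r • (T₁.symm : E →L[ℝ] A)) = |r ^ n| := by
      simp only [D, h3]
      rw [ContinuousLinearMap.det, ContinuousLinearMap.toLinearMap_smul,
        ContinuousLinearMap.coe_id, LinearMap.det_smul, LinearMap.det_id, mul_one]
      rw [abs_pow, show Module.finrank ℝ E = n from finrank_euclideanSpace_fin, abs_pow]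
    have h5 : (0 : ℝ) < D (r • (T₁.symm : E →L[ℝ] A)) := by rw [h4]; positivity
    exact (h5.trans_le h2).ne'
  have hdet0 : ((T₁ : A →L[ℝ] E).comp S₀).det ≠ 0 := by simpa [D] using hD0
  let R : E ≃L[ℝ] E := ContinuousLinearMap.toContinuousLinearEquivOfDetNeZero _ hdet0
  let T : A ≃L[ℝ] E := T₁.trans R.symm
  have hT : ∀ x, S₀ (T x) = x := by
    intro x
    apply T₁.injective
    have : R (R.symm (T₁ x)) = T₁ x := R.apply_symm_apply _
    exact this
  have hTle : ∀ x, ‖x‖ ≤ ‖T x‖ := fun x => by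
    have := S₀.le_of_opNorm_le hS₀1 (T x)
    rwa [hT, one_mul] at this
  -- The dual unit ball of `A` read in the coordinates of `S₀`. If `H` maps it into the Euclidean
  -- ball, then `S₀ ∘ H*` still has norm at most one, so maximality bounds `det H`.
  set B : Set E := {w | ∀ y, inner ℝ w y ≤ ‖S₀ y‖} with hBdef
  have hB1 : ∀ w ∈ B, ‖w‖ ≤ 1 := by
    intro w hw
    by_contra hcon
    push Not at hcon
    have h1 := hw w
    have h2 := S₀.le_of_opNorm_le hS₀1 w
    rw [real_inner_self_eq_norm_sq] at h1
    nlinarith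
  have hBc : IsCompact B := by
    refine (isCompact_closedBall (0 : E) 1).of_isClosed_subset ?_ fun w hw => by
      simpa using hB1 w hw
    rw [hBdef, ofPred_forall]
    exact isClosed_iInter fun y => isClosed_le (by fun_prop) continuous_const
  obtain ⟨ι, hι, c, v, hc, hvB, hv1, hsum⟩ := exists_john_decomposition hn hBc hB1 (by
    intro H hH
    have hS : S₀.comp (ContinuousLinearMap.adjoint H) ∈ Metric.closedBall (0 : E →L[ℝ] A) 1 := by
      rw [mem_closedBall_zero_iff]
      refine ContinuousLinearMap.opNorm_le_bound _ zero_le_one fun y => ?_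
      obtain ⟨g, hg1, hg⟩ := exists_dual_vector'' ℝ (S₀ (ContinuousLinearMap.adjoint H y))
      set w : E := (InnerProductSpace.toDual ℝ E).symm (g.comp S₀) with hw
      have hwi : ∀ y, inner ℝ w y = g (S₀ y) := fun y => by
        rw [hw, InnerProductSpace.toDual_symm_apply]; rfl
      have hwB : w ∈ B := fun y => by
        rw [hwi]
        have := g.le_of_opNorm_le hg1 (S₀ y)
        rw [one_mul] at this
        exact (le_abs_self _).trans this
      have h1 : ‖S₀ (ContinuousLinearMap.adjoint H y)‖ = inner ℝ (H w) y := by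
        rw [← ContinuousLinearMap.adjoint_inner_right, hwi, hg]; rfl
      rw [ContinuousLinearMap.comp_apply, h1]
      exact (real_inner_le_norm _ _).trans
        (mul_le_mul_of_nonneg_right (hH w hwB) (norm_nonneg _))
    have h1 := hmax hS
    have h2 : D (S₀.comp (ContinuousLinearMap.adjoint H)) = D S₀ * |H.det| := by
      simp only [D]
      rw [← abs_mul]
      congr 1
      rw [ContinuousLinearMap.det, ContinuousLinearMap.det, ContinuousLinearMap.det,
        ← det_adjoint_eq H.toLinearMap, ← LinearMap.det_comp]
      rfl
    change D (S₀.comp (ContinuousLinearMap.adjoint H)) ≤ D S₀ at h1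
    rw [h2] at h1
    have h3 : 0 < D S₀ := lt_of_le_of_ne (abs_nonneg _) hD0.symm
    have h4 : |H.det| ≤ 1 := by
      by_contra hcon
      push Not at hcon
      nlinarith
    exact (le_abs_self _).trans h4)
  refine ⟨T, ι, hι, c, v, hTle, hc, hv1, fun i x => ?_, hsum⟩
  have := hvB i (T x)
  rwa [hT] at this

end JohnExistence

end HilbertVolume

/-! ### Axial partitions of unity of Euclidean space -/

namespace HilbertVolume

section Partition

variable {n : ℕ}

instance {Y : Type*} [NormedAddCommGroup Y] [NormedSpace ℝ Y] : T2Space (AxialProjector Y) :=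
  inferInstanceAs (T2Space {q : Y × StrongDual ℝ Y // ‖q.1‖ = 1 ∧ ‖q.2‖ = 1 ∧ q.2 q.1 = 1})

theorem AxialProjector.continuous_axis {Y : Type*} [NormedAddCommGroup Y] [NormedSpace ℝ Y] :
    Continuous (AxialProjector.axis : AxialProjector Y → Y) :=
  continuous_fst.comp continuous_subtype_val

theorem AxialProjector.norm_axis {Y : Type*} [NormedAddCommGroup Y] [NormedSpace ℝ Y]
    (q : AxialProjector Y) : ‖q.axis‖ = 1 := q.2.1

variable {E : Type*} [NormedAddCommGroup E] [InnerProductSpace ℝ E]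

/-- Equality in Cauchy–Schwarz identifies the Riesz vector of `coord` with the axis. -/
theorem AxialProjector.coord_apply [CompleteSpace E] (q : AxialProjector E) (y : E) :
    q.coord y = inner ℝ q.axis y := by
  set w := (InnerProductSpace.toDual ℝ E).symm q.coord with hw
  have hwi : ∀ y, inner ℝ w y = q.coord y := fun y => InnerProductSpace.toDual_symm_apply
  have hw1 : ‖w‖ = 1 := by rw [hw, LinearIsometryEquiv.norm_map]; exact q.2.2.1
  have : w = q.axis := (inner_eq_one_iff_of_norm_eq_one hw1 q.norm_axis).1 (by
    rw [hwi]; exact q.2.2.2)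
  rw [← hwi, this]

/-- The axial projector of a unit vector of a Euclidean space. -/
def AxialProjector.ofUnit (v : E) (hv : ‖v‖ = 1) : AxialProjector E :=
  ⟨(v, innerSL ℝ v), hv, by simp [hv], by
    simp [hv]⟩

theorem AxialProjector.axis_ofUnit (v : E) (hv : ‖v‖ = 1) :
    (AxialProjector.ofUnit v hv).axis = v := rfl

theorem AxialProjector.coord_ofUnit (v : E) (hv : ‖v‖ = 1) (y : E) :
    (AxialProjector.ofUnit v hv).coord y = inner ℝ v y := rfl

section Bounds

variable [FiniteDimensional ℝ E] {μ : Measure (AxialProjector E)}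

theorem IsPartitionOfUnity.integrable_sq (hμ : IsPartitionOfUnity μ) (y : E) :
    Integrable (fun p : AxialProjector E => inner ℝ p.axis y ^ 2) μ := by
  have := (hμ.integrable y).const_inner (𝕜 := ℝ) y
  refine this.congr (Filter.Eventually.of_forall fun p => ?_)
  simp only [inner_smul_right, p.coord_apply]
  rw [real_inner_comm y]; ring

theorem IsPartitionOfUnity.integral_sq (hμ : IsPartitionOfUnity μ) (y : E) :
    ∫ p : AxialProjector E, inner ℝ p.axis y ^ 2 ∂μ = ‖y‖ ^ 2 := by
  rw [← real_inner_self_eq_norm_sq]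
  conv_rhs => rw [← hμ.integral_eq y]
  rw [hμ.integral_eq y]
  have := integral_inner (𝕜 := ℝ) (hμ.integrable y) y
  rw [hμ.integral_eq y] at this
  rw [← this]
  refine integral_congr_ae (Filter.Eventually.of_forall fun p => ?_)
  simp only [inner_smul_right, p.coord_apply]
  rw [real_inner_comm y]; ring

/-- Parseval reduces to the quadratic identity `∫ ⟪v, y⟫² = ‖y‖²`. The value is the squared
Hilbert–Schmidt norm of `M`, whatever `μ` is; `M = id` yields the total mass. -/
theorem IsPartitionOfUnity.integrable_norm_adjoint_sq (hμ : IsPartitionOfUnity μ) (M : E →L[ℝ] E) :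
    Integrable (fun p : AxialProjector E => ‖ContinuousLinearMap.adjoint M p.axis‖ ^ 2) μ ∧
      ∫ p : AxialProjector E, ‖ContinuousLinearMap.adjoint M p.axis‖ ^ 2 ∂μ =
        ∑ i, ‖M (stdOrthonormalBasis ℝ E i)‖ ^ 2 := by
  set b := stdOrthonormalBasis ℝ E
  have h : ∀ p : AxialProjector E, ‖ContinuousLinearMap.adjoint M p.axis‖ ^ 2 =
      ∑ i, inner ℝ p.axis (M (b i)) ^ 2 := fun p => by
    rw [← b.sum_sq_norm_inner_left]
    refine Finset.sum_congr rfl fun i _ => ?_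
    rw [Real.norm_eq_abs, sq_abs, ContinuousLinearMap.adjoint_inner_left]
  simp_rw [h]
  refine ⟨integrable_finsetSum _ fun i _ => hμ.integrable_sq _, ?_⟩
  rw [integral_finsetSum _ fun i _ => hμ.integrable_sq _]
  simp_rw [hμ.integral_sq]

theorem IsPartitionOfUnity.integrable_one (hμ : IsPartitionOfUnity μ) :
    Integrable (fun _ : AxialProjector E => (1 : ℝ)) μ ∧
      ∫ _ : AxialProjector E, (1 : ℝ) ∂μ = Module.finrank ℝ E := by
  obtain ⟨h1, h2⟩ := hμ.integrable_norm_adjoint_sq (ContinuousLinearMap.id ℝ E)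
  have h : ∀ p : AxialProjector E,
      ‖ContinuousLinearMap.adjoint (ContinuousLinearMap.id ℝ E) p.axis‖ ^ 2 = 1 := fun p => by
    rw [ContinuousLinearMap.adjoint_id, ContinuousLinearMap.id_apply, p.norm_axis, one_pow]
  simp_rw [h] at h1 h2
  refine ⟨h1, h2.trans ?_⟩
  simp

theorem IsPartitionOfUnity.isFiniteMeasure (hμ : IsPartitionOfUnity μ) : IsFiniteMeasure μ :=
  (integrable_const_iff.1 hμ.integrable_one.1).resolve_left one_ne_zero

theorem IsPartitionOfUnity.measure_univ (hμ : IsPartitionOfUnity μ) :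
    μ univ = Module.finrank ℝ E := by
  have := hμ.isFiniteMeasure
  have h := hμ.integrable_one.2
  rw [integral_const, smul_eq_mul, mul_one] at h
  rw [← ENNReal.ofReal_toReal (measure_ne_top μ univ)]
  change ENNReal.ofReal (μ.real univ) = _
  rw [h, ENNReal.ofReal_natCast]

end Bounds

end Partition

end HilbertVolume

/-! ### Uniqueness of John's form -/

namespace HilbertVolume

section Uniqueness

variable {A : Type*} [NormedAddCommGroup A] [NormedSpace ℝ A] {n : ℕ}

theorem sum_norm_sq_adjoint {E ι : Type*} [NormedAddCommGroup E] [InnerProductSpace ℝ E]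
    [CompleteSpace E] [Fintype ι] (b : OrthonormalBasis ι ℝ E) (M : E →L[ℝ] E) :
    ∑ i, ‖ContinuousLinearMap.adjoint M (b i)‖ ^ 2 = ∑ i, ‖M (b i)‖ ^ 2 := by
  have h1 : ∀ i, ‖ContinuousLinearMap.adjoint M (b i)‖ ^ 2 =
      ∑ j, inner ℝ (b i) (M (b j)) ^ 2 := fun i => by
    rw [← b.sum_sq_norm_inner_left]
    refine Finset.sum_congr rfl fun j _ => ?_
    rw [Real.norm_eq_abs, sq_abs, ContinuousLinearMap.adjoint_inner_left]
  have h2 : ∀ j, ‖M (b j)‖ ^ 2 = ∑ i, inner ℝ (b i) (M (b j)) ^ 2 := fun j => by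
    rw [← b.sum_sq_norm_inner_right]
    refine Finset.sum_congr rfl fun i _ => ?_
    rw [Real.norm_eq_abs, sq_abs]
  simp_rw [h1, h2]
  exact Finset.sum_comm

/-- Test the Lipschitz constant on `T'⁻¹ w`, with `w` the adjoint image of the axis: its norm in `A`
is at most `‖w‖`, and the coordinate of its `T`-image is `‖w‖²`. -/
theorem ofReal_norm_adjoint_le_lip (T T' : A ≃L[ℝ] EuclideanSpace ℝ (Fin n))
    (hT' : ∀ x, ‖x‖ ≤ ‖T' x‖) (p : AxialProjector (EuclideanSpace ℝ (Fin n))) :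
    ENNReal.ofReal ‖ContinuousLinearMap.adjoint (T'.symm.trans T :
        EuclideanSpace ℝ (Fin n) →L[ℝ] EuclideanSpace ℝ (Fin n)) p.axis‖ ≤
      lip (fun x => p.coord (T x)) := by
  set w := ContinuousLinearMap.adjoint (T'.symm.trans T :
    EuclideanSpace ℝ (Fin n) →L[ℝ] EuclideanSpace ℝ (Fin n)) p.axis with hw
  refine le_iInf₂ fun K hK => ?_
  rw [← ENNReal.ofReal_coe_nnreal]
  refine ENNReal.ofReal_le_ofReal ?_
  have h := hK.dist_le_mul (T'.symm w) 0
  have h2 : p.coord (T (T'.symm w)) = ‖w‖ ^ 2 := by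
    rw [p.coord_apply, ← real_inner_self_eq_norm_sq]
    conv_rhs => rw [hw, ContinuousLinearMap.adjoint_inner_left]
    rfl
  simp only [map_zero, h2, dist_zero_right, Real.norm_eq_abs, abs_of_nonneg (sq_nonneg ‖w‖)] at h
  have h3 := hT' (T'.symm w)
  rw [T'.apply_symm_apply] at h3
  rcases (norm_nonneg w).eq_or_lt with h0 | h0
  · rw [← h0]; exact K.2
  · have : ‖w‖ ^ 2 ≤ K * ‖w‖ := h.trans (by gcongr)
    nlinarith

theorem sum_norm_sq_le_of_hilb_le_one (hn : n ≠ 0) (T T' : A ≃L[ℝ] EuclideanSpace ℝ (Fin n))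
    (hT' : ∀ x, ‖x‖ ≤ ‖T' x‖) (hT : hilb T ≤ 1) :
    ∑ i, ‖T (T'.symm (stdOrthonormalBasis ℝ (EuclideanSpace ℝ (Fin n)) i))‖ ^ 2 ≤ n := by
  set M : EuclideanSpace ℝ (Fin n) →L[ℝ] EuclideanSpace ℝ (Fin n) :=
    (T'.symm.trans T).toContinuousLinearMap with hM
  set s := ∑ i, ‖M (stdOrthonormalBasis ℝ (EuclideanSpace ℝ (Fin n)) i)‖ ^ 2 with hs
  change s ≤ n
  have h1 : ENNReal.ofReal s ^ (1 / 2 : ℝ) ≤ minDil T := by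
    refine le_iInf₂ fun μ hμ => ?_
    refine ENNReal.rpow_le_rpow ?_ (by norm_num)
    obtain ⟨hi, he⟩ := hμ.integrable_norm_adjoint_sq M
    rw [hs, ← he, ofReal_integral_eq_lintegral_ofReal hi
      (Filter.Eventually.of_forall fun p => sq_nonneg _)]
    refine lintegral_mono fun p => ?_
    rw [ENNReal.ofReal_pow (norm_nonneg _)]
    exact pow_le_pow_left' (ofReal_norm_adjoint_le_lip T T' hT' p) 2
  have h2 : minDil T ≤ (n : ℝ≥0∞) ^ (1 / 2 : ℝ) := by
    have := (ENNReal.div_le_iff (by simp [hn]) (by simp)).1 hT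
    rwa [one_mul] at this
  have h3 := (ENNReal.rpow_le_rpow_iff (by norm_num)).1 (h1.trans h2)
  rw [← ENNReal.ofReal_natCast] at h3
  exact (ENNReal.ofReal_le_ofReal_iff (Nat.cast_nonneg n)).1 h3

/-- Uniqueness of John's form. -/
theorem norm_eq_of_hilb_le_one (hn : n ≠ 0) (T T' : A ≃L[ℝ] EuclideanSpace ℝ (Fin n))
    (hT : ∀ x, ‖x‖ ≤ ‖T x‖) (hT' : ∀ x, ‖x‖ ≤ ‖T' x‖) (h : hilb T ≤ 1) (h' : hilb T' ≤ 1) (x : A) :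
    ‖T x‖ = ‖T' x‖ := by
  set b := stdOrthonormalBasis ℝ (EuclideanSpace ℝ (Fin n))
  set M : EuclideanSpace ℝ (Fin n) →L[ℝ] EuclideanSpace ℝ (Fin n) :=
    (T'.symm.trans T).toContinuousLinearMap with hM
  set N : EuclideanSpace ℝ (Fin n) →L[ℝ] EuclideanSpace ℝ (Fin n) :=
    (T.symm.trans T').toContinuousLinearMap with hN
  have h1 : ∑ i, ‖M (b i)‖ ^ 2 ≤ n := sum_norm_sq_le_of_hilb_le_one hn T T' hT' h
  have h2 : ∑ i, ‖N (b i)‖ ^ 2 ≤ n := sum_norm_sq_le_of_hilb_le_one hn T' T hT h'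
  have hMN : ∀ y, M (N y) = y := fun y => by simp [hM, hN]
  -- As `N` inverts `M`, each cross term is `-2`, and the sum is at most `n - 2n + n`. Hence the
  -- adjoint of `M` is its inverse, and `M` is orthogonal.
  have h3 : ∑ i, ‖ContinuousLinearMap.adjoint M (b i) - N (b i)‖ ^ 2 ≤ 0 := by
    have : ∀ i, ‖ContinuousLinearMap.adjoint M (b i) - N (b i)‖ ^ 2 =
        ‖ContinuousLinearMap.adjoint M (b i)‖ ^ 2 - 2 + ‖N (b i)‖ ^ 2 := fun i => by
      rw [norm_sub_sq_real, ContinuousLinearMap.adjoint_inner_left, hMN,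
        real_inner_self_eq_norm_sq, b.norm_eq_one]
      ring
    simp_rw [this]
    rw [Finset.sum_add_distrib, Finset.sum_sub_distrib, sum_norm_sq_adjoint]
    simp only [Finset.sum_const, Finset.card_univ, Fintype.card_fin, nsmul_eq_mul,
      finrank_euclideanSpace]
    linarith
  have h4 : ContinuousLinearMap.adjoint M = N := by
    have h5 := (Finset.sum_eq_zero_iff_of_nonneg (fun i _ => sq_nonneg _)).1
      (h3.antisymm (Finset.sum_nonneg fun i _ => sq_nonneg _))
    refine ContinuousLinearMap.coe_injective (b.toBasis.ext fun i => ?_)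
    have := h5 i (Finset.mem_univ i)
    rw [sq_eq_zero_iff, norm_eq_zero, sub_eq_zero] at this
    simpa using this
  have h5 : ‖M (T' x)‖ ^ 2 = ‖T' x‖ ^ 2 := by
    rw [← real_inner_self_eq_norm_sq, ← ContinuousLinearMap.adjoint_inner_left, h4]
    simp [hM, hN]
  have h6 : M (T' x) = T x := by simp [hM]
  rw [h6] at h5
  exact (sq_eq_sq₀ (norm_nonneg _) (norm_nonneg _)).1 h5

end Uniqueness

/-! ### Finitely supported partitions of unity and extension of Lipschitz maps -/

section Extension

variable {E : Type*} [NormedAddCommGroup E] [InnerProductSpace ℝ E]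
  {ι : Type*} [Fintype ι]

/-- The combination of the axial projectors of the unit vectors `v i` with the weights `c i`. -/
def atomicMeasure (c : ι → ℝ) (v : ι → E) (hv : ∀ i, ‖v i‖ = 1) : Measure (AxialProjector E) :=
  ∑ i, ENNReal.ofReal (c i) • Measure.dirac (AxialProjector.ofUnit (v i) (hv i))

variable {c : ι → ℝ} {v : ι → E} {hv : ∀ i, ‖v i‖ = 1}

theorem integrable_atomicMeasure {F : Type*} [NormedAddCommGroup F] (g : AxialProjector E → F) :
    Integrable g (atomicMeasure c v hv) := by
  refine integrable_finsetSum_measure.2 fun i _ => ?_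
  exact (integrable_dirac (by simp)).smul_measure ENNReal.ofReal_ne_top

theorem integral_atomicMeasure {F : Type*} [NormedAddCommGroup F] [NormedSpace ℝ F]
    [CompleteSpace F] (hc : ∀ i, 0 ≤ c i) (g : AxialProjector E → F) :
    ∫ p, g p ∂(atomicMeasure c v hv) = ∑ i, c i • g (AxialProjector.ofUnit (v i) (hv i)) := by
  unfold atomicMeasure
  rw [integral_finsetSum_measure fun i _ =>
    (integrable_dirac (by simp)).smul_measure ENNReal.ofReal_ne_top]
  refine Finset.sum_congr rfl fun i _ => ?_
  rw [integral_smul_measure, integral_dirac, ENNReal.toReal_ofReal (hc i)]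

theorem memLp_atomicMeasure (g : AxialProjector E → ℝ) : MemLp g 2 (atomicMeasure c v hv) :=
  (memLp_two_iff_integrable_sq (integrable_atomicMeasure g).aestronglyMeasurable).2
    (integrable_atomicMeasure _)

theorem isPartitionOfUnity_atomicMeasure [FiniteDimensional ℝ E] (hc : ∀ i, 0 ≤ c i)
    (hcv : ∀ y, ∑ i, (c i * inner ℝ (v i) y) • v i = y) :
    IsPartitionOfUnity (atomicMeasure c v hv) where
  integrable _ := integrable_atomicMeasure _
  integral_eq y := by
    rw [integral_atomicMeasure hc]
    conv_rhs => rw [← hcv y]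
    refine Finset.sum_congr rfl fun i _ => ?_
    rw [AxialProjector.coord_ofUnit, AxialProjector.axis_ofUnit, smul_smul]

end Extension

section Extend

variable {A : Type*} [NormedAddCommGroup A] [NormedSpace ℝ A] {n : ℕ}
  {ι : Type*} [Fintype ι] {c : ι → ℝ} {v : ι → EuclideanSpace ℝ (Fin n)}

theorem atomicMeasure_univ (hv : ∀ i, ‖v i‖ = 1) (hc : ∀ i, 0 ≤ c i)
    (hcv : ∀ y, ∑ i, (c i * inner ℝ (v i) y) • v i = y) :
    atomicMeasure c v hv univ = n := by
  rw [(isPartitionOfUnity_atomicMeasure hc hcv).measure_univ, finrank_euclideanSpace,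
    Fintype.card_fin]

theorem hilb_le_one (hn : n ≠ 0) (T : A ≃L[ℝ] EuclideanSpace ℝ (Fin n)) (hv : ∀ i, ‖v i‖ = 1)
    (hc : ∀ i, 0 ≤ c i) (hcv : ∀ y, ∑ i, (c i * inner ℝ (v i) y) • v i = y)
    (hT : ∀ i x, inner ℝ (v i) (T x) ≤ ‖x‖) : hilb T ≤ 1 := by
  rw [hilb, ENNReal.div_le_iff (by simp [hn]) (by simp), one_mul]
  refine (iInf₂_le (atomicMeasure c v hv) (isPartitionOfUnity_atomicMeasure hc hcv)).trans ?_
  refine ENNReal.rpow_le_rpow ?_ (by norm_num)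
  have h1 : ∀ i, lip (fun x => (AxialProjector.ofUnit (v i) (hv i)).coord (T x)) ≤ 1 := fun i => by
    refine (iInf₂_le (1 : ℝ≥0) (LipschitzWith.of_le_add fun x y => ?_)).trans (by simp)
    rw [AxialProjector.coord_ofUnit, AxialProjector.coord_ofUnit, dist_eq_norm]
    have := hT i (x - y)
    rw [map_sub, inner_sub_right] at this
    linarith
  have : ∫⁻ p, lip (fun x => p.coord (T x)) ^ 2 ∂(atomicMeasure c v hv) ≤
      ∫⁻ _, 1 ∂(atomicMeasure c v hv) := by
    unfold atomicMeasure
    rw [lintegral_finsetSum_measure, lintegral_finsetSum_measure]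
    refine Finset.sum_le_sum fun i _ => ?_
    rw [lintegral_smul_measure, lintegral_smul_measure, lintegral_dirac, lintegral_dirac]
    gcongr
    exact pow_le_one' (h1 i) 2
  rwa [lintegral_one, atomicMeasure_univ hv hc hcv] at this

theorem hilbTilde_comp_le {X X' : Type*} [PseudoEMetricSpace X] [PseudoEMetricSpace X']
    (f : X → EuclideanSpace ℝ (Fin n)) {s : X' → X} (hs : LipschitzWith 1 s) :
    hilbTilde (f ∘ s) ≤ hilbTilde f := by
  refine ENNReal.div_le_div_right ?_ _
  refine iInf₂_mono fun μ hμ => ?_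
  refine le_iInf₂ fun g L => le_iInf₂ fun hL hg => le_iInf₂ fun hg2 hgf => ?_
  refine (iInf₂_le (fun p => g p ∘ s) L).trans ?_
  refine (iInf₂_le hL fun p => by simpa using (hg p).comp hs).trans ?_
  exact iInf₂_le (fun x => hg2 (s x)) fun x => hgf (s x)

theorem isExpandingDiffeo_id :
    IsExpandingDiffeo (id : EuclideanSpace ℝ (Fin n) → EuclideanSpace ℝ (Fin n)) where
  contDiff := contDiff_id
  injective := Function.injective_id
  one_le_jac v := by
    rw [fderiv_id, ContinuousLinearMap.det]
    simp

theorem hilJac_le_one {X : Type*} [PseudoEMetricSpace X] {f : X → EuclideanSpace ℝ (Fin n)}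
    (hf : hilbTilde f ≤ 1) (x : X) : hilJac f x ≤ 1 := by
  refine (iInf₂_le univ Filter.univ_mem).trans ?_
  refine (iInf₂_le id isExpandingDiffeo_id).trans ?_
  exact pow_le_one' ((hilbTilde_comp_le f (LipschitzWith.subtype_val _)).trans hf) n

/-- Lipschitz maps to `A` extend, as maps to the Euclidean space of John's form, with Hilbert
constant at most `1`. -/
theorem exists_extension_hilbTilde_le_one (hn : n ≠ 0) (T : A ≃L[ℝ] EuclideanSpace ℝ (Fin n))
    (hv : ∀ i, ‖v i‖ = 1)
    (hc : ∀ i, 0 ≤ c i) (hcv : ∀ y, ∑ i, (c i * inner ℝ (v i) y) • v i = y)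
    (hT : ∀ i x, inner ℝ (v i) (T x) ≤ ‖x‖) {X : Type*} [PseudoMetricSpace X] {Y : Set X}
    {φ : X → A} (hφ : LipschitzOnWith 1 φ Y) :
    ∃ f : X → EuclideanSpace ℝ (Fin n), (∃ K, LipschitzWith K f) ∧ hilbTilde f ≤ 1 ∧
      ∀ y ∈ Y, f y = T (φ y) := by
  -- The family must be defined and 1-Lipschitz for every projector. Coordinates of norm at most one
  -- on `A` are extended from `Y` as real functions; for the others, which are not atoms of the
  -- measure, zero will do.
  have key : ∀ p : AxialProjector (EuclideanSpace ℝ (Fin n)), ∃ g : X → ℝ, LipschitzWith 1 g ∧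
      ((∀ x, inner ℝ p.axis (T x) ≤ ‖x‖) → ∀ y ∈ Y, g y = inner ℝ p.axis (T (φ y))) := fun p => by
    by_cases hp : ∀ x, inner ℝ p.axis (T x) ≤ ‖x‖
    · have : LipschitzOnWith 1 (fun y => inner ℝ p.axis (T (φ y))) Y := by
        refine LipschitzOnWith.of_le_add fun x hx y hy => ?_
        have h1 := hp (φ x - φ y)
        have h2 := hφ.dist_le_mul x hx y hy
        rw [map_sub, inner_sub_right, ← dist_eq_norm] at h1
        rw [NNReal.coe_one, one_mul] at h2
        linarith
      obtain ⟨g, hg, hgY⟩ := this.extend_real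
      exact ⟨g, hg, fun _ y hy => (hgY hy).symm⟩
    · exact ⟨fun _ => 0, LipschitzWith.const' 0, fun h => absurd h hp⟩
  choose g hg hgY using key
  have hf : ∀ x, ∫ p : AxialProjector _, g p x • p.axis ∂(atomicMeasure c v hv) =
      ∑ i, c i • g (.ofUnit (v i) (hv i)) x • v i := fun x => integral_atomicMeasure hc _
  refine ⟨fun x => ∑ i, c i • g (.ofUnit (v i) (hv i)) x • v i, ⟨∑ i, ‖c i‖₊ * 1, ?_⟩, ?_, ?_⟩
  · refine LipschitzWith.of_dist_le_mul fun x y => ?_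
    rw [dist_eq_norm, ← Finset.sum_sub_distrib]
    refine (norm_sum_le _ _).trans ?_
    push_cast
    rw [Finset.sum_mul]
    refine Finset.sum_le_sum fun i _ => ?_
    rw [← smul_sub, ← sub_smul, norm_smul, norm_smul, hv, mul_one, mul_one]
    gcongr
    simpa [Real.dist_eq] using (hg (.ofUnit (v i) (hv i))).dist_le_mul x y
  · rw [hilbTilde, ENNReal.div_le_iff (by simp [hn]) (by simp), one_mul]
    refine (iInf₂_le (atomicMeasure c v hv) (isPartitionOfUnity_atomicMeasure hc hcv)).trans ?_
    refine (iInf₂_le g fun _ => 1).trans ?_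
    refine (iInf₂_le measurable_const hg).trans ?_
    refine (iInf₂_le (fun x => memLp_atomicMeasure _) hf).trans ?_
    simp [atomicMeasure_univ hv hc hcv]
  · intro y hy
    conv_rhs => rw [← hcv (T (φ y))]
    refine Finset.sum_congr rfl fun i _ => ?_
    rw [hgY (.ofUnit (v i) (hv i)) (hT i) y hy, smul_smul, AxialProjector.axis_ofUnit]

end Extend

end HilbertVolume

/-! ### Bounding the Jacobian by averaging over balls -/

namespace HilbertVolume

section Polar

variable {n : ℕ}

local notation "E" => EuclideanSpace ℝ (Fin n)

/-- The singular value decomposition of an invertible endomorphism. -/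
theorem exists_orthonormalBasis_isometry (B : E →L[ℝ] E) (hB : B.det ≠ 0) :
    ∃ (b : OrthonormalBasis (Fin n) ℝ E) (Q : E ≃ₗᵢ[ℝ] E) (lam : Fin n → ℝ),
      (∀ i, 0 ≤ lam i) ∧ (∀ i, B (b i) = lam i • Q (b i)) ∧ |B.det| = ∏ i, lam i := by
  have hE : Module.finrank ℝ E = n := by simp
  set S : E →ₗ[ℝ] E := LinearMap.adjoint (B : E →ₗ[ℝ] E) ∘ₗ (B : E →ₗ[ℝ] E) with hS
  have hpos : S.IsPositive := LinearMap.isPositive_adjoint_comp_self _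
  have hsym := hpos.isSymmetric
  set b := hsym.eigenvectorBasis hE with hb
  set ev := hsym.eigenvalues hE with hev
  have hev0 : ∀ i, 0 ≤ ev i := hpos.nonneg_eigenvalues hE
  have hin : ∀ i j, inner ℝ (B (b i)) (B (b j)) = if i = j then ev j else 0 := fun i j => by
    have h1 : inner ℝ (B (b i)) (B (b j)) = inner ℝ (b i) (S (b j)) := by
      rw [hS, LinearMap.comp_apply, LinearMap.adjoint_inner_right]; rfl
    rw [h1, hsym.apply_eigenvectorBasis hE j, inner_smul_right]
    rw [orthonormal_iff_ite.1 b.orthonormal i j]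
    split_ifs <;> simp [hev]
  have hdet : B.det ^ 2 = ∏ i, ev i := by
    have := hsym.det_eq_prod_eigenvalues hE
    have h2 : LinearMap.det S = B.det ^ 2 := by
      rw [hS, LinearMap.det_comp, det_adjoint_eq, sq]
    rw [← h2, this]; rfl
  have hev1 : ∀ i, 0 < ev i := fun i => by
    refine (hev0 i).lt_of_ne fun h => hB ?_
    have : ∏ i, ev i = 0 := Finset.prod_eq_zero (Finset.mem_univ i) h.symm
    rw [this] at hdet
    exact pow_eq_zero_iff two_ne_zero |>.1 hdet
  have hsq : ∀ i, 0 < Real.sqrt (ev i) := fun i => Real.sqrt_pos.2 (hev1 i)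
  have hon : Orthonormal ℝ fun i => (Real.sqrt (ev i))⁻¹ • B (b i) := by
    rw [orthonormal_iff_ite]
    intro i j
    rw [inner_smul_left, inner_smul_right, hin]
    split_ifs with h
    · subst h
      have := Real.mul_self_sqrt (hev0 i)
      have h2 := (hsq i).ne'
      simp only [conj_trivial]
      field_simp
      rw [sq]; exact this.symm
    · simp
  obtain ⟨b', hb'⟩ : ∃ b' : OrthonormalBasis (Fin n) ℝ E,
      ∀ i, b' i = (Real.sqrt (ev i))⁻¹ • B (b i) := by
    refine ⟨OrthonormalBasis.mk hon ?_, fun i => by rw [OrthonormalBasis.coe_mk]⟩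
    rw [hon.linearIndependent.span_eq_top_of_card_eq_finrank' (by simp)]
  refine ⟨b, b.equiv b' (Equiv.refl _), fun i => Real.sqrt (ev i), fun i => Real.sqrt_nonneg _,
    fun i => ?_, ?_⟩
  · rw [OrthonormalBasis.equiv_apply_basis, Equiv.refl_apply, hb',
      smul_inv_smul₀ (hsq i).ne']
  · rw [← Real.sqrt_sq_eq_abs, hdet]
    exact Real.sqrt_prod _ fun i _ => hev0 i

end Polar

section Ball

variable {E : Type*} [NormedAddCommGroup E] [InnerProductSpace ℝ E] [FiniteDimensional ℝ E]
  [MeasurableSpace E] [BorelSpace E]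

theorem setIntegral_ball_comp_isometry (R : E ≃ₗᵢ[ℝ] E) (f : E → ℝ) :
    ∫ θ in Metric.ball (0 : E) 1, f (R θ) = ∫ θ in Metric.ball (0 : E) 1, f θ := by
  have h := R.measurePreserving.setIntegral_preimage_emb
    R.toHomeomorph.measurableEmbedding f (Metric.ball 0 1)
  rwa [show R ⁻¹' Metric.ball 0 1 = Metric.ball 0 1 by ext; simp] at h

theorem integrableOn_ball_of_continuous {f : E → ℝ} (hf : Continuous f) :
    IntegrableOn f (Metric.ball (0 : E) 1) :=
  (hf.continuousOn.integrableOn_compact (isCompact_closedBall 0 1)).mono_set Metric.ball_subset_closedBall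

/-- A reflection carries `u` to `u'` and preserves the ball. -/
theorem setIntegral_ball_inner_sq_eq {u u' : E} (h : ‖u‖ = ‖u'‖) :
    ∫ θ in Metric.ball (0 : E) 1, inner ℝ u θ ^ 2 =
      ∫ θ in Metric.ball (0 : E) 1, inner ℝ u' θ ^ 2 := by
  set R := (ℝ ∙ (u - u'))ᗮ.reflection with hR
  rw [← setIntegral_ball_comp_isometry R fun θ => inner ℝ u' θ ^ 2]
  refine integral_congr_ae (Filter.Eventually.of_forall fun θ => ?_)
  have h1 : R u = u' := Submodule.reflection_sub h
  simp only
  rw [← h1, LinearIsometryEquiv.inner_map_map]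

theorem setIntegral_ball_inner_sq_pos {u : E} (h : ‖u‖ = 1) :
    0 < ∫ θ in Metric.ball (0 : E) 1, inner ℝ u θ ^ 2 := by
  have hc : Continuous fun θ : E => inner ℝ u θ ^ 2 := by fun_prop
  rw [setIntegral_pos_iff_support_of_nonneg_ae
    (Filter.Eventually.of_forall fun θ => sq_nonneg _) (integrableOn_ball_of_continuous hc)]
  refine (hc.isOpen_support.inter Metric.isOpen_ball).measure_pos _ ⟨(1 / 2 : ℝ) • u, ?_, ?_⟩
  · simp [inner_smul_right, h]
  · simp [norm_smul, h]; norm_num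

/-- Pair `θ` with its mirror image in the hyperplane orthogonal to `u`: the weight changes sign, and
the two points are at distance `2 |⟪u, θ⟫|`. -/
theorem setIntegral_ball_inner_mul_le {u : E} (hu : ‖u‖ = 1) {k : E → ℝ} {C : ℝ}
    (hk : ∀ θ ∈ Metric.ball (0 : E) 1, ∀ θ' ∈ Metric.ball (0 : E) 1,
      |k θ - k θ'| ≤ C * ‖θ - θ'‖)
    (hi : IntegrableOn (fun θ => inner ℝ u θ * k θ) (Metric.ball (0 : E) 1)) :
    ∫ θ in Metric.ball (0 : E) 1, inner ℝ u θ * k θ ≤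
      C * ∫ θ in Metric.ball (0 : E) 1, inner ℝ u θ ^ 2 := by
  set R := (ℝ ∙ u)ᗮ.reflection with hR
  have hRθ : ∀ θ, R θ = θ - (2 * inner ℝ u θ) • u := fun θ => by
    rw [hR, Submodule.reflection_orthogonal_apply, Submodule.reflection_singleton_apply, hu]
    simp [two_smul, two_mul, add_smul]
  have hRu : ∀ θ, inner ℝ u (R θ) = - inner ℝ u θ := fun θ => by
    rw [hRθ, inner_sub_right, inner_smul_right, real_inner_self_eq_norm_sq, hu]; ring
  have h1 : ∫ θ in Metric.ball (0 : E) 1, inner ℝ u (R θ) * k (R θ) =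
      ∫ θ in Metric.ball (0 : E) 1, inner ℝ u θ * k θ :=
    setIntegral_ball_comp_isometry R fun θ => inner ℝ u θ * k θ
  have hi' : IntegrableOn (fun θ => inner ℝ u (R θ) * k (R θ)) (Metric.ball (0 : E) 1) := by
    have h := (R.measurePreserving.integrableOn_comp_preimage
      R.toHomeomorph.measurableEmbedding (s := Metric.ball 0 1)).2 hi
    rwa [show R ⁻¹' Metric.ball 0 1 = Metric.ball 0 1 by ext; simp] at h
  have h2 : ∫ θ in Metric.ball (0 : E) 1, (inner ℝ u θ * k θ + inner ℝ u (R θ) * k (R θ)) ≤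
      ∫ θ in Metric.ball (0 : E) 1, 2 * C * inner ℝ u θ ^ 2 := by
    refine setIntegral_mono_on (hi.add hi')
      (integrableOn_ball_of_continuous (by fun_prop)) Metric.isOpen_ball.measurableSet fun θ hθ => ?_
    have h3 := hk θ hθ (R θ) (by simpa using hθ)
    rw [hRθ θ, sub_sub_cancel, norm_smul, hu, mul_one, ← hRθ θ, Real.norm_eq_abs, abs_mul,
      abs_two] at h3
    rw [hRu]
    calc inner ℝ u θ * k θ + -inner ℝ u θ * k (R θ) = inner ℝ u θ * (k θ - k (R θ)) := by ring
      _ ≤ |inner ℝ u θ| * |k θ - k (R θ)| := by rw [← abs_mul]; exact le_abs_self _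
      _ ≤ |inner ℝ u θ| * (C * (2 * |inner ℝ u θ|)) := by gcongr
      _ = 2 * C * inner ℝ u θ ^ 2 := by rw [← sq_abs (inner ℝ u θ)]; ring
  rw [integral_add hi hi', h1, integral_const_mul] at h2
  linarith

end Ball

section Caratheodory

/-- Approximate the continuous variable by simple functions with values in `s`. This gives the joint
measurability that Fubini needs for the families `g_p`. -/
theorem aestronglyMeasurable_uncurry_of_continuousOn {E α : Type*} [PseudoEMetricSpace E]
    [MeasurableSpace E] [OpensMeasurableSpace E] [TopologicalSpace.SeparableSpace E]
    [SecondCountableTopology E]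
    [MeasurableSpace α] {μ : Measure α} [SFinite μ] {ν : Measure E} [SFinite ν] {s : Set E}
    (hs : MeasurableSet s) {y₀ : E} (h₀ : y₀ ∈ s) {h : E → α → ℝ}
    (hc : ∀ p, ContinuousOn (fun θ => h θ p) s) (hm : ∀ θ ∈ s, AEStronglyMeasurable (h θ) μ) :
    AEStronglyMeasurable (Function.uncurry h) ((ν.restrict s).prod μ) := by
  set σ := SimpleFunc.approxOn (id : E → E) measurable_id s y₀ h₀
  have hσ : ∀ k θ, σ k θ ∈ s := fun k θ => SimpleFunc.approxOn_mem _ _ k θ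
  refine aestronglyMeasurable_of_tendsto_ae Filter.atTop
    (f := fun k z => h (σ k z.1) z.2) (fun k => ?_) ?_
  · have : (fun z : E × α => h (σ k z.1) z.2) = fun z : E × α =>
        ∑ c ∈ (σ k).range, ((σ k ⁻¹' {c}).indicator (fun _ => (1 : ℝ)) z.1) * h c z.2 := by
      funext z
      rw [Finset.sum_eq_single (σ k z.1)]
      · simp
      · intro c _ hc
        rw [indicator_of_notMem (fun h => hc h.symm), zero_mul]
      · intro h
        exact absurd ((σ k).mem_range_self z.1) h
    rw [this]
    refine Finset.aestronglyMeasurable_fun_sum _ fun c hc => ?_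
    refine AEStronglyMeasurable.mul ?_ ?_
    · exact (aestronglyMeasurable_const.indicator ((σ k).measurableSet_fiber c)).comp_fst
    · obtain ⟨θ, rfl⟩ := SimpleFunc.mem_range.1 hc
      exact (hm _ (hσ k θ)).comp_snd
  · have h1 : ∀ᵐ z ∂((ν.restrict s).prod μ), z.1 ∈ s :=
      Measure.quasiMeasurePreserving_fst.ae (ae_restrict_mem hs)
    filter_upwards [h1] with z hz
    have h2 : Filter.Tendsto (fun k => σ k z.1) Filter.atTop (𝓝 z.1) :=
      SimpleFunc.tendsto_approxOn measurable_id h₀ (subset_closure hz)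
    exact ((hc z.2 z.1 hz).tendsto).comp
      (tendsto_nhdsWithin_iff.2 ⟨h2, Filter.Eventually.of_forall fun k => hσ k z.1⟩)

end Caratheodory

section LocalBound

variable {n : ℕ}

local notation "E" => EuclideanSpace ℝ (Fin n)

theorem inner_isometry_apply_eq_sum (b : OrthonormalBasis (Fin n) ℝ E) (Q : E ≃ₗᵢ[ℝ] E)
    {lam : Fin n → ℝ} {B : E →L[ℝ] E} (hB : ∀ i, B (b i) = lam i • Q (b i)) (θ : E) :
    inner ℝ (Q θ) (B θ) = ∑ i, lam i * inner ℝ (b i) θ ^ 2 := by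
  have h1 : B θ = ∑ i, inner ℝ (b i) θ • lam i • Q (b i) := by
    conv_lhs => rw [← b.sum_repr' θ]
    rw [map_sum]
    simp_rw [map_smul, hB]
  rw [h1, inner_sum]
  refine Finset.sum_congr rfl fun i _ => ?_
  rw [inner_smul_right, inner_smul_right, LinearIsometryEquiv.inner_map_map, real_inner_comm θ]
  ring

/-- Average `⟪Q θ, F (x + r θ) - F x⟫` over the unit ball. Differentiability gives about `r κ ∑ lam
i`; inserting the decomposition of `F` and exchanging the integrals gives at most `r κ ∫ L`.
Averaging avoids any differentiation of the `g p`. -/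
theorem sum_le_integral_of_hasFDerivAt (hn : n ≠ 0) {μ : Measure (AxialProjector E)}
    [IsFiniteMeasure μ] {F : E → E} {B : E →L[ℝ] E} {x : E} (hF : HasFDerivAt F B x)
    {δ : ℝ} (hδ : 0 < δ) {g : AxialProjector E → E → ℝ} {L : AxialProjector E → ℝ≥0}
    (hL : Integrable (fun p => (L p : ℝ)) μ)
    (hg : ∀ p, LipschitzOnWith (L p) (g p) (Metric.ball x δ))
    (hg2 : ∀ z ∈ Metric.ball x δ, Integrable (fun p => g p z) μ)
    (hgF : ∀ z ∈ Metric.ball x δ, ∫ p : AxialProjector E, g p z • p.axis ∂μ = F z)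
    (b : OrthonormalBasis (Fin n) ℝ E) (Q : E ≃ₗᵢ[ℝ] E) {lam : Fin n → ℝ}
    (hB : ∀ i, B (b i) = lam i • Q (b i)) : ∑ i, lam i ≤ ∫ p, (L p : ℝ) ∂μ := by
  set D := Metric.ball (0 : E) 1 with hD
  set κ := ∫ θ in D, inner ℝ (b ⟨0, Nat.pos_of_ne_zero hn⟩) θ ^ 2 with hκ
  have hκ0 : 0 < κ := setIntegral_ball_inner_sq_pos (b.norm_eq_one _)
  have hκu : ∀ u : E, ‖u‖ = 1 → ∫ θ in D, inner ℝ u θ ^ 2 = κ := fun u hu =>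
    setIntegral_ball_inner_sq_eq (by rw [hu, b.norm_eq_one])
  have hV : 0 < volume.real D :=
    ENNReal.toReal_pos (Metric.measure_ball_pos _ _ one_pos).ne' measure_ball_lt_top.ne
  have hQB : Continuous fun θ => inner ℝ (Q θ) (B θ) := by fun_prop
  have htr : ∫ θ in D, inner ℝ (Q θ) (B θ) = κ * ∑ i, lam i := by
    simp_rw [inner_isometry_apply_eq_sum b Q hB]
    rw [integral_finsetSum _ fun i _ => integrableOn_ball_of_continuous (by fun_prop)]
    rw [Finset.mul_sum]
    refine Finset.sum_congr rfl fun i _ => ?_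
    rw [integral_const_mul, hκu _ (b.norm_eq_one _), mul_comm]
  suffices h : κ * ∑ i, lam i ≤ κ * ∫ p, (L p : ℝ) ∂μ from le_of_mul_le_mul_left h hκ0
  refine le_of_forall_pos_le_add fun η hη => ?_
  -- Chosen so that the linearization error `ε r`, integrated over the ball, is `η r`.
  set ε := η / volume.real D with hε
  have hε0 : 0 < ε := div_pos hη hV
  obtain ⟨r₀, hr₀, hFr⟩ := Metric.eventually_nhds_iff_ball.1
    ((hasFDerivAt_iff_isLittleO_nhds_zero.1 hF).def hε0)
  set r := min r₀ δ with hr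
  have hr0 : 0 < r := lt_min hr₀ hδ
  have hrθ : ∀ θ ∈ D, ‖r • θ‖ < r := fun θ hθ => by
    rw [norm_smul, Real.norm_of_nonneg hr0.le]
    have : ‖θ‖ < 1 := by simpa [hD] using hθ
    nlinarith
  have hmem : ∀ θ ∈ D, x + r • θ ∈ Metric.ball x δ := fun θ hθ => by
    rw [mem_ball_iff_norm, add_sub_cancel_left]
    exact (hrθ θ hθ).trans_le (min_le_right _ _)
  have hx : x ∈ Metric.ball x δ := Metric.mem_ball_self hδ
  set h : E → AxialProjector E → ℝ := fun θ p => g p (x + r • θ) - g p x with hh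
  have hhL : ∀ p, ∀ θ ∈ D, ∀ θ' ∈ D, |h θ p - h θ' p| ≤ (r * L p) * ‖θ - θ'‖ :=
    fun p θ hθ θ' hθ' => by
      have := (hg p).dist_le_mul _ (hmem θ hθ) _ (hmem θ' hθ')
      rw [dist_eq_norm, dist_eq_norm, add_sub_add_left_eq_sub, ← smul_sub, norm_smul,
        Real.norm_of_nonneg hr0.le, Real.norm_eq_abs] at this
      simp only [hh, sub_sub_sub_cancel_right]
      linarith
  set K : E → AxialProjector E → ℝ := fun θ p => inner ℝ (Q θ) p.axis * h θ p with hK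
  have hax : ∀ θ : E, AEStronglyMeasurable
      (fun p : AxialProjector E => inner ℝ (Q θ) p.axis) μ := fun θ =>
    (continuous_const.inner AxialProjector.continuous_axis).aestronglyMeasurable
  have hKm : AEStronglyMeasurable (Function.uncurry K) ((volume.restrict D).prod μ) := by
    refine aestronglyMeasurable_uncurry_of_continuousOn Metric.isOpen_ball.measurableSet
      (Metric.mem_ball_self one_pos) (fun p => ?_) fun θ hθ => ?_
    · refine ContinuousOn.mul (by fun_prop) (ContinuousOn.sub ?_ continuousOn_const)
      exact (hg p).continuousOn.comp (by fun_prop) hmem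
    · exact (hax θ).mul
        ((hg2 _ (hmem θ hθ)).aestronglyMeasurable.sub (hg2 x hx).aestronglyMeasurable)
  have hKi : Integrable (Function.uncurry K) ((volume.restrict D).prod μ) := by
    have : IsFiniteMeasure (volume.restrict D) := ⟨by
      rw [Measure.restrict_apply_univ]; exact measure_ball_lt_top⟩
    refine ((hL.comp_snd (volume.restrict D)).const_mul r).mono' hKm ?_
    have h1 : ∀ᵐ z ∂((volume.restrict D).prod μ), z.1 ∈ D :=
      Measure.quasiMeasurePreserving_fst.ae (ae_restrict_mem Metric.isOpen_ball.measurableSet)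
    filter_upwards [h1] with z hz
    have hz1 : ‖z.1‖ < 1 := by simpa [hD] using hz
    have h2 : |inner ℝ (Q z.1) z.2.axis| ≤ 1 := by
      refine (abs_real_inner_le_norm _ _).trans ?_
      rw [z.2.norm_axis, mul_one, Q.norm_map]
      exact hz1.le
    have h3 := hhL z.2 z.1 hz 0 (Metric.mem_ball_self one_pos)
    have h4 : h 0 z.2 = 0 := by simp [hh]
    rw [h4, sub_zero, sub_zero] at h3
    have h5 : 0 ≤ r * L z.2 := by positivity
    simp only [Function.uncurry, hK, Real.norm_eq_abs, abs_mul]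
    calc |inner ℝ (Q z.1) z.2.axis| * |h z.1 z.2| ≤ 1 * (r * L z.2 * 1) := by
          gcongr
          exact h3.trans (by gcongr)
      _ = r * L z.2 := by ring
  have hga : ∀ z ∈ Metric.ball x δ, Integrable (fun p : AxialProjector E => g p z • p.axis) μ :=
    fun z hz => by
      refine (hg2 z hz).norm.mono' ((hg2 z hz).aestronglyMeasurable.smul
        AxialProjector.continuous_axis.aestronglyMeasurable)
        (Filter.Eventually.of_forall fun p => ?_)
      rw [norm_smul, p.norm_axis, mul_one]
  have hleft : ∀ θ ∈ D, r * inner ℝ (Q θ) (B θ) - ε * r ≤ ∫ p, K θ p ∂μ := fun θ hθ => by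
    have h1 : ∫ p, K θ p ∂μ = inner ℝ (Q θ) (F (x + r • θ) - F x) := by
      rw [← hgF _ (hmem θ hθ), ← hgF x hx, ← integral_sub (hga _ (hmem θ hθ)) (hga x hx)]
      refine Eq.trans ?_ (integral_inner (𝕜 := ℝ) ((hga _ (hmem θ hθ)).sub (hga x hx)) (Q θ))
      refine integral_congr_ae (Filter.Eventually.of_forall fun p => ?_)
      simp only [hK, hh, Pi.sub_apply, ← sub_smul, inner_smul_right]
      ring
    have h2 : ‖F (x + r • θ) - F x - B (r • θ)‖ ≤ ε * ‖r • θ‖ :=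
      hFr _ (by rw [mem_ball_zero_iff]; exact (hrθ θ hθ).trans_le (min_le_left _ _))
    have h3 : F (x + r • θ) - F x = r • B θ + (F (x + r • θ) - F x - B (r • θ)) := by
      rw [map_smul]; abel
    rw [h1, h3, inner_add_right, inner_smul_right]
    have h4 := (abs_le.1 (abs_real_inner_le_norm (Q θ) (F (x + r • θ) - F x - B (r • θ)))).1
    have h5 : ‖θ‖ < 1 := by simpa [hD] using hθ
    have h6 : ‖Q θ‖ * ‖F (x + r • θ) - F x - B (r • θ)‖ ≤ 1 * (ε * r) := by
      rw [Q.norm_map]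
      gcongr
      exact h2.trans (by gcongr; exact (hrθ θ hθ).le)
    linarith
  have hright : ∀ᵐ p ∂μ, ∫ θ in D, K θ p ≤ r * L p * κ := by
    filter_upwards [hKi.prod_left_ae] with p hp
    have hu : ‖Q.symm p.axis‖ = 1 := by rw [Q.symm.norm_map, p.norm_axis]
    have hin : ∀ θ, inner ℝ (Q θ) p.axis = inner ℝ (Q.symm p.axis) θ := fun θ => by
      rw [← Q.inner_map_map (Q.symm p.axis), Q.apply_symm_apply, real_inner_comm]
    simp only [hK, Function.uncurry, hin] at hp ⊢
    rw [← hκu _ hu]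
    exact setIntegral_ball_inner_mul_le hu (hhL p) hp
  have hswap := integral_integral_swap hKi
  have h1 : r * (κ * ∑ i, lam i) - ε * r * volume.real D ≤ ∫ θ in D, ∫ p, K θ p ∂μ := by
    rw [← htr, ← integral_const_mul, mul_comm _ (volume.real D), ← smul_eq_mul (volume.real D),
      ← setIntegral_const, ← integral_sub ((integrableOn_ball_of_continuous hQB).const_mul r)
        (integrableOn_const measure_ball_lt_top.ne)]
    exact setIntegral_mono_on
      (((integrableOn_ball_of_continuous hQB).const_mul r).sub
        (integrableOn_const measure_ball_lt_top.ne))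
      hKi.integral_prod_left Metric.isOpen_ball.measurableSet hleft
  have h2 : ∫ p, (∫ θ in D, K θ p) ∂μ ≤ r * κ * ∫ p, (L p : ℝ) ∂μ := by
    rw [← integral_const_mul]
    refine integral_mono_ae hKi.integral_prod_right (hL.const_mul _) ?_
    filter_upwards [hright] with p hp
    exact hp.trans_eq (by ring)
  rw [hswap] at h1
  have h3 : ε * volume.real D = η := div_mul_cancel₀ _ hV.ne'
  have h4 : r * (κ * ∑ i, lam i) ≤ r * (κ * (∫ p, (L p : ℝ) ∂μ) + η) := by
    rw [← h3]; linarith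
  exact le_of_mul_le_mul_left h4 hr0

/-- A map with a decomposition along an axial partition of unity has a small Jacobian. -/
theorem abs_det_rpow_le (hn : n ≠ 0) {μ : Measure (AxialProjector E)}
    (hμ : IsPartitionOfUnity μ) {F : E → E} {B : E →L[ℝ] E} {x : E} (hF : HasFDerivAt F B x)
    {δ : ℝ} (hδ : 0 < δ) {g : AxialProjector E → E → ℝ} {L : AxialProjector E → ℝ≥0}
    (hL : Measurable L) (hg : ∀ p, LipschitzOnWith (L p) (g p) (Metric.ball x δ))
    (hg2 : ∀ z ∈ Metric.ball x δ, MemLp (fun p => g p z) 2 μ)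
    (hgF : ∀ z ∈ Metric.ball x δ, ∫ p : AxialProjector E, g p z • p.axis ∂μ = F z) :
    ENNReal.ofReal |B.det| ^ (n⁻¹ : ℝ) * (n : ℝ≥0∞) ^ (1 / 2 : ℝ) ≤
      (∫⁻ p, (L p : ℝ≥0∞) ^ 2 ∂μ) ^ (1 / 2 : ℝ) := by
  have hn' : (0 : ℝ) < n := by exact_mod_cast Nat.pos_of_ne_zero hn
  by_cases hB : B.det = 0
  · rw [hB, abs_zero, ENNReal.ofReal_zero, ENNReal.zero_rpow_of_pos (by positivity), zero_mul]
    exact zero_le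
  by_cases htop : ∫⁻ p, (L p : ℝ≥0∞) ^ 2 ∂μ = ⊤
  · rw [htop, ENNReal.top_rpow_of_pos (by norm_num)]
    exact le_top
  have := hμ.isFiniteMeasure
  -- Cauchy–Schwarz against the constant one; `n` is the mass of `μ`.
  have hCS : ∫⁻ p, (L p : ℝ≥0∞) ∂μ ≤
      (∫⁻ p, (L p : ℝ≥0∞) ^ 2 ∂μ) ^ (1 / 2 : ℝ) * (n : ℝ≥0∞) ^ (1 / 2 : ℝ) := by
    have h := ENNReal.lintegral_mul_le_Lp_mul_Lq μ Real.HolderConjugate.two_two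
      (f := fun p => (L p : ℝ≥0∞)) (g := fun _ => 1) hL.coe_nnreal_ennreal.aemeasurable
      aemeasurable_const
    simpa [hμ.measure_univ] using h
  have hfin : (∫⁻ p, (L p : ℝ≥0∞) ^ 2 ∂μ) ^ (1 / 2 : ℝ) * (n : ℝ≥0∞) ^ (1 / 2 : ℝ) ≠ ⊤ :=
    ENNReal.mul_ne_top (ENNReal.rpow_ne_top_of_nonneg (by norm_num) htop)
      (ENNReal.rpow_ne_top_of_nonneg (by norm_num) (by simp))
  have hLm : AEStronglyMeasurable (fun p => (L p : ℝ)) μ :=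
    hL.coe_nnreal_real.aestronglyMeasurable
  have hLi : Integrable (fun p => (L p : ℝ)) μ := by
    refine ⟨hLm, ?_⟩
    rw [hasFiniteIntegral_iff_enorm]
    refine lt_of_le_of_lt ?_ (hCS.trans_lt hfin.lt_top)
    exact lintegral_mono fun p => by simp
  have hint : ENNReal.ofReal (∫ p, (L p : ℝ) ∂μ) = ∫⁻ p, (L p : ℝ≥0∞) ∂μ := by
    rw [ofReal_integral_eq_lintegral_ofReal hLi (Filter.Eventually.of_forall fun p => (L p).2)]
    simp
  obtain ⟨b, Q, lam, hlam, hbQ, hdet⟩ := exists_orthonormalBasis_isometry B hB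
  have h1 := sum_le_integral_of_hasFDerivAt hn hF hδ hLi hg
    (fun z hz => (hg2 z hz).integrable one_le_two) hgF b Q hbQ
  have h2 : |B.det| ^ (n⁻¹ : ℝ) * n ≤ ∑ i, lam i := by
    have h3 := Real.geom_mean_le_arith_mean_weighted Finset.univ (fun _ : Fin n => (n⁻¹ : ℝ)) lam
      (fun _ _ => by positivity) (by simp [hn]) (fun i _ => hlam i)
    rw [Real.finsetProd_rpow _ _ (fun i _ => hlam i), ← hdet, ← Finset.mul_sum] at h3
    calc |B.det| ^ (n⁻¹ : ℝ) * n ≤ (n : ℝ)⁻¹ * (∑ i, lam i) * n := by gcongr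
      _ = ∑ i, lam i := by field_simp
  have h4 := (ENNReal.ofReal_le_ofReal (h2.trans h1)).trans (hint.le.trans hCS)
  rw [ENNReal.ofReal_mul (by positivity), ENNReal.ofReal_natCast,
    ← ENNReal.ofReal_rpow_of_nonneg (abs_nonneg _) (by positivity)] at h4
  have h5 : (n : ℝ≥0∞) = (n : ℝ≥0∞) ^ (1 / 2 : ℝ) * (n : ℝ≥0∞) ^ (1 / 2 : ℝ) := by
    rw [← ENNReal.rpow_add _ _ (by simp [hn]) (by simp)]
    norm_num
  rw [show ENNReal.ofReal |B.det| ^ (n⁻¹ : ℝ) * (n : ℝ≥0∞) =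
    ENNReal.ofReal |B.det| ^ (n⁻¹ : ℝ) * (n : ℝ≥0∞) ^ (1 / 2 : ℝ) * (n : ℝ≥0∞) ^ (1 / 2 : ℝ) by
      rw [mul_assoc, ← h5]] at h4
  exact (ENNReal.mul_le_mul_iff_left (by simp [hn]) (by simp)).1 h4

end LocalBound

end HilbertVolume

/-! ### Upper bound for the global volume -/

namespace HilbertVolume

section UpperBound

variable {n : ℕ}

local notation "E" => EuclideanSpace ℝ (Fin n)

/-- The Hilbert Jacobian bounds the Jacobian along every `1`-Lipschitz parametrization. -/
theorem abs_det_le_hilJac {M : Type*} [PseudoEMetricSpace M] (hn : n ≠ 0) {f : M → E} {s : E → M}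
    {Ω : Set E} (hΩ : IsOpen Ω) (hs : LipschitzOnWith 1 s Ω) {x : E} (hx : x ∈ Ω) {B : E →L[ℝ] E}
    (hB : HasFDerivAt (f ∘ s) B x) : ENNReal.ofReal |B.det| ≤ hilJac f (s x) := by
  classical
  refine le_iInf₂ fun W hW => le_iInf₂ fun φ hφ => ?_
  set B' := (fderiv ℝ φ (f (s x))).comp B with hB'
  have hder : HasFDerivAt (fun z => φ (f (s z))) B' x :=
    ((hφ.contDiff.differentiable one_ne_zero (f (s x))).hasFDerivAt).comp x hB
  have hdet : |B.det| ≤ |B'.det| := by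
    have h1 : B'.det = (fderiv ℝ φ (f (s x))).det * B.det := LinearMap.det_comp _ _
    rw [h1, abs_mul]
    exact le_mul_of_one_le_left (abs_nonneg _) (hφ.one_le_jac _)
  refine (ENNReal.ofReal_le_ofReal hdet).trans ?_
  suffices h : ENNReal.ofReal |B'.det| ^ (n⁻¹ : ℝ) ≤ hilbTilde (fun w : W => φ (f w)) by
    have h2 := pow_le_pow_left' h n
    rwa [← ENNReal.rpow_natCast, ← ENNReal.rpow_mul, inv_mul_cancel₀ (by exact_mod_cast hn),
      ENNReal.rpow_one] at h2
  rw [hilbTilde, ENNReal.le_div_iff_mul_le (Or.inl (by simp [hn])) (Or.inl (by simp))]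
  refine le_iInf₂ fun μ hμ => le_iInf₂ fun g L => le_iInf₂ fun hL hg =>
    le_iInf₂ fun hg2 hgf => ?_
  have hsx : ContinuousAt s x := hs.continuousOn.continuousAt (hΩ.mem_nhds hx)
  obtain ⟨δ, hδ, hδW⟩ := Metric.mem_nhds_iff.1 (Filter.inter_mem (hΩ.mem_nhds hx) (hsx hW))
  -- The decomposition pulled back along `s`. The value zero is never used, since `s` maps the ball
  -- of radius `δ` into `W`.
  set g' : AxialProjector E → E → ℝ := fun p z => if h : s z ∈ W then g p ⟨s z, h⟩ else 0 with hg'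
  have hg'W : ∀ p, ∀ z (hz : z ∈ Metric.ball x δ), g' p z = g p ⟨s z, (hδW hz).2⟩ :=
    fun p z hz => dif_pos (hδW hz).2
  refine abs_det_rpow_le hn hμ hder hδ (g := g') hL (fun p z hz z' hz' => ?_) (fun z hz => ?_)
    fun z hz => ?_
  · rw [hg'W p z hz, hg'W p z' hz']
    refine (hg p _ _).trans ?_
    gcongr
    simpa using hs (hδW hz).1 (hδW hz').1
  · simp_rw [fun p => hg'W p z hz]
    exact hg2 _
  · simp_rw [fun p => hg'W p z hz]
    exact hgf ⟨s z, (hδW hz).2⟩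

theorem volume_image_eq_zero_of_lipschitzOnWith {K : ℝ≥0} {f : E → E} {N : Set E}
    (hf : LipschitzOnWith K f N) (hN : volume N = 0) : volume (f '' N) = 0 := by
  have h1 : (volume : Measure E) ≪ μH[Module.finrank ℝ E] :=
    Measure.absolutelyContinuous_isAddHaarMeasure _ _
  have h2 : (μH[Module.finrank ℝ E] : Measure E) ≪ volume :=
    Measure.absolutelyContinuous_isAddHaarMeasure _ _
  refine h1 (le_antisymm ((hf.hausdorffMeasure_image_le (by positivity)).trans ?_) zero_le)
  rw [h2 hN, mul_zero]

/-- The global volume of an open subset of a normed space, of smaller norm than the Euclidean norm,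
is at most its Euclidean volume. -/
theorem glbVol_le_volume_range {G : Type*} [AddCommGroup G] {k : ℕ} {M : Type*}
    [PseudoEMetricSpace M] {J : M → EuclideanSpace ℝ (Fin (k + 2))} (hJ : IsOpen (range J))
    {s : EuclideanSpace ℝ (Fin (k + 2)) → M} (hs : LipschitzOnWith 1 s (range J))
    (hsJ : ∀ m, s (J m) = m) : glbVol G (k + 2) M ≤ volume (range J) := by
  refine iSup_le fun f => iSup₂_le fun ⟨K, hK⟩ hjac => ?_
  set F := f ∘ s with hF
  have hFL : LipschitzOnWith K F (range J) := by
    simpa using (hK.lipschitzOnWith (s := univ)).comp hs (mapsTo_univ _ _)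
  have hrange : stableImage G f ⊆ F '' range J := by
    refine (stableImage_subset_range f).trans ?_
    rintro _ ⟨m, rfl⟩
    exact ⟨J m, mem_range_self m, by simp [hF, hsJ]⟩
  set S := range J ∩ {z | DifferentiableAt ℝ F z} with hS
  have hSm : MeasurableSet S := hJ.measurableSet.inter (measurableSet_of_differentiableAt ℝ F)
  -- Rademacher's theorem; the Lipschitz image of this exceptional set is null as well.
  have hnull : volume (range J \ S) = 0 := by
    have h1 := hFL.ae_differentiableWithinAt_of_mem (μ := volume)
    refine measure_mono_null (fun z hz => ?_) h1
    intro h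
    exact hz.2 ⟨hz.1, (h hz.1).differentiableAt (hJ.mem_nhds hz.1)⟩
  have hgood : volume (F '' S) ≤ volume (range J) := by
    refine (addHaar_image_le_lintegral_abs_det_fderiv volume hSm
      (f' := fderiv ℝ F) fun z hz => hz.2.hasFDerivAt.hasFDerivWithinAt).trans ?_
    calc ∫⁻ z in S, ENNReal.ofReal |(fderiv ℝ F z).det| ≤ ∫⁻ _ in S, 1 :=
          setLIntegral_mono measurable_const fun z hz =>
            (abs_det_le_hilJac (by omega) hJ hs hz.1 hz.2.hasFDerivAt).trans (hjac _)
      _ = volume S := by simp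
      _ ≤ volume (range J) := measure_mono inter_subset_left
  calc volume (stableImage G f) ≤ volume (F '' S ∪ F '' (range J \ S)) := by
        refine measure_mono (hrange.trans ?_)
        rw [← image_union]
        exact image_mono fun z hz => by
          by_cases h : z ∈ S
          · exact Or.inl h
          · exact Or.inr ⟨hz, h⟩
    _ ≤ volume (F '' S) + volume (F '' (range J \ S)) := measure_union_le _ _
    _ ≤ volume (range J) := by
        rw [volume_image_eq_zero_of_lipschitzOnWith (hFL.mono sdiff_subset) hnull, add_zero]
        exact hgood

end UpperBound

end HilbertVolume

/-! ### Exteriors on the line, frames, and the two volume bounds -/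

namespace HilbertVolume

section Exterior

/-- In dimension one the exterior of a bounded set is not connected. -/
theorem finrank_ne_one_of_isConnected_exterior {A : Type*} [NormedAddCommGroup A] [NormedSpace ℝ A]
    {U : Set A} (hUb : Bornology.IsBounded U) (hU : U.Nonempty)
    (hUe : IsPreconnected (closure U)ᶜ) : Module.finrank ℝ A ≠ 1 := by
  intro hA
  have : FiniteDimensional ℝ A := Module.finite_of_finrank_eq_succ hA
  have φ : A ≃L[ℝ] ℝ := ContinuousLinearEquiv.ofFinrankEq (by simp [hA])
  have hc : IsPreconnected (φ '' (closure U)ᶜ) := hUe.image _ φ.continuous.continuousOn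
  obtain ⟨R, hR⟩ := (φ.lipschitz.isBounded_image hUb.closure).exists_norm_le
  have hout : ∀ t : ℝ, R < |t| → t ∈ φ '' (closure U)ᶜ := fun t ht =>
    ⟨φ.symm t, fun h => by
      have := hR _ (mem_image_of_mem φ h)
      rw [φ.apply_symm_apply, Real.norm_eq_abs] at this
      linarith, φ.apply_symm_apply t⟩
  obtain ⟨u, hu⟩ := hU
  have hu' := hR _ (mem_image_of_mem φ (subset_closure hu))
  rw [Real.norm_eq_abs] at hu'
  have hR0 : 0 ≤ R := (abs_nonneg _).trans hu'
  have h1 : φ u ∈ φ '' (closure U)ᶜ := hc.ordConnected.out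
    (hout (-(R + 1)) (by rw [abs_neg, abs_of_pos (by linarith)]; linarith))
    (hout (R + 1) (by rw [abs_of_pos (by linarith)]; linarith))
    ⟨by linarith [(abs_le.1 hu').1], by linarith [(abs_le.1 hu').2]⟩
  obtain ⟨z, hz, hzu⟩ := h1
  exact hz (φ.injective hzu ▸ subset_closure hu)

end Exterior

section FormVol

variable {A : Type*} [NormedAddCommGroup A] [NormedSpace ℝ A] {n : ℕ}

/-- The quadratic form `x ↦ ‖T x‖²`. -/
def pullbackForm (T : A ≃L[ℝ] EuclideanSpace ℝ (Fin n)) : QuadraticForm ℝ A :=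
  (LinearMap.BilinMap.toQuadraticMap (innerₗ (EuclideanSpace ℝ (Fin n)))).comp
    T.toLinearEquiv.toLinearMap

theorem isFrame_pullbackForm (T : A ≃L[ℝ] EuclideanSpace ℝ (Fin n)) :
    IsFrame (pullbackForm T) T := fun x => by
  simp [pullbackForm]

/-- Two frames of the same form differ by a linear isometry, which preserves volume. -/
theorem formVol_eq {h : QuadraticForm ℝ A} {T : A ≃L[ℝ] EuclideanSpace ℝ (Fin n)}
    (hT : IsFrame h T) (s : Set A) : formVol n h s = volume (T '' s) := by
  refine le_antisymm (iSup₂_le fun T' hT' => ?_) (le_iSup₂_of_le T hT le_rfl)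
  let R : EuclideanSpace ℝ (Fin n) ≃ₗᵢ[ℝ] EuclideanSpace ℝ (Fin n) :=
    { (T.symm.trans T').toLinearEquiv with
      norm_map' := fun y => by
        have h1 := (hT' (T.symm y)).symm.trans (hT (T.symm y))
        rw [T.apply_symm_apply] at h1
        exact (sq_eq_sq₀ (norm_nonneg _) (norm_nonneg _)).1 h1 }
  have h2 : T' '' s = R.symm ⁻¹' (T '' s) := by
    rw [← R.image_eq_preimage_symm, image_image]
    refine image_congr fun x _ => ?_
    change T' x = T' (T.symm (T x))
    rw [T.symm_apply_apply]
  rw [h2, R.symm.measurePreserving.measure_preimage_emb R.symm.toHomeomorph.measurableEmbedding]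

end FormVol

section Bounds

variable {G : Type*} [AddCommGroup G] {k : ℕ}

theorem glbVol_le_volume_range_of_edist_le {M : Type*} [PseudoEMetricSpace M]
    {J : M → EuclideanSpace ℝ (Fin (k + 2))} (hJo : IsOpen (range J)) (hJi : Function.Injective J)
    (hJ : ∀ m m', edist m m' ≤ edist (J m) (J m')) : glbVol G (k + 2) M ≤ volume (range J) := by
  rcases isEmpty_or_nonempty M with hM | hM
  · refine iSup_le fun f => iSup₂_le fun _ _ => ?_
    refine (measure_mono (stableImage_subset_range f)).trans ?_
    simp [range_eq_empty]
  · refine glbVol_le_volume_range hJo (s := Function.invFun J) ?_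
      (Function.leftInverse_invFun hJi)
    rintro _ ⟨m, rfl⟩ _ ⟨m', rfl⟩
    rw [Function.leftInverse_invFun hJi, Function.leftInverse_invFun hJi]
    simpa using hJ m m'

/-- Bound each global volume by the Euclidean volume of its piece; at every point of `T '' U` the
indicators of the pieces add up to at most the multiplicity. -/
theorem hilVol_le_volume_image {A : Type*} [NormedAddCommGroup A] [NormedSpace ℝ A]
    {T : A ≃L[ℝ] EuclideanSpace ℝ (Fin (k + 2))} (hT : ∀ x, ‖x‖ ≤ ‖T x‖) {U : Set A}
    (hU : IsOpen U) : hilVol G (k + 2) U ≤ volume (T '' U) := by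
  refine iSup₂_le fun V _ => ENNReal.div_le_of_le_mul ?_
  set J : ∀ i, V i → EuclideanSpace ℝ (Fin (k + 2)) := fun i m => T m.1.1 with hJ
  have hrange : ∀ i, range (J i) = T '' (Subtype.val '' (V i : Set U)) := fun i => by
    ext z
    simp only [hJ, mem_range, mem_image, Subtype.exists, SetLike.mem_coe]
    constructor
    · rintro ⟨x, hx, hxV, rfl⟩
      exact ⟨x, ⟨x, hx, hxV, rfl⟩, rfl⟩
    · rintro ⟨_, ⟨x, hx, hxV, rfl⟩, rfl⟩
      exact ⟨x, hx, hxV, rfl⟩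
  have hopen : ∀ i, IsOpen (range (J i)) := fun i => by
    rw [hrange]
    exact T.toHomeomorph.isOpenMap _ (hU.isOpenMap_subtype_val _ (V i).isOpen)
  have h1 : ∀ i, glbVol G (k + 2) (V i) ≤ volume (range (J i)) := fun i => by
    refine glbVol_le_volume_range_of_edist_le (hopen i)
      (fun m m' h => Subtype.ext (Subtype.ext (T.injective h))) fun m m' => ?_
    change edist m.1.1 m'.1.1 ≤ edist (T m.1.1) (T m'.1.1)
    rw [edist_dist, edist_dist, dist_eq_norm, dist_eq_norm, ← map_sub]
    exact ENNReal.ofReal_le_ofReal (hT _)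
  have hTU : MeasurableSet (T '' U) := (T.toHomeomorph.isOpenMap _ hU).measurableSet
  calc ∑' i, glbVol G (k + 2) (V i) ≤ ∑' i, volume (range (J i)) := ENNReal.tsum_le_tsum h1
    _ = ∑' i, ∫⁻ z, (range (J i)).indicator 1 z := by
        simp_rw [fun i => lintegral_indicator_one (μ := volume) (hopen i).measurableSet]
    _ = ∫⁻ z, ∑' i, (range (J i)).indicator 1 z :=
        (lintegral_tsum fun i =>
          (measurable_const.indicator (hopen i).measurableSet).aemeasurable).symm
    _ ≤ ∫⁻ z, (T '' U).indicator (fun _ => (multiplicity V : ℝ≥0∞)) z := by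
        refine lintegral_mono fun z => ?_
        by_cases hz : z ∈ T '' U
        · obtain ⟨x, hx, rfl⟩ := hz
          rw [indicator_of_mem (mem_image_of_mem T hx)]
          have h2 : ∀ i, (range (J i)).indicator (1 : EuclideanSpace ℝ (Fin (k + 2)) → ℝ≥0∞) (T x) =
              {i | (⟨x, hx⟩ : U) ∈ V i}.indicator (fun _ => 1) i := fun i => by
            by_cases hi : (⟨x, hx⟩ : U) ∈ V i
            · rw [indicator_of_mem (show i ∈ {i | (⟨x, hx⟩ : U) ∈ V i} from hi),
                indicator_of_mem (show T x ∈ range (J i) from ⟨⟨⟨x, hx⟩, hi⟩, rfl⟩), Pi.one_apply]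
            · rw [indicator_of_notMem (show i ∉ {i | (⟨x, hx⟩ : U) ∈ V i} from hi),
                indicator_of_notMem]
              rintro ⟨m, hm⟩
              have : m.1 = ⟨x, hx⟩ := Subtype.ext (T.injective hm)
              exact hi (this ▸ m.2)
          simp_rw [h2]
          rw [← tsum_subtype, ENNReal.tsum_set_one]
          exact ENat.toENNReal_le.2 (le_iSup (fun x : U => {i | x ∈ V i}.encard) ⟨x, hx⟩)
        · rw [indicator_of_notMem hz, ENNReal.tsum_eq_zero.2 fun i => ?_]
          refine indicator_of_notMem (fun hi => hz ?_) _
          obtain ⟨m, rfl⟩ := hi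
          exact mem_image_of_mem T m.1.2
    _ = volume (T '' U) * multiplicity V := by
        rw [lintegral_indicator_const hTU, mul_comm]

theorem volume_stableImage_le_hilVol {X : Type*} [PseudoEMetricSpace X]
    (f : C(X, EuclideanSpace ℝ (Fin (k + 2)))) (hf : ∃ K, LipschitzWith K f)
    (hf1 : hilbTilde f ≤ 1) : volume (stableImage G f) ≤ hilVol G (k + 2) X := by
  classical
  -- The one-set system, padded by empty sets. Its multiplicity is at most one, and zero for empty
  -- `X`.
  set V : ℕ → TopologicalSpace.Opens X := fun i => if i = 0 then ⊤ else ⊥ with hV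
  have h0 : V 0 = ⊤ := if_pos rfl
  have hm : multiplicity V ≤ 1 := iSup_le fun x => by
    have : {i | x ∈ V i} = {0} := by
      ext i
      by_cases hi : i = 0 <;> simp [hV, hi]
    rw [this, encard_singleton]
  have hm' : (multiplicity V : ℝ≥0∞) ≤ 1 := by exact_mod_cast ENat.toENNReal_le.2 hm
  refine le_iSup₂_of_le V (hm.trans_lt (by simp)).ne ?_
  set ι : C(X, (⊤ : TopologicalSpace.Opens X)) := ⟨fun x => ⟨x, trivial⟩, by fun_prop⟩
  set f' : C((⊤ : TopologicalSpace.Opens X), EuclideanSpace ℝ (Fin (k + 2))) :=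
    f.comp ⟨Subtype.val, continuous_subtype_val⟩
  have h1 : volume (stableImage G f) ≤ glbVol G (k + 2) (⊤ : TopologicalSpace.Opens X) := by
    have h2 : stableImage G f ⊆ stableImage G f' := stableImage_comp_subset f' ι
    refine (measure_mono h2).trans (le_iSup_of_le f' ?_)
    obtain ⟨K, hK⟩ := hf
    refine le_iSup₂_of_le ⟨K, ?_⟩ (hilJac_le_one ?_) le_rfl
    · rw [← mul_one K]; exact hK.comp (LipschitzWith.subtype_val _)
    · exact (hilbTilde_comp_le f (LipschitzWith.subtype_val _)).trans hf1
  calc volume (stableImage G f) ≤ glbVol G (k + 2) (V 0) := by rwa [h0]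
    _ ≤ ∑' i, glbVol G (k + 2) (V i) := ENNReal.le_tsum 0
    _ = (∑' i, glbVol G (k + 2) (V i)) / 1 := (div_one _).symm
    _ ≤ _ := ENNReal.div_le_div_left hm' _

end Bounds

section Filling

variable {A : Type*} [NormedAddCommGroup A] [NormedSpace ℝ A] {G : Type*} [AddCommGroup G] {k : ℕ}

/-- A `1`-Lipschitz filling of the boundary of `U` has a map to Euclidean space of Hilbert constant
at most `1` for which all points of `T '' U` are stable. -/
theorem exists_image_subset_stableImage {T : A ≃L[ℝ] EuclideanSpace ℝ (Fin (k + 2))}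
    (hT1 : ∀ x, ‖x‖ ≤ ‖T x‖) {ι : Type*} [Fintype ι] {c : ι → ℝ}
    {v : ι → EuclideanSpace ℝ (Fin (k + 2))} (hc : ∀ i, 0 ≤ c i) (hv : ∀ i, ‖v i‖ = 1)
    (hT : ∀ i x, inner ℝ (v i) (T x) ≤ ‖x‖)
    (hcv : ∀ y, ∑ i, (c i * inner ℝ (v i) y) • v i = y)
    {U : Set A} (hUo : IsOpen U) (hUb : Bornology.IsBounded U)
    (hUc : IsConnected U) (hUe : IsConnected (closure U)ᶜ)
    {X : Type*} [MetricSpace X] [CompactSpace X] {Y : Set X}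
    (F : Y → frontier U) (hF : LipschitzWith 1 F)
    (hX : Cech.mapAbs (k + 1) G (⟨Subtype.val, continuous_subtype_val⟩ : C(Y, X)) = 0)
    (hFG : Cech.mapAbs (k + 1) G (⟨F, hF.continuous⟩ : C(Y, frontier U)) ≠ 0) :
    ∃ f : C(X, EuclideanSpace ℝ (Fin (k + 2))), (∃ K, LipschitzWith K f) ∧ hilbTilde f ≤ 1 ∧
      T '' U ⊆ stableImage G f := by
  classical
  have : FiniteDimensional ℝ A := T.symm.toLinearEquiv.finiteDimensional
  have : ProperSpace A := FiniteDimensional.proper ℝ A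
  have : CompactSpace (frontier U) :=
    isCompact_iff_compactSpace.1 (Metric.isCompact_of_isClosed_isBounded isClosed_frontier
      (hUb.closure.subset frontier_subset_closure))
  -- A point is needed to define the inverse of `τ` on all of Euclidean space. An empty frontier
  -- would make `U` empty or everything.
  have : Nonempty (frontier U) := by
    rw [nonempty_coe_sort, nonempty_iff_ne_empty]
    intro h
    rcases isClopen_iff.1 (isClopen_iff_frontier_eq_empty.2 h) with h | h
    · exact hUc.nonempty.ne_empty h
    · obtain ⟨z, hz⟩ := hUe.nonempty
      exact hz (by rw [h, closure_univ]; trivial)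
  set φ : X → A := fun x => if h : x ∈ Y then (F ⟨x, h⟩).1 else 0 with hφ
  have hφY : ∀ y : Y, φ y = F y := fun y => dif_pos y.2
  have hφL : LipschitzOnWith 1 φ Y := fun x hx y hy => by
    rw [hφY ⟨x, hx⟩, hφY ⟨y, hy⟩]
    exact hF ⟨x, hx⟩ ⟨y, hy⟩
  obtain ⟨f, ⟨K, hK⟩, hf1, hfY⟩ :=
    exists_extension_hilbTilde_le_one (by omega) T hv hc hcv hT hφL
  refine ⟨⟨f, hK.continuous⟩, ⟨K, hK⟩, hf1, ?_⟩
  set τ : frontier U → EuclideanSpace ℝ (Fin (k + 2)) := fun q => T q with hτ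
  have hτi : Function.Injective τ := T.injective.comp Subtype.val_injective
  have hfr : range τ = frontier (T '' U) := by
    have h1 : T '' frontier U = frontier (T '' U) := T.toHomeomorph.image_frontier U
    rw [← h1, hτ, ← image_eq_range]
  have hρ : ∀ q, Function.invFun τ (τ q) = q := Function.leftInverse_invFun hτi
  refine subset_stableImage (L' := 1) (L := K) (τ := τ) (ρ := Function.invFun τ)
    (S := T '' U) (T.toHomeomorph.isOpenMap _ hUo) (T.lipschitz.isBounded_image hUb)
    (hUc.isPreconnected.image _ T.continuous.continuousOn) ?_ hfr ?_ hρ ⟨F, hF.continuous⟩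
    (f := ⟨f, hK.continuous⟩) hK (fun y => ?_) hX hFG
  · have h1 : T '' (closure U)ᶜ = (closure (T '' U))ᶜ := by
      rw [image_compl_eq T.bijective]
      exact congrArg _ (T.toHomeomorph.image_closure U)
    rw [← h1]
    exact hUe.isPreconnected.image _ T.continuous.continuousOn
  · rw [← hfr]
    rintro _ ⟨q, rfl⟩ _ ⟨q', rfl⟩
    rw [hρ, hρ]
    change edist q.1 q'.1 ≤ _ * edist (T q.1) (T q'.1)
    rw [edist_dist, edist_dist, dist_eq_norm, dist_eq_norm, ← map_sub]
    simpa using ENNReal.ofReal_le_ofReal (hT1 (q.1 - q'.1))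
  · exact (hfY y y.2).trans (congrArg T (hφY y))

end Filling

end HilbertVolume

end

theorem mainTheorem10 {n : ℕ} (hn : 1 ≤ n)
    {A : Type*} [NormedAddCommGroup A] [NormedSpace ℝ A] (hA : Module.finrank ℝ A = n)
    {U : Set A} (hUo : IsOpen U) (hUb : Bornology.IsBounded U)
    (hUc : IsConnected U) (hUe : IsConnected (closure U)ᶜ)
    {X : Type*} [MetricSpace X] [CompactSpace X] {Y : Set X} (hY : IsClosed Y)
    {G : Type*} [AddCommGroup G]
    (F : Y → frontier U) (hF : LipschitzWith 1 F)
    (hX : Cech.mapAbs (n - 1) G (⟨Subtype.val, continuous_subtype_val⟩ : C(Y, X)) = 0)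
    (hFG : Cech.mapAbs (n - 1) G (⟨F, hF.continuous⟩ : C(Y, frontier U)) ≠ 0) :
    ∃ h : QuadraticForm ℝ A,
      (HilbertVolume.IsJohnForm n h ∧
        ∀ h' : QuadraticForm ℝ A, HilbertVolume.IsJohnForm n h' → h' = h) ∧
      HilbertVolume.hilVol G n U = HilbertVolume.formVol n h U ∧
      HilbertVolume.hilVol G n U ≤ HilbertVolume.hilVol G n X := by
  -- Dimension one is excluded by the connected exterior, so the cohomological degree `n - 1` is
  -- positive.
  obtain ⟨k, rfl⟩ : ∃ k, n = k + 2 := by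
    have h1 : n ≠ 1 := hA ▸ HilbertVolume.finrank_ne_one_of_isConnected_exterior hUb hUc.nonempty
      hUe.isPreconnected
    exact ⟨n - 2, by omega⟩
  obtain ⟨T, ι, _, c, v, hT1, hc, hv, hT, hcv⟩ := HilbertVolume.exists_john (by omega) hA
  have hT2 : HilbertVolume.hilb T ≤ 1 := HilbertVolume.hilb_le_one (by omega) T hv hc hcv hT
  have hframe := HilbertVolume.isFrame_pullbackForm T
  obtain ⟨f, hfK, hf1, hf⟩ := HilbertVolume.exists_image_subset_stableImage hT1 hc hv hT hcv hUo hUb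
    hUc hUe F hF hX hFG
  -- With `Y = univ` nothing is extended: `g` is `T` on `U`, and the point is its Hilbert constant.
  obtain ⟨g, ⟨K, hK⟩, hg1, hgT⟩ := HilbertVolume.exists_extension_hilbTilde_le_one (by omega) T hv
    hc hcv hT (Y := univ) (φ := (Subtype.val : U → A)) (LipschitzWith.subtype_val U).lipschitzOnWith
  have hupper : HilbertVolume.hilVol G (k + 2) U ≤ volume (T '' U) :=
    HilbertVolume.hilVol_le_volume_image hT1 hUo
  have hTU : IsOpen (T '' U) := T.toHomeomorph.isOpenMap _ hUo
  have hsection : T '' U ⊆ HilbertVolume.stableImage G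
      (⟨g, hK.continuous⟩ : C(U, EuclideanSpace ℝ (Fin (k + 2)))) := fun y hy => by
    have hmem : ∀ z : T '' U, T.symm z ∈ U := by
      rintro ⟨_, x, hx, rfl⟩
      simpa using hx
    -- The non-vanishing of the local cohomology with coefficients in `G` is borrowed from the
    -- filling `f`, for which `y` is already stable.
    refine HilbertVolume.mem_stableImage_of_section _ f (hf hy) (hTU.mem_nhds hy)
      ⟨fun z => ⟨T.symm z, hmem z⟩, by fun_prop⟩ fun z => ?_
    exact (hgT _ (mem_univ _)).trans (T.apply_symm_apply _)
  refine ⟨HilbertVolume.pullbackForm T, ⟨⟨T, hframe, hT1, hT2⟩, ?_⟩, ?_, ?_⟩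
  · rintro h' ⟨T', hh', hT1', hT2'⟩
    ext x
    rw [hh' x, hframe x, HilbertVolume.norm_eq_of_hilb_le_one (by omega) T T' hT1 hT1' hT2 hT2']
  · rw [HilbertVolume.formVol_eq hframe]
    exact hupper.antisymm ((measure_mono hsection).trans
      (HilbertVolume.volume_stableImage_le_hilVol _ ⟨K, hK⟩ hg1))
  · exact hupper.trans ((measure_mono hf).trans
      (HilbertVolume.volume_stableImage_le_hilVol f hfK hf1))
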